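/- **Setting.** Let $\mathbb K=\mathbb R$ or $\mathbb C$, and let $b,p,K\ge 1$, $B=pb$, $B'=pb-b+1$, $L\ge B$ with $L\mid n$, and $L'=L+2pb-b$ be integers with $n\ge Kb+2L'+K+1$. Let $\Phi\in\mathbb K^{m\times n}$ have columns of Euclidean norm $1$; $\Phi_S$ is the submatrix of the columns with index in $S$. *PIBS supports.* $S\subseteq\{1,\dots,n\}$ is a PIBS support with parameters $(b,p,l,L',K,R)$ if it is the union of "true clusters", i.e. intervals of lengths $j_1b,\dots,j_gb$ with $1\le j_s\le p$ and $\sum_s j_s=K$, any two consecutive ones separated by at least $L'$ indices, and of at most $R$ "pseudo blocks", i.e. intervals of length $l$ disjoint from each other and from the true clusters. A vector is PIBS (generalized block sparse) with these parameters if its support is such a set. The PIBRIC is $\delta_{b,p,l,L'}(K,R)=\max_S\|\Phi_S^H\Phi_S-I\|_{2\to2}$ over all PIBS supports $S$ with parameters $(b,p,l,L',k,r)$, $k\le K$, $r\le R$. *TSGBOMP* with input $y,\Phi,K,\epsilon,L,b,p$: start with $T^0=\emptyset$, $r^0=y$, $k=0$. While $\|r^k\|\ge\epsilon$ and $k<K$: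 increase $k$ by one; choose a window $W=\{(w-1)L+1,\dots,wL\}$, $1\le w\le n/L$, that maximizes $\|\Phi_W^Hr^{k-1}\|$; among the intervals $\{i,\dots,i+B-1\}\subseteq\{1,\dots,n\}$ that meet $W$ choose one, $h^k$, that maximizes $\|\Phi_{h^k}^Hr^{k-1}\|$; put $T^k=T^{k-1}\cup h^k$ (as index sets), let $x^k$ minimize $\|y-\Phi u\|$ over all $u$ supported in $T^k$, and $r^k=y-\Phi x^k$. Ties are broken arbitrarily. **Theorem.** Let $x\in\mathbb K^n$ be PIBS with parameters $(b,p,L,L',K,0)$, with $g\ (\le K)$ true clusters, and $y=\Phi x+e$ with $\|e\|\le\epsilon$. Let $\delta=\delta_{b,p,L',L'}(K-1,2)$, and let $x_{\min}$, $x_{\max}$ be the smallest and largest modulus of a nonzero entry of $x$. Assume $\delta<\frac1{\sqrt{2K+1}}$ and, in the real case $\mathbb K=\mathbb R$, $$x_{\min}>\frac{x_{\max}\,\delta\sqrt{B'b}}{1+\delta}\Big[\frac{K}{4B'}(1+\delta)+\sqrt{K+1}+1\Big]+\frac{\sqrt{2(1+B')(1+\delta)}\,\epsilon}{1-\delta\sqrt{2K+1}},$$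 respectively, in the complex case $\mathbb K=\mathbb C$, $$x_{\min}>\frac{\Big[\delta\sqrt{Kb}+\frac{\delta(1-\delta^2)\sqrt{B'b}}{1+\delta}\big[\frac{K}{4B'}(1+\delta)+\sqrt{K+1}+1\big]\Big]x_{\max}}{\sqrt{(1-\delta^2)^2+\delta^2}}+\frac{\sqrt{2(1+B')(1+\delta)}\,\epsilon}{1-\delta\sqrt{2K+1}}.$$ Then TSGBOMP recovers the support of $x$ within $K$ iterations. Precisely: the algorithm can be executed, and every execution performs at least $g$ and at most $K$ iterations (exactly $g$ if $\|e\|<\epsilon$); each of the first $g$ iterations selects an interval $h^k$ of length $pb$ that contains another true cluster, so that $\operatorname{supp}(x)\subseteq T^g$, with equality if all true clusters have length $pb$ (for instance if $p=1$), and the final set contains $\operatorname{supp}(x)$ too; and the least squares vector $x^g$ identifies the support exactly: $|x^g_s|>|x^g_t|$ for all $s\in\operatorname{supp}(x)$, $t\notin\operatorname{supp}(x)$, and $x^g=x$ if $e=0$. -/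

import Mathlib

open scoped Matrix

noncomputable section

namespace TSGBOMP

variable {𝕜 : Type*} [RCLike 𝕜] {m n : ℕ}

/-! Indices are counted from `0`: the signal lives on `Fin n`. -/

/-- The set of the `len` consecutive indices `a, a + 1, …, a + len - 1`. -/
def interval (n a len : ℕ) : Finset (Fin n) :=
  Finset.univ.filter fun i => a ≤ (i : ℕ) ∧ (i : ℕ) < a + len

/-- `c s` and `j s * b` are the first index and the length of the `s`-th true cluster: every cluster
lies in the signal range and consists of between `1` and `p` blocks of length `b`, there are `K`
blocks altogether, and two consecutive clusters are separated by at least `L'` indices. -/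
structure TrueClusters (n b p L' K : ℕ) {g : ℕ} (c j : Fin g → ℕ) : Prop where
  one_le : ∀ s, 1 ≤ j s
  le_p : ∀ s, j s ≤ p
  sum_eq : ∑ s, j s = K
  in_range : ∀ s, c s + j s * b ≤ n
  separated : ∀ s s', s < s' → c s + j s * b + L' ≤ c s'

/-- The set of indices covered by the true clusters. -/
def clusterSet (n b : ℕ) {g : ℕ} (c j : Fin g → ℕ) : Finset (Fin n) :=
  Finset.univ.biUnion fun s => interval n (c s) (j s * b)

/-- `S` is the support pattern of a pseudoblock interleaved block sparse (PIBS) vector with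
parameters `(b, p, l, L', K, R)`: true clusters with `K` blocks altogether, and at most `R`
pseudo blocks of length `l`, disjoint from each other and from the true clusters. -/
def IsPIBSSupport (b p l L' K R : ℕ) (S : Finset (Fin n)) : Prop :=
  ∃ (g : ℕ) (c j : Fin g → ℕ) (q : ℕ) (a : Fin q → ℕ),
    TrueClusters n b p L' K c j ∧
    q ≤ R ∧
    (∀ u, a u + l ≤ n) ∧
    (∀ u u', u < u' → a u + l ≤ a u') ∧
    (∀ u s, a u + l ≤ c s ∨ c s + j s * b ≤ a u) ∧
    S = clusterSet n b c j ∪ Finset.univ.biUnion fun u => interval n (a u) l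

open Classical in
/-- The support of a vector. -/
def supp (x : EuclideanSpace 𝕜 (Fin n)) : Finset (Fin n) :=
  Finset.univ.filter fun i => x i ≠ 0

/-- `x` is a PIBS vector with parameters `(b, p, l, L', K, R)`. -/
def IsPIBS (b p l L' K R : ℕ) (x : EuclideanSpace 𝕜 (Fin n)) : Prop :=
  IsPIBSSupport b p l L' K R (supp x)

/-- The submatrix of the columns with index in `S`. -/
def colSub (Φ : Matrix (Fin m) (Fin n) 𝕜) (S : Finset (Fin n)) : Matrix (Fin m) S 𝕜 :=
  Φ.submatrix id (fun i => (i : Fin n))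

/-- The `ℓ² → ℓ²` operator norm of `Φ_Sᴴ Φ_S - I`. -/
def gramDeviation (Φ : Matrix (Fin m) (Fin n) 𝕜) (S : Finset (Fin n)) : ℝ :=
  ‖Matrix.toEuclideanCLM (n := S) (𝕜 := 𝕜) ((colSub Φ S)ᴴ * colSub Φ S - 1)‖

/-- The pseudoblock interleaved block restricted isometry constant (PIBRIC) of order `(K, R)`
with parameters `b, p, l, L'`: the maximum of `‖Φ_Sᴴ Φ_S - I‖` over the finitely many
supports `S` of PIBS vectors with parameters `(b, p, l, L', k, r)`, `k ≤ K`, `r ≤ R`. -/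
def pibric (Φ : Matrix (Fin m) (Fin n) 𝕜) (b p l L' K R : ℕ) : ℝ :=
  ⨆ S : {S : Finset (Fin n) // ∃ k ≤ K, ∃ r ≤ R, IsPIBSSupport b p l L' k r S},
    gramDeviation Φ S.1

/-- The matrix-vector product as a vector of the Euclidean space. -/
def mulE {m n : ℕ} (A : Matrix (Fin m) (Fin n) 𝕜) (v : EuclideanSpace 𝕜 (Fin n)) :
    EuclideanSpace 𝕜 (Fin m) :=
  WithLp.toLp 2 (A *ᵥ v.ofLp)

/-- `‖Φ_Sᴴ r‖₂`, the size of the correlations of `r` with the columns in `S`. -/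
def corrNorm (Φ : Matrix (Fin m) (Fin n) 𝕜) (S : Finset (Fin n))
    (r : EuclideanSpace 𝕜 (Fin m)) : ℝ :=
  Real.sqrt (∑ i ∈ S, ‖mulE Φᴴ r i‖ ^ 2)

/-- The `w`-th window of length `L`. -/
def window (n L w : ℕ) : Finset (Fin n) := interval n (w * L) L

/-- The first indices `i, i + b, …, i + (p - 1) b` of the blocks of the cluster of length `p b`
that starts at `i`. -/
def blockStarts (b p i : ℕ) : Finset ℕ := (Finset.range p).image fun t => i + t * b

/-- The set of all indices in the blocks of length `b` that start at an element of `T`. -/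
def blockIndices (n b : ℕ) (T : Finset ℕ) : Finset (Fin n) := T.biUnion fun t => interval n t b

/-- `i` is the first index of a cluster of length `B` of indices of the signal which overlaps the
`w`-th window. -/
def IsCandidate (n B L w i : ℕ) : Prop := i + B ≤ n ∧ i < (w + 1) * L ∧ w * L < i + B

/-- The residual `y - Φ z`. -/
def residual (Φ : Matrix (Fin m) (Fin n) 𝕜) (y : EuclideanSpace 𝕜 (Fin m))
    (z : EuclideanSpace 𝕜 (Fin n)) : EuclideanSpace 𝕜 (Fin m) :=
  y - mulE Φ z

/-- An execution of TSGBOMP on the input `y, Φ, K, ε, L, b, p` that performs `N` iterations. In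
iteration `k + 1` it selects the window `w (k + 1)` and the cluster of length `p b` that starts at
`i (k + 1)`, and computes the set `T (k + 1)` of first indices of blocks and the least squares
vector `z (k + 1)`. Ties in the maximizations may be broken in any way. -/
structure IsRun (Φ : Matrix (Fin m) (Fin n) 𝕜) (y : EuclideanSpace 𝕜 (Fin m))
    (b p L K : ℕ) (ε : ℝ) (N : ℕ) (w i : ℕ → ℕ) (T : ℕ → Finset ℕ)
    (z : ℕ → EuclideanSpace 𝕜 (Fin n)) : Prop where
  T_zero : T 0 = ∅
  z_zero : z 0 = 0
  /-- the loop condition holds before each of the `N` iterations -/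
  loop : ∀ k < N, ε ≤ ‖residual Φ y (z k)‖ ∧ k < K
  /-- the loop condition fails after the last iteration -/
  exit_cond : ¬ (ε ≤ ‖residual Φ y (z N)‖ ∧ N < K)
  window_mem : ∀ k < N, w (k + 1) < n / L
  window_max : ∀ k < N, ∀ l < n / L,
    corrNorm Φ (window n L l) (residual Φ y (z k)) ≤
      corrNorm Φ (window n L (w (k + 1))) (residual Φ y (z k))
  cluster_mem : ∀ k < N, IsCandidate n (p * b) L (w (k + 1)) (i (k + 1))
  cluster_max : ∀ k < N, ∀ l, IsCandidate n (p * b) L (w (k + 1)) l →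
    corrNorm Φ (blockIndices n b (blockStarts b p l)) (residual Φ y (z k)) ≤
      corrNorm Φ (blockIndices n b (blockStarts b p (i (k + 1)))) (residual Φ y (z k))
  T_succ : ∀ k < N, T (k + 1) = T k ∪ blockStarts b p (i (k + 1))
  supp_z : ∀ k < N, supp (z (k + 1)) ⊆ blockIndices n b (T (k + 1))
  least_squares : ∀ k < N, ∀ u : EuclideanSpace 𝕜 (Fin n),
    supp u ⊆ blockIndices n b (T (k + 1)) →
      ‖residual Φ y (z (k + 1))‖ ≤ ‖residual Φ y u‖

/-- TSGBOMP recovers the support of `x` within `K` iterations from `y = Φ x + e`. Here `g` is the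
number of true clusters. As the algorithm selects clusters of the fixed length `p b`, the estimated
support `blockIndices n b (T g)` is the true one up to the padding of the clusters that
have less than `p` blocks, and the support is then given by the dominating entries of the
least squares vector. -/
def RecoversSupport (Φ : Matrix (Fin m) (Fin n) 𝕜) (x : EuclideanSpace 𝕜 (Fin n))
    (e : EuclideanSpace 𝕜 (Fin m)) (b p L L' K : ℕ) (ε : ℝ) : Prop :=
  (∃ N w i T z, IsRun Φ (mulE Φ x + e) b p L K ε N w i T z) ∧
  ∃ (g : ℕ) (c j : Fin g → ℕ), TrueClusters n b p L' K c j ∧ supp x = clusterSet n b c j ∧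
    ∀ N w i T z, IsRun Φ (mulE Φ x + e) b p L K ε N w i T z →
      g ≤ N ∧ N ≤ K ∧ (‖e‖ < ε → N = g) ∧
      -- each of the first `g` iterations selects another true cluster
      (∃ σ : Equiv.Perm (Fin g), ∀ k : Fin g,
        i (k + 1) ≤ c (σ k) ∧ c (σ k) + j (σ k) * b ≤ i (k + 1) + p * b) ∧
      supp x ⊆ blockIndices n b (T g) ∧
      supp x ⊆ blockIndices n b (T N) ∧
      ((∀ s, j s = p) → blockIndices n b (T g) = supp x) ∧
      -- the least squares vector singles out the support
      (∀ s ∈ supp x, ∀ t ∉ supp x, ‖z g t‖ < ‖z g s‖) ∧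
      (e = 0 → z g = x)

/-- The smallest modulus of a nonzero entry. -/
def xmin (x : EuclideanSpace 𝕜 (Fin n)) : ℝ := sInf ((fun i => ‖x i‖) '' {i | x i ≠ 0})

/-- The largest modulus of a nonzero entry. -/
def xmax (x : EuclideanSpace 𝕜 (Fin n)) : ℝ := sSup ((fun i => ‖x i‖) '' {i | x i ≠ 0})

/-- The standing assumptions: `b, p, K ≥ 1`, windows of length `L ≥ p b` that partition the signal
range, separation `L' = L + 2 p b - b`, a signal that is long enough, and columns of norm one. -/
structure Setting (Φ : Matrix (Fin m) (Fin n) 𝕜) (b p L L' K : ℕ) : Prop where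
  one_le_b : 1 ≤ b
  one_le_p : 1 ≤ p
  one_le_K : 1 ≤ K
  le_L : p * b ≤ L
  dvd : L ∣ n
  sep : L' = L + 2 * p * b - b
  long : K * b + 2 * L' + K + 1 ≤ n
  unit_columns : ∀ i, ∑ s, ‖Φ s i‖ ^ 2 = 1

end TSGBOMP

end

/-! Suppose that the intervals selected so far contain the true clusters with index in `A`, one
each. Let `T` be their union and `u` the part of `x` on the other clusters. Least squares makes the
residual equal to `Φ (u - v) + e'` with `v` supported in `T`, both terms orthogonal to the columns
of `T`, and `‖e'‖ ≤ ‖e‖`. Hence off `T` the correlations `q` are `u` plus a perturbation `dev Φ (u -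
v) + Φᴴ e'`. Measure it jointly on an undiscovered index `i₀` and an interval `D` of length at most
`L` that misses the undiscovered clusters. If its norm is at most `β` with `√2 β < |x i₀|`, then the
correlations on all of `D` are smaller than the one at `i₀` (`corrNorm_lt_of_disjoint`).

This comparison drives the algorithm. A window without undiscovered indices loses to the window of
`i₀`. An interval that misses part of an undiscovered cluster near the window loses to a shifted
one, which trades such a `D` for a missed index (`exists_selected`). The same perturbation bound and
the unit columns keep the residual at least `ε`, so the loop does not stop early. Induction yields
`g` iterations with `g` different clusters, and a lower isometry bound on the selected columns then
puts `z g` close to `x`.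

The difficulty is that `δ` has order `(K - 1, 2)`, while `T` may contain up to `g p` blocks. Three
kinds of sets fit that order: all true clusters and one interval; all but two true clusters and the
paddings of those two; every `p`-th padding and one interval. Splitting `v` into `p` residue classes
costs `√p`, and adding up the intervals of `T` costs `√|A|`. So `‖v‖` is controlled when `ρ = √(|A|
p) δ < 1`, and the perturbation is at most `η ‖u‖` plus noise with `η = δ / (1 - ρ)`. For `p = 1` no
splitting is needed and `η = δ`.

What is left is numerical: `√2 η √((K - |A|) b)` is at most the coefficient `errorFactor` of `xmax`.
The complex condition implies the one for real signals, so a single argument serves both fields. -/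

namespace TSGBOMP

/-- A set of indices contained in the support of a PIBS vector with at most `K` true blocks and
at most two pseudo blocks of length `L'`. -/
def Covered {n : ℕ} (b p L' K : ℕ) (A : Finset (Fin n)) : Prop :=
  ∃ S, (∃ k ≤ K, ∃ r ≤ 2, IsPIBSSupport b p L' L' k r S) ∧ A ⊆ S

/-- True clusters indexed by an initial segment of the natural numbers. -/
structure ClusterSeq (n b p L' g : ℕ) (c j : ℕ → ℕ) : Prop where
  one_le : ∀ i < g, 1 ≤ j i
  le_p : ∀ i < g, j i ≤ p
  in_range : ∀ i < g, c i + j i * b ≤ n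
  separated : ∀ i i', i < i' → i' < g → c i + j i * b + L' ≤ c i'

theorem mem_interval {n a len : ℕ} {x : Fin n} :
    x ∈ interval n a len ↔ a ≤ (x : ℕ) ∧ (x : ℕ) < a + len := by
  simp [interval]

theorem mem_clusterSet {n b g : ℕ} {c j : Fin g → ℕ} {x : Fin n} :
    x ∈ clusterSet n b c j ↔ ∃ s, c s ≤ (x : ℕ) ∧ (x : ℕ) < c s + j s * b := by
  simp [clusterSet, mem_interval]

/-! ### Fitting pseudo blocks between clusters -/

section cover

variable {n b p L' g K : ℕ} {c j : ℕ → ℕ}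

/-- Dropping clusters only widens the gaps, so any subset `F`, listed in increasing order, is again
a family of true clusters. -/
theorem ClusterSeq.covered (h : ClusterSeq n b p L' g c j) {F : Finset ℕ}
    (hF : F ⊆ Finset.range g) (hsum : ∑ i ∈ F, j i ≤ K) {q : ℕ} (hq : q ≤ 2) (a : Fin q → ℕ)
    (ha : ∀ u, a u + L' ≤ n) (hord : ∀ u u', u < u' → a u + L' ≤ a u')
    (hdis : ∀ u, ∀ i ∈ F, a u + L' ≤ c i ∨ c i + j i * b ≤ a u) {A : Finset (Fin n)}
    (hA : ∀ x ∈ A, (∃ i ∈ F, c i ≤ (x : ℕ) ∧ (x : ℕ) < c i + j i * b) ∨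
      ∃ u, a u ≤ (x : ℕ) ∧ (x : ℕ) < a u + L') :
    Covered b p L' K A := by
  have hm : ∀ s : Fin F.card, F.orderEmbOfFin rfl s ∈ F := fun s => Finset.orderEmbOfFin_mem ..
  have hg : ∀ s : Fin F.card, F.orderEmbOfFin rfl s < g := fun s =>
    Finset.mem_range.1 (hF (hm s))
  refine ⟨_, ⟨∑ i ∈ F, j i, hsum, 2, le_rfl, F.card, fun s => c (F.orderEmbOfFin rfl s),
    fun s => j (F.orderEmbOfFin rfl s), q, a, ?_, hq, ha, hord, ?_, rfl⟩, ?_⟩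
  · refine ⟨fun s => h.one_le _ (hg s), fun s => h.le_p _ (hg s), ?_,
      fun s => h.in_range _ (hg s), fun s s' hs => h.separated _ _ ?_ (hg s')⟩
    · conv_rhs => rw [← Finset.map_orderEmbOfFin_univ F rfl]
      rw [Finset.sum_map]
      rfl
    · exact (F.orderEmbOfFin rfl).strictMono hs
  · intro u s
    exact hdis u _ (hm s)
  · intro x hx
    rcases hA x hx with ⟨i, hi, hx⟩ | ⟨u, hu⟩
    · refine Finset.mem_union_left _ (mem_clusterSet.2 ?_)
      obtain ⟨s, hs⟩ : ∃ s, F.orderEmbOfFin rfl s = i := by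
        have : i ∈ Set.range (F.orderEmbOfFin rfl) := by
          rw [Finset.range_orderEmbOfFin]; exact hi
        exact this
      exact ⟨s, by simpa only [hs] using hx⟩
    · refine Finset.mem_union_right _ (Finset.mem_biUnion.2 ⟨u, Finset.mem_univ _, ?_⟩)
      exact mem_interval.2 hu

theorem ClusterSeq.covered_one (h : ClusterSeq n b p L' g c j) {F : Finset ℕ}
    (hF : F ⊆ Finset.range g) (hsum : ∑ i ∈ F, j i ≤ K) {lo hi a e : ℕ}
    (hlen : lo + L' ≤ hi) (hn : hi ≤ n) (hout : ∀ i ∈ F, c i + j i * b ≤ lo ∨ hi ≤ c i)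
    (ha : lo ≤ a) (he : e ≤ hi) (hae : e ≤ a + L') {A : Finset (Fin n)}
    (hA : ∀ x ∈ A, (∃ i ∈ F, c i ≤ (x : ℕ) ∧ (x : ℕ) < c i + j i * b) ∨
      (a ≤ (x : ℕ) ∧ (x : ℕ) < e)) :
    Covered b p L' K A := by
  -- The pseudo block starts at `a`, or is pushed back to end at `hi` if it would overrun the free
  -- stretch.
  refine h.covered hF hsum (q := 1) (by norm_num) (fun _ => min a (hi - L')) ?_ ?_ ?_ ?_
  · intro _; omega
  · intro u u' huu; exact absurd huu (by rw [Subsingleton.elim u u']; exact lt_irrefl _)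
  · intro _ i hi'
    have := hout i hi'
    omega
  · intro x hx
    rcases hA x hx with hx | hx
    · exact Or.inl hx
    · right
      refine ⟨0, ?_⟩
      omega

theorem ClusterSeq.covered_two (h : ClusterSeq n b p L' g c j) {F : Finset ℕ}
    (hF : F ⊆ Finset.range g) (hsum : ∑ i ∈ F, j i ≤ K) {lo hi a e a' e' : ℕ}
    (hlen : lo + 2 * L' ≤ hi) (hn : hi ≤ n) (hout : ∀ i ∈ F, c i + j i * b ≤ lo ∨ hi ≤ c i)
    (ha : lo ≤ a) (he : e ≤ hi) (hae : e ≤ a + L') (he' : e' ≤ hi) (haa : a ≤ a')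
    (hae' : e' ≤ a' + L') {A : Finset (Fin n)}
    (hA : ∀ x ∈ A, (∃ i ∈ F, c i ≤ (x : ℕ) ∧ (x : ℕ) < c i + j i * b) ∨
      (a ≤ (x : ℕ) ∧ (x : ℕ) < e) ∨ (a' ≤ (x : ℕ) ∧ (x : ℕ) < e')) :
    Covered b p L' K A := by
  obtain ⟨x₁, x₂, h1, h2, h3, h4⟩ : ∃ x₁ x₂, lo ≤ x₁ ∧ x₁ + L' ≤ x₂ ∧ x₂ + L' ≤ hi ∧
      ∀ i, (a ≤ i ∧ i < e) ∨ (a' ≤ i ∧ i < e') →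
        (x₁ ≤ i ∧ i < x₁ + L') ∨ (x₂ ≤ i ∧ i < x₂ + L') := by
    -- With enough room to the right of `a` the first block starts there and the second follows as
    -- far as needed. Otherwise the last `2 L'` indices of the stretch contain both intervals.
    by_cases hc : a ≤ hi - 2 * L'
    · refine ⟨a, min (max a' (a + L')) (hi - L'), ha, by omega, by omega, fun i hi => by omega⟩
    · exact ⟨hi - 2 * L', hi - L', by omega, by omega, by omega, fun i hi => by omega⟩
  refine h.covered hF hsum (q := 2) le_rfl ![x₁, x₂] ?_ ?_ ?_ ?_
  · rw [Fin.forall_fin_two]; simp only [Matrix.cons_val_zero, Matrix.cons_val_one]; omega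
  · intro u u' huu
    have hu : u = 0 := by omega
    have hu' : u' = 1 := by omega
    subst hu hu'
    simpa using h2
  · rw [Fin.forall_fin_two]
    simp only [Matrix.cons_val_zero, Matrix.cons_val_one]
    refine ⟨fun i hi' => ?_, fun i hi' => ?_⟩ <;> have := hout i hi' <;> omega
  · intro x hx
    rcases hA x hx with hx | hx
    · exact Or.inl hx
    · right
      rcases h4 _ hx with hx | hx
      · exact ⟨0, by simpa using hx⟩
      · exact ⟨1, by simpa using hx⟩

end cover

/-- The end of the last cluster before the `i`-th gap. -/
def gapStart (b : ℕ) (c j : ℕ → ℕ) : ℕ → ℕ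
  | 0 => 0
  | i + 1 => c i + j i * b

/-- The start of the first cluster after the `i`-th gap. -/
def gapEnd (n g : ℕ) (c : ℕ → ℕ) (i : ℕ) : ℕ := if i < g then c i else n

/-! ### Clusters together with one interval -/

section cover

variable {n b p L' g K : ℕ} {c j : ℕ → ℕ}

theorem gapEnd_of_lt {i : ℕ} (h : i < g) : gapEnd n g c i = c i := if_pos h

theorem gapEnd_self : gapEnd n g c g = n := if_neg (lt_irrefl _)

theorem ClusterSeq.gapEnd_le (h : ClusterSeq n b p L' g c j) (i : ℕ) : gapEnd n g c i ≤ n := by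
  unfold gapEnd
  split_ifs with hi
  · have := h.in_range i hi; omega
  · exact le_rfl

theorem ClusterSeq.gapStart_add_le (h : ClusterSeq n b p L' g c j) {i : ℕ} (h0 : 0 < i)
    (hi : i < g) : gapStart b c j i + L' ≤ c i := by
  obtain ⟨i, rfl⟩ := Nat.exists_eq_succ_of_ne_zero h0.ne'
  exact h.separated i (i + 1) (Nat.lt_succ_self i) hi

theorem ClusterSeq.gapStart_le (h : ClusterSeq n b p L' g c j) {i : ℕ}
    (hi : i < g) : gapStart b c j i ≤ c i := by
  rcases Nat.eq_zero_or_pos i with rfl | h0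
  · exact Nat.zero_le _
  · have := h.gapStart_add_le h0 hi; omega

theorem ClusterSeq.end_le_gapStart (h : ClusterSeq n b p L' g c j) {i i' : ℕ} (hii : i < i')
    (hi' : i' ≤ g) : c i + j i * b ≤ gapStart b c j i' := by
  obtain ⟨k, rfl⟩ := Nat.exists_eq_succ_of_ne_zero (Nat.ne_zero_of_lt hii)
  rcases Nat.lt_succ_iff_lt_or_eq.1 hii with h1 | rfl
  · have := h.separated i k h1 hi'
    simp only [gapStart]; omega
  · exact le_rfl

theorem ClusterSeq.gapEnd_le_start (h : ClusterSeq n b p L' g c j) {i i' : ℕ} (hii : i' ≤ i)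
    (hi : i < g) : gapEnd n g c i' ≤ c i := by
  rw [gapEnd_of_lt (by omega)]
  rcases hii.lt_or_eq with h1 | rfl
  · have := h.separated i' i h1 hi; omega
  · exact le_rfl

/-- A gap after the first cluster, together with a cluster next to it, is long. -/
theorem ClusterSeq.gapEnd_succ (h : ClusterSeq n b p L' g c j) {i : ℕ} (hi : i + 1 < g) :
    gapStart b c j (i + 1) + L' ≤ gapEnd n g c (i + 1) := by
  rw [gapEnd_of_lt hi]; exact h.gapStart_add_le (Nat.succ_pos i) hi

theorem exists_gap {a e : ℕ} (hn : e ≤ n)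
    (hI : ∀ i < g, e ≤ c i ∨ c i + j i * b ≤ a) :
    ∃ r ≤ g, gapStart b c j r ≤ a ∧ e ≤ gapEnd n g c r := by
  -- Scan the clusters from the left: either a suitable gap has been found, or the last cluster
  -- passed ends before `a`.
  have key : ∀ r ≤ g, (gapStart b c j r ≤ a ∧ e ≤ gapEnd n g c r) ∨
      (∃ r' ≤ g, gapStart b c j r' ≤ a ∧ e ≤ gapEnd n g c r') ∨ (gapStart b c j r ≤ a) := by
    intro r
    induction r with
    | zero => exact fun _ => Or.inr (Or.inr (Nat.zero_le _))
    | succ r ih =>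
      intro hr
      rcases hI r hr with h1 | h1
      · rcases ih (by omega) with h2 | h2 | h2
        · exact Or.inr (Or.inl ⟨r, by omega, h2⟩)
        · exact Or.inr (Or.inl h2)
        · exact Or.inr (Or.inl ⟨r, by omega, h2, by rw [gapEnd_of_lt hr]; exact h1⟩)
      · exact Or.inr (Or.inr h1)
  rcases key g le_rfl with h2 | h2 | h2
  · exact ⟨g, le_rfl, h2⟩
  · exact h2
  · exact ⟨g, le_rfl, h2, by rw [gapEnd_self]; exact hn⟩

/-- Clusters that leave at most `K` blocks when one of them is dropped, and an interval of
length at most `L`, are covered by a PIBS support with at most `K` true blocks and two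
pseudo blocks. -/
theorem ClusterSeq.covered_union_interval (h : ClusterSeq n b p L' g c j) {L : ℕ}
    (hL : L + p * b ≤ L') (hb : 1 ≤ b) (hlong : 2 * L' ≤ n)
    (hsum : ∀ i < g, ∑ i' ∈ (Finset.range g).erase i, j i' ≤ K)
    (htight : g = 2 → c 1 < 2 * L' → n < c 0 + j 0 * b + 2 * L' → c 1 + j 1 * b ≤ c 0 + 2 * L')
    {a e : ℕ} (hae : e ≤ a + L) (hn : e ≤ n) {A : Finset (Fin n)}
    (hA : ∀ x ∈ A, (∃ i < g, c i ≤ (x : ℕ) ∧ (x : ℕ) < c i + j i * b) ∨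
      (a ≤ (x : ℕ) ∧ (x : ℕ) < e)) :
    Covered b p L' K A := by
  have hjb : ∀ i < g, j i * b ≤ p * b := fun i hi => Nat.mul_le_mul_right _ (h.le_p i hi)
  have hjpos : ∀ i < g, 1 ≤ j i * b := fun i hi => Nat.mul_pos (h.one_le i hi) hb
  have hout : ∀ i < g, ∀ i' ∈ (Finset.range g).erase i,
      c i' + j i' * b ≤ gapStart b c j i ∨ gapEnd n g c (i + 1) ≤ c i' := by
    intro i hi i' hi'
    rw [Finset.mem_erase, Finset.mem_range] at hi'
    rcases lt_or_gt_of_ne hi'.1 with h1 | h1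
    · exact Or.inl (h.end_le_gapStart h1 hi.le)
    · exact Or.inr (h.gapEnd_le_start h1 hi'.2)
  have hsplit : ∀ i < g, ∀ x ∈ A, (∃ i' ∈ (Finset.range g).erase i, c i' ≤ (x : ℕ) ∧
      (x : ℕ) < c i' + j i' * b) ∨ (c i ≤ (x : ℕ) ∧ (x : ℕ) < c i + j i * b) ∨
      (a ≤ (x : ℕ) ∧ (x : ℕ) < e) := by
    intro i hi x hx
    rcases hA x hx with ⟨i', hi', hx⟩ | hx
    · by_cases hii : i' = i
      · subst hii; exact Or.inr (Or.inl hx)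
      · exact Or.inl ⟨i', Finset.mem_erase.2 ⟨hii, Finset.mem_range.2 hi'⟩, hx⟩
    · exact Or.inr (Or.inr hx)
  -- Dropping cluster `i` merges the two gaps around it. At least one of them has length `L'`,
  -- unless `i` is the only cluster; then the merged gap is the whole signal.
  have hreg : ∀ i < g, gapStart b c j i + L' ≤ gapEnd n g c (i + 1) := by
    intro i hi
    rcases Nat.lt_or_ge (i + 1) g with h1 | h1
    · have := h.gapEnd_succ h1
      have h2 := h.gapStart_le hi
      have h3 : gapStart b c j (i + 1) = c i + j i * b := rfl
      omega
    · have h2 : i + 1 = g := by omega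
      rw [h2, gapEnd_self]
      rcases Nat.eq_zero_or_pos i with rfl | h0
      · simp only [gapStart]; omega
      · have := h.gapStart_add_le h0 hi
        have := h.in_range i hi
        omega
  -- If the interval hits cluster `i`, their hull has length at most `L + p b ≤ L'`, so after
  -- dropping `i` a single pseudo block suffices.
  by_cases hmeet : ∃ i < g, c i < e ∧ a < c i + j i * b
  · obtain ⟨i, hi, h1, h2⟩ := hmeet
    refine h.covered_one (Finset.erase_subset i _) (hsum i hi) (hreg i hi)
      (h.gapEnd_le _) (hout i hi) (a := min a (c i)) (e := max e (c i + j i * b)) ?_ ?_ ?_ ?_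
    · have := h.gapStart_le hi
      rcases Nat.eq_zero_or_pos i with rfl | h0
      · exact Nat.zero_le _
      · have := h.gapStart_add_le h0 hi
        omega
    · have h4 : c i + j i * b ≤ gapEnd n g c (i + 1) := by
        rcases Nat.lt_or_ge (i + 1) g with h3 | h3
        · have := h.gapEnd_succ h3
          simp only [gapStart] at this; omega
        · rw [show i + 1 = g by omega, gapEnd_self]; exact h.in_range i hi
      have h5 : e ≤ gapEnd n g c (i + 1) := by
        rcases Nat.lt_or_ge (i + 1) g with h3 | h3
        · have := h.gapEnd_succ h3
          simp only [gapStart] at this; omega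
        · rw [show i + 1 = g by omega, gapEnd_self]; exact hn
      exact max_le h5 h4
    · have := hjb i hi
      omega
    · intro x hx
      rcases hsplit i hi x hx with h6 | h6 | h6
      · exact Or.inl h6
      · right; omega
      · right; omega
  push Not at hmeet
  obtain ⟨r, hr, hra, hre⟩ := exists_gap (b := b) (g := g) (c := c) (j := j) (a := a) (e := e) hn
      (fun i hi => by
    have := hmeet i hi; omega)
  rcases Nat.eq_zero_or_pos g with rfl | hg
  · refine h.covered_one (F := ∅) (by simp) (by simp) (lo := 0) (hi := n) (by omega) le_rfl
      (by simp) (Nat.zero_le a) hn (by omega) ?_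
    intro x hx
    rcases hA x hx with ⟨i', hi', hx⟩ | hx
    · omega
    · exact Or.inr hx
  -- The interval lies in gap `r`. If the gap merged by dropping a neighbouring cluster has length
  -- `2 L'`, the cluster and the interval get one pseudo block each.
  have hleft : ∀ i, i + 1 = r → gapStart b c j i + 2 * L' ≤ gapEnd n g c r →
      Covered b p L' K A := by
    intro i hir hlen
    subst hir
    have hi : i < g := hr
    have h3 : c i + j i * b ≤ a := hra
    refine h.covered_two (Finset.erase_subset i _) (hsum i hi) hlen (h.gapEnd_le _) (hout i hi)
      (a := c i) (e := c i + j i * b) (a' := a) (e' := e) (h.gapStart_le hi) ?_ ?_ hre ?_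
      (by omega) (hsplit i hi)
    · have := hreg i hi
      rcases Nat.lt_or_ge (i + 1) g with h3 | h3
      · have := h.gapEnd_succ h3
        simp only [gapStart] at this; omega
      · rw [show i + 1 = g by omega, gapEnd_self]; exact h.in_range i hi
    · have := hjb i hi; omega
    · omega
  have hright : r < g → gapStart b c j r + 2 * L' ≤ gapEnd n g c (r + 1) →
      Covered b p L' K A := by
    intro hrg hlen
    rw [gapEnd_of_lt hrg] at hre
    have h4 : c r + j r * b ≤ gapEnd n g c (r + 1) := by
      rcases Nat.lt_or_ge (r + 1) g with h3 | h3
      · have := h.gapEnd_succ h3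
        simp only [gapStart] at this; omega
      · rw [show r + 1 = g by omega, gapEnd_self]; exact h.in_range r hrg
    have hjp := hjb r hrg
    by_cases haa : a ≤ c r
    · refine h.covered_two (Finset.erase_subset r _) (hsum r hrg) hlen (h.gapEnd_le _)
        (hout r hrg) (a := a) (e := e) (a' := c r) (e' := c r + j r * b) hra ?_ ?_ h4
        haa ?_ ?_
      · omega
      · omega
      · omega
      · intro x hx
        rcases hsplit r hrg x hx with h6 | h6 | h6
        · exact Or.inl h6
        · exact Or.inr (Or.inr h6)
        · exact Or.inr (Or.inl h6)
    · refine h.covered_two (Finset.erase_subset r _) (hsum r hrg) hlen (h.gapEnd_le _)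
        (hout r hrg) (a := c r) (e := c r + j r * b) (a' := c r) (e' := c r + j r * b)
        (h.gapStart_le hrg) h4 ?_ h4
        le_rfl ?_ ?_
      · omega
      · omega
      · intro x hx
        rcases hsplit r hrg x hx with h6 | h6 | h6
        · exact Or.inl h6
        · exact Or.inr (Or.inr h6)
        · exfalso; omega
  rcases Nat.eq_zero_or_pos r with rfl | hr0
  · by_cases h2 : gapStart b c j 0 + 2 * L' ≤ gapEnd n g c (0 + 1)
    · exact hright hg h2
    · have h1 : 1 < g := by
        by_contra h1
        have h3 : 0 + 1 = g := by omega
        rw [h3, gapEnd_self] at h2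
        simp only [gapStart] at h2
        omega
      have h3 := h.gapEnd_succ h1
      have h4 : gapStart b c j (0 + 1) = c 0 + j 0 * b := rfl
      have h5 : gapStart b c j 0 = 0 := rfl
      rw [gapEnd_of_lt hg] at hre
      -- The gap behind cluster `0` takes `L'` of fewer than `2 L'` indices, so everything up to the
      -- end of that cluster fits into one pseudo block.
      refine h.covered_one (Finset.erase_subset 0 _) (hsum 0 hg) (hreg 0 hg)
        (h.gapEnd_le _) (hout 0 hg) (a := 0) (e := c 0 + j 0 * b) ?_ ?_ ?_ ?_
      · omega
      · omega
      · omega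
      · intro x hx
        rcases hsplit 0 hg x hx with h6 | h6 | h6
        · exact Or.inl h6
        · right; omega
        · right; omega
  · obtain ⟨i, rfl⟩ := Nat.exists_eq_succ_of_ne_zero hr0.ne'
    rw [Nat.succ_eq_add_one] at *
    by_cases h2 : gapStart b c j i + 2 * L' ≤ gapEnd n g c (i + 1)
    · exact hleft i rfl h2
    have hi : i < g := hr
    have h4 : gapStart b c j (i + 1) = c i + j i * b := rfl
    have hi0 : i + 1 < g → i = 0 := by
      intro h1
      by_contra h0
      have := h.gapStart_add_le (Nat.pos_of_ne_zero h0) hi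
      have := h.gapEnd_succ h1
      omega
    rcases hr.lt_or_eq with hrg | hrg
    · by_cases h3 : gapStart b c j (i + 1) + 2 * L' ≤ gapEnd n g c (i + 1 + 1)
      · exact hright hrg h3
      have h0 := hi0 hrg
      subst h0
      have hg2 : 0 + 1 + 1 = g := by
        by_contra h5
        have h6 := h.gapEnd_succ (i := 0 + 1) (by omega)
        have h7 := h.gapStart_add_le (i := 0 + 1) (by omega) (by omega)
        have h8 : gapStart b c j (0 + 1 + 1) = c 1 + j 1 * b := rfl
        simp only [zero_add] at *
        omega
      rw [hg2, gapEnd_self] at h3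
      rw [gapEnd_of_lt hrg] at h2 hre
      have h5 : gapStart b c j 0 = 0 := rfl
      -- There are only two clusters, the interval lies between them, and both merged gaps are
      -- short. Now both clusters are dropped: `htight` says that everything fits into `2 L'`
      -- consecutive indices.
      have h7 := htight hg2.symm (by simp only [zero_add] at *; omega)
        (by simp only [zero_add] at *; omega)
      refine h.covered_two (F := ∅) (by simp) (by simp) (lo := 0) (hi := n) (by omega) le_rfl
        (by simp) (a := c 0) (e := min (c 0 + L') n) (a' := min (c 0 + L') n)
        (e' := c 1 + j 1 * b) (Nat.zero_le _) (by omega) (by omega)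
        (h.in_range 1 (by omega)) ?_ ?_ ?_
      · have := h.in_range 0 hg; omega
      · have := h.in_range 1 (by omega); omega
      · intro x hx
        have := h.separated 0 1 (by omega) (by omega)
        simp only [zero_add] at *
        rcases hA x hx with ⟨i', hi', hx⟩ | hx
        · have : i' = 0 ∨ i' = 1 := by omega
          rcases this with rfl | rfl <;> omega
        · omega
    · rw [hrg, gapEnd_self] at h2
      have h0 : 0 < i := by
        by_contra h0
        have h1 : i = 0 := by omega
        subst h1
        have h5 : gapStart b c j 0 = 0 := rfl
        omega
      have h5 := h.gapStart_add_le h0 hi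
      have h6 := h.in_range i hi
      -- The mirror image at the right end: from `c i` to the end of the signal there are fewer than
      -- `L'` indices.
      refine h.covered_one (Finset.erase_subset i _) (hsum i hi) (hreg i hi)
        (h.gapEnd_le _) (hout i hi) (a := c i) (e := n) (by omega) ?_ ?_ ?_
      · rw [hrg, gapEnd_self]
      · omega
      · intro x hx
        have := x.2
        rcases hsplit i hi x hx with h6 | h6 | h6
        · exact Or.inl h6
        · right; omega
        · right; omega

end cover

/-! ### The three kinds of covered sets -/

section cover

variable {n b p L L' g K : ℕ}

/-- The relations between the parameters of `Setting`. -/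
structure Sizes (n b p L L' K : ℕ) : Prop where
  one_le_b : 1 ≤ b
  one_le_p : 1 ≤ p
  le_L : p * b ≤ L
  sep : L' = L + 2 * p * b - b
  long : K * b + 2 * L' + K + 1 ≤ n

theorem Sizes.L_add_le (hs : Sizes n b p L L' K) : L + p * b ≤ L' := by
  have h1 := Nat.mul_le_mul_right b hs.one_le_p
  have h2 := hs.sep
  rw [mul_assoc] at h2
  omega

theorem Sizes.b_le (hs : Sizes n b p L L' K) : b ≤ p * b := by
  have h1 := Nat.mul_le_mul_right b hs.one_le_p
  omega

/-- Extension of a finite family to all natural numbers. -/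
def extend (f : Fin g → ℕ) (i : ℕ) : ℕ := if h : i < g then f ⟨i, h⟩ else 0

@[simp] theorem extend_val (f : Fin g → ℕ) (s : Fin g) : extend f s = f s := by
  simp [extend]

theorem extend_of_lt (f : Fin g → ℕ) {i : ℕ} (h : i < g) : extend f i = f ⟨i, h⟩ := dif_pos h

theorem TrueClusters.clusterSeq {c j : Fin g → ℕ} (h : TrueClusters n b p L' K c j) :
    ClusterSeq n b p L' g (extend c) (extend j) := by
  refine ⟨fun i hi => ?_, fun i hi => ?_, fun i hi => ?_, fun i i' hii hi' => ?_⟩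
  · rw [extend_of_lt _ hi]; exact h.one_le _
  · rw [extend_of_lt _ hi]; exact h.le_p _
  · rw [extend_of_lt _ hi, extend_of_lt _ hi]; exact h.in_range _
  · rw [extend_of_lt _ (hii.trans hi'), extend_of_lt _ (hii.trans hi'), extend_of_lt _ hi']
    exact h.separated _ _ hii

theorem TrueClusters.sum_range {c j : Fin g → ℕ} (h : TrueClusters n b p L' K c j) :
    ∑ i ∈ Finset.range g, extend j i = K := by
  rw [← h.sum_eq, Finset.sum_range]
  simp

theorem TrueClusters.card_le {c j : Fin g → ℕ} (h : TrueClusters n b p L' K c j) : g ≤ K := by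
  rw [← h.sum_eq]
  calc g = ∑ _s : Fin g, 1 := by simp
    _ ≤ _ := Finset.sum_le_sum fun s _ => h.one_le s

theorem ClusterSeq.start_add_le {c j : ℕ → ℕ} (h : ClusterSeq n b p L' g c j) (i d : ℕ)
    (hd : i + d < g) : c i + d * (L' + b) ≤ c (i + d) := by
  induction d with
  | zero => simp
  | succ d ih =>
    have h1 := ih (by omega)
    have h2 := h.separated (i + d) (i + (d + 1)) (by omega) hd
    have h3 := Nat.mul_le_mul_right b (h.one_le (i + d) (by omega))
    rw [Nat.succ_mul]
    omega

variable {c j : Fin g → ℕ}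

theorem covered_clusterSet_union_interval (hs : Sizes n b p L L' K)
    (hc : TrueClusters n b p L' K c j) (a len : ℕ) (hlen : len ≤ L) :
    Covered b p L' (K - 1) (clusterSet n b c j ∪ interval n a len) := by
  have hq := hc.clusterSeq
  have hsum := hc.sum_range
  refine hq.covered_union_interval (a := a) (e := min (a + len) n) hs.L_add_le hs.one_le_b
    (by have := hs.long; omega) ?_ ?_ (by omega) (by omega) ?_
  · intro i hi
    have := hq.one_le i hi
    rw [← Finset.add_sum_erase _ _ (Finset.mem_range.2 hi)] at hsum
    omega
  -- The lower bound on `n` turns `n < c 0 + j 0 * b + 2 L'` into `j 1 * b < c 0`, which together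
  -- with `c 1 < 2 L'` is what is needed.
  · intro hg h1 h2
    subst hg
    rw [Finset.sum_range_succ, Finset.sum_range_one] at hsum
    have h3 := hs.long
    rw [← hsum, add_mul] at h3
    omega
  · intro x hx
    rcases Finset.mem_union.1 hx with hx | hx
    · obtain ⟨s, hs⟩ := mem_clusterSet.1 hx
      exact Or.inl ⟨s, s.2, by simpa using hs⟩
    · have := mem_interval.1 hx
      have := x.2
      right; omega

/-- Intervals of length `p b` in the signal range that contain the true clusters. -/
def Padding (n b p : ℕ) (c j i : Fin g → ℕ) : Prop :=
  ∀ s, i s ≤ c s ∧ c s + j s * b ≤ i s + p * b ∧ i s + p * b ≤ n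

/-- Both clusters are dropped, and each padding, of length `p b ≤ L'`, gets a pseudo block. For
non-adjacent clusters each block has its own merged gap. For adjacent ones the gap between them and
an outer gap provide `2 L'` indices, or, if there are no other clusters, the whole signal does. -/
theorem covered_of_two_paddings (hs : Sizes n b p L L' K)
    (hc : TrueClusters n b p L' K c j) {i : Fin g → ℕ} (hi : Padding n b p c j i)
    {s s' : Fin g} (hss : s < s') {A : Finset (Fin n)}
    (hA : ∀ x ∈ A, (∃ r, r ≠ s ∧ r ≠ s' ∧ x ∈ interval n (c r) (j r * b)) ∨
      x ∈ interval n (i s) (p * b) ∨ x ∈ interval n (i s') (p * b)) :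
    Covered b p L' (K - 1) A := by
  have hq := hc.clusterSeq
  have hsum := hc.sum_range
  have hL := hs.L_add_le
  have hLp := hs.le_L
  have hlong := hs.long
  have hb1 := hs.one_le_b
  have hbp := hs.b_le
  obtain ⟨s, hsg⟩ := s
  obtain ⟨s', hsg'⟩ := s'
  have h1 := hi ⟨s, hsg⟩
  have h1' := hi ⟨s', hsg'⟩
  set d := i ⟨s, hsg⟩
  set d' := i ⟨s', hsg'⟩
  rw [← extend_of_lt c hsg, ← extend_of_lt j hsg] at h1
  rw [← extend_of_lt c hsg', ← extend_of_lt j hsg'] at h1'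
  have hss : s < s' := hss
  set F := ((Finset.range g).erase s).erase s' with hF
  have hFg : F ⊆ Finset.range g :=
    (Finset.erase_subset _ _).trans (Finset.erase_subset _ _)
  have hFmem : ∀ r, r ∈ F ↔ r ≠ s' ∧ r ≠ s ∧ r < g := by
    intro r; simp [hF]
  have hFsum : ∑ r ∈ F, extend j r ≤ K - 1 := by
    have h2 := hq.one_le s hsg
    rw [← Finset.add_sum_erase _ _ (Finset.mem_range.2 hsg)] at hsum
    have h3 : ∑ r ∈ F, extend j r ≤ ∑ r ∈ (Finset.range g).erase s, extend j r :=
      Finset.sum_le_sum_of_subset (Finset.erase_subset _ _)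
    omega
  have hmem : ∀ x ∈ A, (∃ r ∈ F, extend c r ≤ (x : ℕ) ∧
      (x : ℕ) < extend c r + extend j r * b) ∨
      (d ≤ (x : ℕ) ∧ (x : ℕ) < d + p * b) ∨ (d' ≤ (x : ℕ) ∧ (x : ℕ) < d' + p * b) := by
    intro x hx
    rcases hA x hx with ⟨r, hr, hr', hx⟩ | hx | hx
    · refine Or.inl ⟨r, (hFmem r).2 ⟨fun h => hr' (Fin.ext h), fun h => hr (Fin.ext h), r.2⟩, ?_⟩
      simpa using mem_interval.1 hx
    · exact Or.inr (Or.inl (mem_interval.1 hx))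
    · exact Or.inr (Or.inr (mem_interval.1 hx))
  generalize extend c = c at *
  generalize extend j = j at *
  have hlow : ∀ t < g, ∀ d, c t + j t * b ≤ d + p * b → gapStart b c j t ≤ d := by
    intro t ht d hd
    rcases Nat.eq_zero_or_pos t with rfl | h0
    · exact Nat.zero_le _
    · have := hq.gapStart_add_le h0 ht; omega
  have hhigh : ∀ t < g, ∀ d, d ≤ c t → d + p * b ≤ n → d + p * b ≤ gapEnd n g c (t + 1) := by
    intro t ht d hd hn
    rcases Nat.lt_or_ge (t + 1) g with h3 | h3
    · have := hq.gapEnd_succ h3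
      simp only [gapStart] at this; omega
    · rw [show t + 1 = g by omega, gapEnd_self]; exact hn
  have hout : ∀ t < g, ∀ r < g, r ≠ t →
      c r + j r * b ≤ gapStart b c j t ∨ gapEnd n g c (t + 1) ≤ c r := by
    intro t ht r hr hrt
    rcases lt_or_gt_of_ne hrt with h1 | h1
    · exact Or.inl (hq.end_le_gapStart h1 ht.le)
    · exact Or.inr (hq.gapEnd_le_start h1 hr)
  have hreg : ∀ t < g, gapStart b c j t + L' ≤ gapEnd n g c (t + 1) := by
    intro t ht
    rcases Nat.lt_or_ge (t + 1) g with h1 | h1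
    · have := hq.gapEnd_succ h1
      have h2 := hq.gapStart_le ht
      have h3 : gapStart b c j (t + 1) = c t + j t * b := rfl
      omega
    · rw [show t + 1 = g by omega, gapEnd_self]
      rcases Nat.eq_zero_or_pos t with rfl | h0
      · simp only [gapStart]; omega
      · have := hq.gapStart_add_le h0 ht
        have := hq.in_range t ht
        omega
  have hl := hlow s hsg d h1.2.1
  have hl' := hlow s' hsg' d' h1'.2.1
  have hh := hhigh s hsg d h1.1 h1.2.2
  have hh' := hhigh s' hsg' d' h1'.1 h1'.2.2
  have hr := hreg s hsg
  have hr' := hreg s' hsg'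
  have hmid := hq.separated s s' hss hsg'
  rcases (Nat.succ_le_of_lt hss).lt_or_eq with hlt | rfl
  · have hgg : gapEnd n g c (s + 1) ≤ gapStart b c j s' := by
      have h3 := hq.end_le_gapStart hlt hsg'.le
      have h4 := hq.gapEnd_le_start (le_refl (s + 1)) (by omega)
      rw [Nat.succ_eq_add_one] at h3
      omega
    have hn' := hq.gapEnd_le (s' + 1)
    refine hq.covered hFg hFsum (q := 2) le_rfl
      ![min d (gapEnd n g c (s + 1) - L'), min d' (gapEnd n g c (s' + 1) - L')] ?_ ?_ ?_ ?_
    · rw [Fin.forall_fin_two]; simp only [Matrix.cons_val_zero, Matrix.cons_val_one]; omega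
    · intro u u' huu
      have hu : u = 0 := by omega
      have hu' : u' = 1 := by omega
      subst hu hu'
      simp only [Matrix.cons_val_zero, Matrix.cons_val_one]
      omega
    · rw [Fin.forall_fin_two]
      simp only [Matrix.cons_val_zero, Matrix.cons_val_one]
      refine ⟨fun r hr' => ?_, fun r hr' => ?_⟩
      · have h5 := (hFmem r).1 hr'
        have := hout s hsg r h5.2.2 h5.2.1
        omega
      · have h5 := (hFmem r).1 hr'
        have := hout s' hsg' r h5.2.2 h5.1
        omega
    · intro x hx
      rcases hmem x hx with hx | hx | hx
      · exact Or.inl hx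
      · right
        refine ⟨0, ?_⟩
        simp only [Matrix.cons_val_zero]
        omega
      · right
        refine ⟨1, ?_⟩
        simp only [Matrix.cons_val_one, Matrix.cons_val_zero]
        omega
  · rw [Nat.succ_eq_add_one] at *
    have hgs1 : gapStart b c j (s + 1) = c s + j s * b := rfl
    have hgs2 : gapStart b c j (s + 1 + 1) = c (s + 1) + j (s + 1) * b := rfl
    have hgs : gapStart b c j s ≤ gapStart b c j (s + 1) := by
      have := hq.gapStart_le hsg
      rw [hgs1]; omega
    have hge : gapEnd n g c (s + 1) ≤ gapEnd n g c (s + 1 + 1) := by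
      rw [gapEnd_of_lt hsg']
      omega
    refine hq.covered_two hFg hFsum (lo := gapStart b c j s) (hi := gapEnd n g c (s + 1 + 1))
      ?_ (hq.gapEnd_le _) ?_ hl (by omega) (by omega) hh' ?_ (by omega) hmem
    · rcases Nat.eq_zero_or_pos s with rfl | h0
      · have h5 : gapStart b c j 0 = 0 := rfl
        rcases Nat.lt_or_ge (0 + 1 + 1) g with h3 | h3
        · have : gapStart b c j (0 + 1 + 1) + L' ≤ gapEnd n g c (0 + 1 + 1) := hq.gapEnd_succ h3
          omega
        · rw [show 0 + 1 + 1 = g by omega, gapEnd_self]; omega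
      · have := hq.gapStart_add_le h0 hsg
        have := hq.in_range _ hsg'
        rcases Nat.lt_or_ge (s + 1 + 1) g with h3 | h3
        · have := hq.gapEnd_succ h3
          omega
        · rw [show s + 1 + 1 = g by omega, gapEnd_self]; omega
    · intro r hr
      have h5 := (hFmem r).1 hr
      have h6 := hout s hsg r h5.2.2 h5.2.1
      have h7 := hout (s + 1) hsg' r h5.2.2 h5.1
      rcases h6 with h6 | h6
      · exact Or.inl h6
      · rcases h7 with h7 | h7
        · rw [gapEnd_of_lt hsg'] at h6
          have : r ≠ s + 1 := h5.1
          rcases lt_or_gt_of_ne h5.2.1 with h8 | h8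
          · exact Or.inl (hq.end_le_gapStart h8 hsg.le)
          · have := hq.separated (s + 1) r (by omega) h5.2.2
            omega
        · exact Or.inr h7
    · omega

/-- The left side bounds `t` by `⌈(g - ρ) / p⌉`, the number of indices below `g` of the form `ρ + p
* t`; truncated subtraction gives `0` when `ρ` exceeds `g`. -/
theorem lt_classCard_iff {ρ : ℕ} (hp : 1 ≤ p) (t : ℕ) :
    t < (g - ρ + (p - 1)) / p ↔ ρ + p * t < g := by
  rw [Nat.lt_iff_add_one_le, Nat.le_div_iff_mul_le (by omega), Nat.succ_mul, mul_comm p t]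
  omega

/-- Paddings `p` clusters apart are so far from each other that they count as true clusters of `p`
blocks, however they are aligned. There is one for every `p` clusters, so without one of them at
most `g - 1 ≤ K - 1` blocks remain. -/
theorem covered_paddings_union_interval (hs : Sizes n b p L L' K) (hp : 2 ≤ p)
    (hc : TrueClusters n b p L' K c j) {i : Fin g → ℕ} (hi : Padding n b p c j i)
    (ρ : ℕ) (a len : ℕ) (hlen : len ≤ L) :
    Covered b p L' (K - 1)
      (((Finset.univ.filter fun r : Fin g => (r : ℕ) % p = ρ).biUnion
        fun r => interval n (i r) (p * b)) ∪ interval n a len) := by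
  have hq := hc.clusterSeq
  have hgK := hc.card_le
  have hb := hs.one_le_b
  have hpad : ∀ t < g, extend i t ≤ extend c t ∧ extend c t + b ≤ extend i t + p * b ∧
      extend i t + p * b ≤ n := by
    intro t ht
    rw [extend_of_lt i ht, extend_of_lt c ht]
    have h1 := hi ⟨t, ht⟩
    have h2 := Nat.mul_le_mul_right b (hc.one_le ⟨t, ht⟩)
    omega
  have hL := hs.L_add_le
  have hLp := hs.le_L
  have hbp := hs.b_le
  have hlt := fun t => lt_classCard_iff (g := g) (ρ := ρ) hs.one_le_p t
  set G := (g - ρ + (p - 1)) / p with hG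
  have hstep : ∀ t t', t < t' → t' < G →
      extend i (ρ + p * t) + p * L' + b ≤ extend i (ρ + p * t') := by
    intro t t' htt ht'
    rw [hlt] at ht'
    have h0 : p * t + p ≤ p * t' := by
      have := Nat.mul_le_mul_left p (Nat.succ_le_of_lt htt)
      rwa [Nat.mul_succ] at this
    have h1 := hpad (ρ + p * t) (by omega)
    have h2 := hpad (ρ + p * t') ht'
    have h3 := hq.start_add_le (ρ + p * t) (p * t' - p * t) (by omega)
    rw [show ρ + p * t + (p * t' - p * t) = ρ + p * t' by omega] at h3
    have h4 := Nat.mul_le_mul_right (L' + b) (show p ≤ p * t' - p * t by omega)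
    rw [mul_add p L' b] at h4
    omega
  have hpL : p * L' = L' + (p - 1) * L' := by
    conv_lhs => rw [show p = 1 + (p - 1) by omega, add_mul, one_mul]
  have hpb : p * b = b + (p - 1) * b := by
    conv_lhs => rw [show p = 1 + (p - 1) by omega, add_mul, one_mul]
  have hbL := Nat.mul_le_mul_left (p - 1) (show b ≤ L' by omega)
  have hseq : ClusterSeq n b p L' G (fun t => extend i (ρ + p * t)) (fun _ => p) := by
    refine ⟨fun _ _ => hs.one_le_p, fun _ _ => le_rfl,
      fun t ht => (hpad _ ((hlt t).1 ht)).2.2, fun t t' htt ht' => ?_⟩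
    have := hstep t t' htt ht'
    omega
  refine hseq.covered_union_interval (a := a) (e := min (a + len) n) hs.L_add_le hs.one_le_b
    (by have := hs.long; omega) ?_ ?_ (by omega) (by omega) ?_
  · intro t ht
    rw [Finset.sum_const, Finset.card_erase_of_mem (Finset.mem_range.2 ht), Finset.card_range,
      smul_eq_mul]
    have := (hlt (G - 1)).1 (by omega)
    rw [mul_comm p] at this
    omega
  -- The tight case does not occur: the second padding starts after `p L' ≥ 2 L'`.
  · intro hG2 h1 h2
    exfalso
    have h3 := (hlt 1).1 (by omega)
    have h4 := hstep 0 1 (by omega) (by omega)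
    have h5 := hs.long
    have h6 := Nat.mul_le_mul_right b (show p + 1 ≤ K by omega)
    have h7 := Nat.mul_le_mul_right L' hp
    rw [add_mul] at h6
    omega
  · intro x hx
    rcases Finset.mem_union.1 hx with hx | hx
    · obtain ⟨r, hr, hx⟩ := Finset.mem_biUnion.1 hx
      have hrρ : (r : ℕ) % p = ρ := (Finset.mem_filter.1 hr).2
      have hdiv : ρ + p * ((r : ℕ) / p) = r := by rw [← hrρ]; exact Nat.mod_add_div _ _
      refine Or.inl ⟨(r : ℕ) / p, (hlt _).2 (by rw [hdiv]; exact r.2), ?_⟩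
      simp only [hdiv, extend_val]
      exact mem_interval.1 hx
    · have := mem_interval.1 hx
      have := x.2
      right; omega

end cover

/-! ### Restriction of vectors and the isometry constant -/

noncomputable section

variable {𝕜 : Type*} [RCLike 𝕜] {m n : ℕ}

/-- The vector that agrees with `v` on `A` and vanishes elsewhere. -/
def restr (A : Finset (Fin n)) (v : EuclideanSpace 𝕜 (Fin n)) : EuclideanSpace 𝕜 (Fin n) :=
  WithLp.toLp 2 fun i => if i ∈ A then v i else 0

@[simp] theorem restr_apply (A : Finset (Fin n)) (v : EuclideanSpace 𝕜 (Fin n)) (i : Fin n) :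
    restr A v i = if i ∈ A then v i else 0 := rfl

theorem norm_restr_sq (A : Finset (Fin n)) (v : EuclideanSpace 𝕜 (Fin n)) :
    ‖restr A v‖ ^ 2 = ∑ i ∈ A, ‖v i‖ ^ 2 := by
  rw [EuclideanSpace.norm_sq_eq, ← Finset.sum_filter_add_sum_filter_not _ (· ∈ A)]
  rw [Finset.sum_congr rfl (g := fun i => ‖v i‖ ^ 2),
    Finset.sum_eq_zero (s := Finset.univ.filter (· ∉ A)), add_zero]
  · congr 1; ext; simp
  · intro i hi; simp [(Finset.mem_filter.1 hi).2]
  · intro i hi; simp [(Finset.mem_filter.1 hi).2]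

theorem restr_add (A : Finset (Fin n)) (v w : EuclideanSpace 𝕜 (Fin n)) :
    restr A (v + w) = restr A v + restr A w := by
  ext i; by_cases h : i ∈ A <;> simp [h]

theorem restr_sub (A : Finset (Fin n)) (v w : EuclideanSpace 𝕜 (Fin n)) :
    restr A (v - w) = restr A v - restr A w := by
  ext i; by_cases h : i ∈ A <;> simp [h]

theorem restr_sum {ι : Type*} (A : Finset (Fin n)) (s : Finset ι)
    (f : ι → EuclideanSpace 𝕜 (Fin n)) : restr A (∑ a ∈ s, f a) = ∑ a ∈ s, restr A (f a) := by
  classical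
  induction s using Finset.induction_on with
  | empty => ext i; simp
  | insert a s ha ih => rw [Finset.sum_insert ha, Finset.sum_insert ha, restr_add, ih]

theorem norm_restr_mono {A B : Finset (Fin n)} (h : A ⊆ B) (v : EuclideanSpace 𝕜 (Fin n)) :
    ‖restr A v‖ ≤ ‖restr B v‖ := by
  rw [← sq_le_sq₀ (norm_nonneg _) (norm_nonneg _), norm_restr_sq, norm_restr_sq]
  exact Finset.sum_le_sum_of_subset_of_nonneg h fun _ _ _ => sq_nonneg _

theorem supp_subset_iff {v : EuclideanSpace 𝕜 (Fin n)} {A : Finset (Fin n)} :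
    supp v ⊆ A ↔ ∀ i, i ∉ A → v i = 0 := by
  simp only [supp, Finset.subset_iff, Finset.mem_filter, Finset.mem_univ, true_and]
  exact forall_congr' fun i => by rw [not_imp_comm]

theorem mem_supp {v : EuclideanSpace 𝕜 (Fin n)} {i : Fin n} : i ∈ supp v ↔ v i ≠ 0 := by
  simp [supp]

theorem restr_eq_self {v : EuclideanSpace 𝕜 (Fin n)} {A : Finset (Fin n)} (h : supp v ⊆ A) :
    restr A v = v := by
  ext i
  by_cases hi : i ∈ A
  · simp [hi]
  · simp [hi, supp_subset_iff.1 h i hi]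

theorem supp_restr_subset (A : Finset (Fin n)) (v : EuclideanSpace 𝕜 (Fin n)) :
    supp (restr A v) ⊆ A :=
  supp_subset_iff.2 fun i hi => by simp [hi]

theorem restr_congr {A : Finset (Fin n)} {v w : EuclideanSpace 𝕜 (Fin n)}
    (h : ∀ i ∈ A, v i = w i) : restr A v = restr A w := by
  ext i; by_cases hi : i ∈ A <;> simp [hi, h]

theorem norm_restr_union_sq {A B : Finset (Fin n)} (h : Disjoint A B)
    (v : EuclideanSpace 𝕜 (Fin n)) :
    ‖restr (A ∪ B) v‖ ^ 2 = ‖restr A v‖ ^ 2 + ‖restr B v‖ ^ 2 := by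
  simp only [norm_restr_sq, Finset.sum_union h]

theorem norm_restr_union_sq_le (A B : Finset (Fin n)) (v : EuclideanSpace 𝕜 (Fin n)) :
    ‖restr (A ∪ B) v‖ ^ 2 ≤ ‖restr A v‖ ^ 2 + ‖restr B v‖ ^ 2 := by
  have h : A ∪ B = A ∪ (B \ A) := by simp
  rw [h, norm_restr_union_sq Finset.disjoint_sdiff]
  have := norm_restr_mono (Finset.sdiff_subset : B \ A ⊆ B) v
  gcongr

theorem norm_restr_biUnion_sq {ι : Type*} [DecidableEq ι] {s : Finset ι}
    {t : ι → Finset (Fin n)} (h : (s : Set ι).PairwiseDisjoint t)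
    (v : EuclideanSpace 𝕜 (Fin n)) :
    ‖restr (s.biUnion t) v‖ ^ 2 = ∑ a ∈ s, ‖restr (t a) v‖ ^ 2 := by
  simp only [norm_restr_sq, Finset.sum_biUnion h]

theorem sum_restr {ι : Type*} [DecidableEq ι] {s : Finset ι}
    {t : ι → Finset (Fin n)} (h : (s : Set ι).PairwiseDisjoint t)
    (v : EuclideanSpace 𝕜 (Fin n)) : ∑ a ∈ s, restr (t a) v = restr (s.biUnion t) v := by
  induction s using Finset.induction_on with
  | empty => ext i; simp
  | insert a s ha ih =>
    rw [Finset.sum_insert ha, ih (h.subset (by simp)), Finset.biUnion_insert]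
    have hd : Disjoint (t a) (s.biUnion t) := by
      rw [Finset.disjoint_biUnion_right]
      exact fun b hb => h (by simp) (by simp [hb]) (by rintro rfl; exact ha hb)
    ext i
    by_cases h1 : i ∈ t a
    · have h2 := Finset.disjoint_left.1 hd h1
      simp only [PiLp.add_apply, restr_apply, Finset.mem_union, h1, h2, if_true, if_false,
        true_or, add_zero]
    · simp only [PiLp.add_apply, restr_apply, Finset.mem_union, h1, if_false, false_or, zero_add]

theorem mulE_eq (A : Matrix (Fin m) (Fin n) 𝕜) (v : EuclideanSpace 𝕜 (Fin n)) :
    mulE A v = Matrix.toEuclideanLin A v := rfl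

theorem mulE_add (A : Matrix (Fin m) (Fin n) 𝕜) (v w : EuclideanSpace 𝕜 (Fin n)) :
    mulE A (v + w) = mulE A v + mulE A w := map_add (Matrix.toEuclideanLin A) v w

theorem mulE_sub (A : Matrix (Fin m) (Fin n) 𝕜) (v w : EuclideanSpace 𝕜 (Fin n)) :
    mulE A (v - w) = mulE A v - mulE A w := map_sub (Matrix.toEuclideanLin A) v w

theorem mulE_zero (A : Matrix (Fin m) (Fin n) 𝕜) : mulE A 0 = 0 :=
  map_zero (Matrix.toEuclideanLin A)

theorem inner_mulE_conjTranspose (Φ : Matrix (Fin m) (Fin n) 𝕜) (r : EuclideanSpace 𝕜 (Fin m))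
    (w : EuclideanSpace 𝕜 (Fin n)) : inner 𝕜 (mulE Φᴴ r) w = inner 𝕜 r (mulE Φ w) := by
  rw [mulE_eq, mulE_eq, Matrix.toEuclideanLin_conjTranspose_eq_adjoint,
    LinearMap.adjoint_inner_left]

theorem inner_restr {A : Finset (Fin n)} {w : EuclideanSpace 𝕜 (Fin n)} (hw : supp w ⊆ A)
    (f : EuclideanSpace 𝕜 (Fin n)) : inner 𝕜 (restr A f) w = inner 𝕜 f w := by
  simp only [PiLp.inner_apply]
  refine Finset.sum_congr rfl fun i _ => ?_
  by_cases hi : i ∈ A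
  · simp [hi]
  · simp [hi, supp_subset_iff.1 hw i hi]

/-- `(Φᴴ Φ - I) v`. -/
def dev (Φ : Matrix (Fin m) (Fin n) 𝕜) (v : EuclideanSpace 𝕜 (Fin n)) :
    EuclideanSpace 𝕜 (Fin n) := mulE Φᴴ (mulE Φ v) - v

theorem dev_sub (Φ : Matrix (Fin m) (Fin n) 𝕜) (v w : EuclideanSpace 𝕜 (Fin n)) :
    dev Φ (v - w) = dev Φ v - dev Φ w := by
  simp only [dev, mulE_sub]; abel

theorem dev_add (Φ : Matrix (Fin m) (Fin n) 𝕜) (v w : EuclideanSpace 𝕜 (Fin n)) :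
    dev Φ (v + w) = dev Φ v + dev Φ w := by
  simp only [dev, mulE_add]; abel

theorem dev_zero (Φ : Matrix (Fin m) (Fin n) 𝕜) : dev Φ 0 = 0 := by
  simp [dev, mulE_zero]

theorem dev_sum {ι : Type*} (Φ : Matrix (Fin m) (Fin n) 𝕜) (s : Finset ι)
    (f : ι → EuclideanSpace 𝕜 (Fin n)) : dev Φ (∑ a ∈ s, f a) = ∑ a ∈ s, dev Φ (f a) := by
  classical
  induction s using Finset.induction_on with
  | empty => simp [dev_zero]
  | insert a s ha ih => rw [Finset.sum_insert ha, Finset.sum_insert ha, dev_add, ih]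

/-- Extension by zero identifies vectors indexed by `S` with vectors supported in `S`. All later
estimates can thus stay in one Euclidean space. -/
theorem norm_restr_dev_le_gramDeviation (Φ : Matrix (Fin m) (Fin n) 𝕜) {S : Finset (Fin n)}
    {v : EuclideanSpace 𝕜 (Fin n)} (hv : supp v ⊆ S) :
    ‖restr S (dev Φ v)‖ ≤ gramDeviation Φ S * ‖v‖ := by
  set vS : EuclideanSpace 𝕜 S := WithLp.toLp 2 fun i => v i with hvS
  have hsum : ∀ f : Fin n → 𝕜, (∀ i ∉ S, f i = 0) → ∑ i : S, f i = ∑ i, f i := by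
    intro f hf
    rw [Finset.sum_coe_sort S f]
    exact Finset.sum_subset (Finset.subset_univ _) fun i _ hi => hf i hi
  have hnorm : ‖vS‖ = ‖v‖ := by
    rw [← restr_eq_self hv, ← sq_eq_sq₀ (norm_nonneg _) (norm_nonneg _), norm_restr_sq,
      EuclideanSpace.norm_sq_eq]
    exact Finset.sum_coe_sort S fun i => ‖v i‖ ^ 2
  have hmul : colSub Φ S *ᵥ vS.ofLp = Φ *ᵥ v.ofLp := by
    ext k
    simp only [Matrix.mulVec, dotProduct, colSub, Matrix.submatrix_apply, id, hvS]
    exact hsum (fun i => Φ k i * v i) fun i hi => by rw [supp_subset_iff.1 hv i hi, mul_zero]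
  have hval : ∀ i : S, Matrix.toEuclideanCLM (n := S) (𝕜 := 𝕜)
      ((colSub Φ S)ᴴ * colSub Φ S - 1) vS i = dev Φ v i := by
    intro i
    rw [Matrix.ofLp_toEuclideanCLM, Matrix.sub_mulVec, ← Matrix.mulVec_mulVec, hmul,
      Matrix.one_mulVec]
    rfl
  have hle := (Matrix.toEuclideanCLM (n := S) (𝕜 := 𝕜)
    ((colSub Φ S)ᴴ * colSub Φ S - 1)).le_opNorm vS
  rw [hnorm] at hle
  refine le_trans (le_of_eq ?_) hle
  rw [← sq_eq_sq₀ (norm_nonneg _) (norm_nonneg _), norm_restr_sq, EuclideanSpace.norm_sq_eq,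
    ← Finset.sum_coe_sort S fun i => ‖dev Φ v i‖ ^ 2]
  exact Finset.sum_congr rfl fun i _ => by rw [hval]

theorem gramDeviation_le_pibric (Φ : Matrix (Fin m) (Fin n) 𝕜) {b p l L' K R : ℕ}
    {S : Finset (Fin n)} (hS : ∃ k ≤ K, ∃ r ≤ R, IsPIBSSupport b p l L' k r S) :
    gramDeviation Φ S ≤ pibric Φ b p l L' K R :=
  le_ciSup (f := fun S : {S : Finset (Fin n) // ∃ k ≤ K, ∃ r ≤ R, IsPIBSSupport b p l L' k r S} =>
    gramDeviation Φ S.1) (Set.finite_range _).bddAbove ⟨S, hS⟩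

theorem pibric_nonneg (Φ : Matrix (Fin m) (Fin n) 𝕜) (b p l L' K R : ℕ) :
    0 ≤ pibric Φ b p l L' K R :=
  Real.iSup_nonneg fun _ => norm_nonneg _

theorem Covered.norm_restr_dev_le {Φ : Matrix (Fin m) (Fin n) 𝕜} {b p L' K : ℕ}
    {A : Finset (Fin n)} (hA : Covered b p L' K A) {v : EuclideanSpace 𝕜 (Fin n)}
    (hv : supp v ⊆ A) : ‖restr A (dev Φ v)‖ ≤ pibric Φ b p L' L' K 2 * ‖v‖ := by
  obtain ⟨S, hS, hAS⟩ := hA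
  calc ‖restr A (dev Φ v)‖ ≤ ‖restr S (dev Φ v)‖ := norm_restr_mono hAS _
    _ ≤ gramDeviation Φ S * ‖v‖ := norm_restr_dev_le_gramDeviation Φ (hv.trans hAS)
    _ ≤ _ := mul_le_mul_of_nonneg_right (gramDeviation_le_pibric Φ hS) (norm_nonneg _)

/-- The difference is the inner product of `dev Φ w` with `w`, which only sees the entries in `A`.
-/
theorem abs_norm_mulE_sq_sub_le (Φ : Matrix (Fin m) (Fin n) 𝕜) {A : Finset (Fin n)}
    {w : EuclideanSpace 𝕜 (Fin n)} (hw : supp w ⊆ A) :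
    |‖mulE Φ w‖ ^ 2 - ‖w‖ ^ 2| ≤ ‖restr A (dev Φ w)‖ * ‖w‖ := by
  have h1 : inner 𝕜 (restr A (dev Φ w)) w = ((‖mulE Φ w‖ ^ 2 - ‖w‖ ^ 2 : ℝ) : 𝕜) := by
    rw [inner_restr hw, dev, inner_sub_left, inner_mulE_conjTranspose, inner_self_eq_norm_sq_to_K,
      inner_self_eq_norm_sq_to_K]
    push_cast
    rfl
  have h2 := norm_inner_le_norm (𝕜 := 𝕜) (restr A (dev Φ w)) w
  rw [h1, RCLike.norm_ofReal] at h2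
  exact h2

theorem corrNorm_eq (Φ : Matrix (Fin m) (Fin n) 𝕜) (S : Finset (Fin n))
    (r : EuclideanSpace 𝕜 (Fin m)) : corrNorm Φ S r = ‖restr S (mulE Φᴴ r)‖ := by
  rw [corrNorm, ← norm_restr_sq, Real.sqrt_sq (norm_nonneg _)]

theorem norm_restr_singleton (i : Fin n) (v : EuclideanSpace 𝕜 (Fin n)) :
    ‖restr {i} v‖ = ‖v i‖ := by
  rw [← sq_eq_sq₀ (norm_nonneg _) (norm_nonneg _), norm_restr_sq, Finset.sum_singleton]

end

/-! ### Deviation estimates beyond the order of the constant -/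

noncomputable section

variable {𝕜 : Type*} [RCLike 𝕜] {m n b p L L' g K : ℕ} {c j i : Fin g → ℕ}

/-- The union of the intervals of length `p b` that start at `i s`, `s ∈ A`. -/
def padded (n b p : ℕ) (i : Fin g → ℕ) (A : Finset (Fin g)) : Finset (Fin n) :=
  A.biUnion fun s => interval n (i s) (p * b)

/-- The union of the true clusters with index outside `A`. -/
def remaining (n b : ℕ) (c j : Fin g → ℕ) (A : Finset (Fin g)) : Finset (Fin n) :=
  Aᶜ.biUnion fun s => interval n (c s) (j s * b)

theorem cluster_subset_padding (hi : Padding n b p c j i) (s : Fin g) :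
    interval n (c s) (j s * b) ⊆ interval n (i s) (p * b) := by
  intro x hx
  rw [mem_interval] at *
  have := hi s
  omega

theorem cluster_subset_clusterSet (s : Fin g) :
    interval n (c s) (j s * b) ⊆ clusterSet n b c j :=
  Finset.subset_biUnion_of_mem (fun s => interval n (c s) (j s * b)) (Finset.mem_univ s)

theorem remaining_subset_clusterSet (A : Finset (Fin g)) :
    remaining n b c j A ⊆ clusterSet n b c j :=
  Finset.biUnion_subset_biUnion_of_subset_left _ (Finset.subset_univ _)

theorem padding_end_le (hs : Sizes n b p L L' K) (hc : TrueClusters n b p L' K c j)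
    (hi : Padding n b p c j i) {s s' : Fin g} (hss : s < s') : i s + p * b ≤ i s' := by
  have h1 := hi s
  have h2 := hi s'
  have h3 := hc.separated s s' hss
  have h4 := hs.L_add_le
  have h5 := hs.le_L
  omega

theorem disjoint_interval {a len a' len' : ℕ} (h : a + len ≤ a') :
    Disjoint (interval n a len) (interval n a' len') := by
  rw [Finset.disjoint_left]
  intro x hx hx'
  rw [mem_interval] at *
  omega

theorem disjoint_paddings (hs : Sizes n b p L L' K) (hc : TrueClusters n b p L' K c j)
    (hi : Padding n b p c j i) {s s' : Fin g} (hss : s ≠ s') :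
    Disjoint (interval n (i s) (p * b)) (interval n (i s') (p * b)) := by
  rcases lt_or_gt_of_ne hss with h | h
  · exact disjoint_interval (padding_end_le hs hc hi h)
  · exact (disjoint_interval (padding_end_le hs hc hi h)).symm

theorem disjoint_remaining_padded (hs : Sizes n b p L L' K) (hc : TrueClusters n b p L' K c j)
    (hi : Padding n b p c j i) (A : Finset (Fin g)) :
    Disjoint (remaining n b c j A) (padded n b p i A) := by
  simp only [remaining, padded, Finset.disjoint_biUnion_left, Finset.disjoint_biUnion_right]
  intro s hsA s' hs'
  have hne : s' ≠ s := by rintro rfl; exact Finset.mem_compl.1 hs' hsA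
  exact (disjoint_paddings hs hc hi hne).mono_left (cluster_subset_padding hi s')

/-- Split `v` according to the cluster index modulo `p`. Each part together with the interval is
covered, and Cauchy–Schwarz over the `p` parts costs the factor `√p`. -/
theorem norm_restr_dev_interval_le (Φ : Matrix (Fin m) (Fin n) 𝕜) (hs : Sizes n b p L L' K)
    (hp : 2 ≤ p) (hc : TrueClusters n b p L' K c j) (hi : Padding n b p c j i)
    {A : Finset (Fin g)} {v : EuclideanSpace 𝕜 (Fin n)} (hv : supp v ⊆ padded n b p i A)
    {a len : ℕ} (hlen : len ≤ L) :
    ‖restr (interval n a len) (dev Φ v)‖ ≤ √p * (pibric Φ b p L' L' (K - 1) 2 * ‖v‖) := by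
  set δ := pibric Φ b p L' L' (K - 1) 2 with hδ
  have hδ0 : 0 ≤ δ := pibric_nonneg ..
  set V : ℕ → Finset (Fin n) := fun ρ =>
    (Finset.univ.filter fun r : Fin g => (r : ℕ) % p = ρ).biUnion
      fun r => interval n (i r) (p * b) with hV
  have hdis : ((Finset.range p : Finset ℕ) : Set ℕ).PairwiseDisjoint V := by
    intro ρ _ ρ' _ hne
    simp only [hV, Function.onFun, Finset.disjoint_biUnion_left, Finset.disjoint_biUnion_right,
      Finset.mem_filter, Finset.mem_univ, true_and]
    intro r hr r' hr'
    refine disjoint_paddings hs hc hi ?_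
    rintro rfl
    exact hne (hr'.symm.trans hr)
  have hsub : supp v ⊆ (Finset.range p).biUnion V := by
    refine hv.trans fun x hx => ?_
    obtain ⟨r, -, hx⟩ := Finset.mem_biUnion.1 hx
    refine Finset.mem_biUnion.2 ⟨(r : ℕ) % p, Finset.mem_range.2 (Nat.mod_lt _ (by omega)), ?_⟩
    exact Finset.mem_biUnion.2 ⟨r, by simp, hx⟩
  have hsum : v = ∑ ρ ∈ Finset.range p, restr (V ρ) v := by
    rw [sum_restr hdis, restr_eq_self hsub]
  have hnorm : ∑ ρ ∈ Finset.range p, ‖restr (V ρ) v‖ ^ 2 = ‖v‖ ^ 2 := by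
    rw [← norm_restr_biUnion_sq hdis, restr_eq_self hsub]
  calc ‖restr (interval n a len) (dev Φ v)‖
      = ‖∑ ρ ∈ Finset.range p, restr (interval n a len) (dev Φ (restr (V ρ) v))‖ := by
        conv_lhs => rw [hsum]
        rw [dev_sum, restr_sum]
    _ ≤ ∑ ρ ∈ Finset.range p, ‖restr (interval n a len) (dev Φ (restr (V ρ) v))‖ :=
        norm_sum_le _ _
    _ ≤ ∑ ρ ∈ Finset.range p, δ * ‖restr (V ρ) v‖ := by
        refine Finset.sum_le_sum fun ρ _ => ?_
        have hcov := covered_paddings_union_interval hs hp hc hi ρ a len hlen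
        exact (norm_restr_mono Finset.subset_union_right _).trans
          (hcov.norm_restr_dev_le ((supp_restr_subset _ _).trans Finset.subset_union_left))
    _ = δ * ∑ ρ ∈ Finset.range p, ‖restr (V ρ) v‖ := by rw [Finset.mul_sum]
    _ ≤ δ * (√p * ‖v‖) := by
        refine mul_le_mul_of_nonneg_left ?_ hδ0
        have h1 := sq_sum_le_card_mul_sum_sq (s := Finset.range p)
          (f := fun ρ => ‖restr (V ρ) v‖)
        rw [hnorm, Finset.card_range] at h1
        rw [← Real.sqrt_sq (norm_nonneg v), ← Real.sqrt_mul (Nat.cast_nonneg _)]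
        exact Real.le_sqrt_of_sq_le h1
    _ = _ := by ring

theorem norm_restr_dev_padded_le (Φ : Matrix (Fin m) (Fin n) 𝕜) (hs : Sizes n b p L L' K)
    (hp : 2 ≤ p) (hc : TrueClusters n b p L' K c j) (hi : Padding n b p c j i)
    {A : Finset (Fin g)} {v : EuclideanSpace 𝕜 (Fin n)} (hv : supp v ⊆ padded n b p i A) :
    ‖restr (padded n b p i A) (dev Φ v)‖ ≤
      √(A.card * p) * pibric Φ b p L' L' (K - 1) 2 * ‖v‖ := by
  have hδ0 : 0 ≤ pibric Φ b p L' L' (K - 1) 2 := pibric_nonneg ..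
  refine le_of_sq_le_sq ?_ (by positivity)
  rw [padded, norm_restr_biUnion_sq fun s _ s' _ h => disjoint_paddings hs hc hi h]
  calc ∑ s ∈ A, ‖restr (interval n (i s) (p * b)) (dev Φ v)‖ ^ 2
      ≤ ∑ _s ∈ A, (√p * (pibric Φ b p L' L' (K - 1) 2 * ‖v‖)) ^ 2 :=
        Finset.sum_le_sum fun s _ => pow_le_pow_left₀ (norm_nonneg _)
          (norm_restr_dev_interval_le Φ hs hp hc hi hv hs.le_L) 2
    _ = _ := by
        rw [Finset.sum_const, nsmul_eq_mul, mul_pow, mul_pow, mul_pow, mul_pow,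
          Real.sq_sqrt (Nat.cast_nonneg _), Real.sq_sqrt (by positivity)]
        ring

/-- If any two terms of a sum of `k ≥ 2` reals add up to at most `C`, then twice the sum is at
most `k C`. -/
theorem two_mul_sum_le_of_pairs {ι : Type*} [DecidableEq ι] {A : Finset ι} (hA : 2 ≤ A.card)
    {f : ι → ℝ} {C : ℝ} (h : ∀ s ∈ A, ∀ s' ∈ A, s ≠ s' → f s + f s' ≤ C) :
    2 * ∑ s ∈ A, f s ≤ A.card * C := by
  -- Add the pair inequalities over all `s' ≠ s`. Adding over `s` as well produces a common factor
  -- `A.card - 1`, which is then cancelled.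
  have h1 : ∀ s ∈ A, (A.card : ℝ) * f s + ∑ s' ∈ A, f s' - 2 * f s ≤ (A.card - 1) * C := by
    intro s hsA
    have h2 : ∑ s' ∈ A.erase s, (f s + f s') ≤ ∑ _s' ∈ A.erase s, C :=
      Finset.sum_le_sum fun s' hs' =>
        h s hsA s' (Finset.mem_of_mem_erase hs') (Finset.ne_of_mem_erase hs').symm
    rw [Finset.sum_const, Finset.sum_add_distrib, Finset.sum_const,
      Finset.card_erase_of_mem hsA, nsmul_eq_mul, nsmul_eq_mul,
      Nat.cast_sub (by omega), Nat.cast_one] at h2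
    rw [← Finset.add_sum_erase _ _ hsA]
    linarith
  have h3 := Finset.sum_le_sum h1
  rw [Finset.sum_const, Finset.sum_sub_distrib, Finset.sum_add_distrib, Finset.sum_const,
    ← Finset.mul_sum, ← Finset.mul_sum, nsmul_eq_mul, nsmul_eq_mul] at h3
  have h4 : (2 : ℝ) ≤ A.card := by exact_mod_cast hA
  have h5 : ((A.card : ℝ) - 1) * (2 * ∑ s ∈ A, f s) ≤ (A.card - 1) * (A.card * C) := by
    linarith
  exact le_of_mul_le_mul_left h5 (by linarith)

theorem norm_restr_dev_clusterSet_le (Φ : Matrix (Fin m) (Fin n) 𝕜) (hs : Sizes n b p L L' K)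
    (hc : TrueClusters n b p L' K c j)
    {u : EuclideanSpace 𝕜 (Fin n)} (hu : supp u ⊆ clusterSet n b c j) {a len : ℕ}
    (hlen : len ≤ L) :
    ‖restr (clusterSet n b c j ∪ interval n a len) (dev Φ u)‖ ≤
      pibric Φ b p L' L' (K - 1) 2 * ‖u‖ :=
  (covered_clusterSet_union_interval hs hc a len hlen).norm_restr_dev_le
    (hu.trans Finset.subset_union_left)

/-- Two pseudo blocks allow two paddings to be tested at once against `u`; averaging over the pairs
gains a factor `2` over testing them singly. It compensates the `√2` lost when `i₀` and an interval
are joined in `devBound_of_one_lt`. -/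
theorem two_mul_norm_restr_dev_remaining_sq_le (Φ : Matrix (Fin m) (Fin n) 𝕜)
    (hs : Sizes n b p L L' K) (hc : TrueClusters n b p L' K c j) (hi : Padding n b p c j i)
    {A : Finset (Fin g)} (hA : 2 ≤ A.card) {u : EuclideanSpace 𝕜 (Fin n)}
    (hu : supp u ⊆ remaining n b c j A) :
    2 * ‖restr (padded n b p i A) (dev Φ u)‖ ^ 2 ≤
      A.card * (pibric Φ b p L' L' (K - 1) 2 * ‖u‖) ^ 2 := by
  rw [padded, norm_restr_biUnion_sq fun s _ s' _ h => disjoint_paddings hs hc hi h]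
  have key : ∀ s ∈ A, ∀ s' ∈ A, s < s' →
      ‖restr (interval n (i s) (p * b)) (dev Φ u)‖ ^ 2 +
        ‖restr (interval n (i s') (p * b)) (dev Φ u)‖ ^ 2 ≤
      (pibric Φ b p L' L' (K - 1) 2 * ‖u‖) ^ 2 := by
    intro s hsA s' hsA' hss
    rw [← norm_restr_union_sq (disjoint_paddings hs hc hi hss.ne)]
    refine pow_le_pow_left₀ (norm_nonneg _) ?_ 2
    have hcov : Covered b p L' (K - 1) (remaining n b c j A ∪
        (interval n (i s) (p * b) ∪ interval n (i s') (p * b))) := by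
      refine covered_of_two_paddings hs hc hi hss fun x hx => ?_
      rcases Finset.mem_union.1 hx with hx | hx
      · obtain ⟨r, hr, hx⟩ := Finset.mem_biUnion.1 hx
        rw [Finset.mem_compl] at hr
        exact Or.inl ⟨r, fun h => hr (h ▸ hsA), fun h => hr (h ▸ hsA'), hx⟩
      · exact Or.inr (Finset.mem_union.1 hx)
    exact (norm_restr_mono Finset.subset_union_right _).trans
      (hcov.norm_restr_dev_le (hu.trans Finset.subset_union_left))
  refine two_mul_sum_le_of_pairs hA fun s hsA s' hsA' hne => ?_
  rcases lt_or_gt_of_ne hne with h | h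
  · exact key s hsA s' hsA' h
  · rw [add_comm]; exact key s' hsA' s hsA h

/-- The residual correlations with the columns of an undiscovered index and of an interval are
close to the undiscovered part of the signal: for vectors `u` on the remaining clusters and `v` on
the padded ones such that `Φ (u - v)` is orthogonal to the padded columns, the deviation is at most
`η ‖u‖`. -/
def DevBound (Φ : Matrix (Fin m) (Fin n) 𝕜) (b p L : ℕ) (c j i : Fin g → ℕ) (A : Finset (Fin g))
    (η : ℝ) : Prop :=
  ∀ u v : EuclideanSpace 𝕜 (Fin n), supp u ⊆ remaining n b c j A → supp v ⊆ padded n b p i A →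
    (∀ t ∈ padded n b p i A, mulE Φᴴ (mulE Φ (u - v)) t = 0) →
    ∀ i₀ ∈ remaining n b c j A, ∀ a len, len ≤ L →
      ‖restr ((insert i₀ (interval n a len)) \ padded n b p i A) (dev Φ (u - v))‖ ≤ η * ‖u‖

/-- On the padded set `Φᴴ Φ (u - v)` vanishes by orthogonality and `u` vanishes by disjointness, so
only `v` is left of the deviation. -/
theorem restr_padded_dev_eq (Φ : Matrix (Fin m) (Fin n) 𝕜) (hs : Sizes n b p L L' K)
    (hc : TrueClusters n b p L' K c j) (hi : Padding n b p c j i)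
    {A : Finset (Fin g)} {u v : EuclideanSpace 𝕜 (Fin n)}
    (hu : supp u ⊆ remaining n b c j A) (hv : supp v ⊆ padded n b p i A)
    (hort : ∀ t ∈ padded n b p i A, mulE Φᴴ (mulE Φ (u - v)) t = 0) :
    restr (padded n b p i A) (dev Φ (u - v)) = v := by
  conv_rhs => rw [← restr_eq_self hv]
  refine restr_congr fun t ht => ?_
  have h1 : u t = 0 := supp_subset_iff.1 hu t
    fun h => Finset.disjoint_left.1 (disjoint_remaining_padded hs hc hi A) h ht
  simp [dev, hort t ht, h1]

/-- With `ρ = √(|A| p) δ`, the identity `v + dev v = dev u` on the padded set bounds `(1 - ρ) ‖v‖`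
by the deviation of `u` there. Off the set, `u` contributes `δ ‖u‖` and `v` at most `ρ δ ‖u‖ / (1 -
ρ)`, and these add up to `δ ‖u‖ / (1 - ρ)`. -/
theorem devBound_of_one_lt (Φ : Matrix (Fin m) (Fin n) 𝕜) (hs : Sizes n b p L L' K)
    (hp : 2 ≤ p) (hc : TrueClusters n b p L' K c j) (hi : Padding n b p c j i)
    (A : Finset (Fin g)) (hρ : √(A.card * p) * pibric Φ b p L' L' (K - 1) 2 < 1) :
    DevBound Φ b p L c j i A (pibric Φ b p L' L' (K - 1) 2 /
      (1 - √(A.card * p) * pibric Φ b p L' L' (K - 1) 2)) := by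
  intro u v hu hv hort i₀ hi₀ a len hlen
  set δ := pibric Φ b p L' L' (K - 1) 2 with hδ
  have hδ0 : 0 ≤ δ := pibric_nonneg ..
  set T := padded n b p i A with hT
  set ρ := √(A.card * p) * δ with hρdef
  have hρ1 : 0 < 1 - ρ := by linarith
  have hucl := hu.trans (remaining_subset_clusterSet A)
  have hi₀i : {i₀} = interval n (i₀ : ℕ) 1 := by
    ext x; rw [mem_interval, Finset.mem_singleton, Fin.ext_iff]; omega
  have hL1 : 1 ≤ L := by
    have := hs.le_L; have := hs.b_le; have := hs.one_le_b; omega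
  -- the bound on `v`
  have hvT : (1 - ρ) * ‖v‖ ≤ ‖restr T (dev Φ u)‖ := by
    have h1 := restr_padded_dev_eq Φ hs hc hi hu hv hort
    rw [dev_sub, restr_sub, sub_eq_iff_eq_add] at h1
    have h2 := norm_restr_dev_padded_le Φ hs hp hc hi hv
    have h3 : ‖v‖ ≤ ‖v + restr T (dev Φ v)‖ + ‖restr T (dev Φ v)‖ := by
      simpa using norm_sub_le (v + restr T (dev Φ v)) (restr T (dev Φ v))
    rw [h1]
    linarith
  -- the deviation of `u`
  have huR : ‖restr ((insert i₀ (interval n a len)) \ T) (dev Φ u)‖ ≤ δ * ‖u‖ := by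
    refine (norm_restr_mono ?_ _).trans (norm_restr_dev_clusterSet_le Φ hs hc hucl (a := a) hlen)
    refine Finset.sdiff_subset.trans (Finset.insert_subset_iff.2 ⟨?_, Finset.subset_union_right⟩)
    exact Finset.mem_union_left _ (remaining_subset_clusterSet A hi₀)
  -- the deviation of `v`
  have hcomb : ∀ α : ℝ, 0 ≤ α → (∀ a len, len ≤ L →
      ‖restr (interval n a len) (dev Φ v)‖ ≤ α * (δ * ‖v‖)) →
      ‖restr ((insert i₀ (interval n a len)) \ T) (dev Φ v)‖ ≤ √2 * α * (δ * ‖v‖) := by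
    intro α hα hrow
    have h1 := hrow a len hlen
    have h2 := hrow i₀ 1 hL1
    rw [← hi₀i] at h2
    refine (norm_restr_mono Finset.sdiff_subset _).trans ?_
    refine le_of_sq_le_sq ?_ (by positivity)
    have h3 := norm_restr_union_sq_le {i₀} (interval n a len) (dev Φ v)
    rw [← Finset.insert_eq] at h3
    have h4 := pow_le_pow_left₀ (norm_nonneg _) h1 2
    have h5 := pow_le_pow_left₀ (norm_nonneg _) h2 2
    have h6 : (√2 * α * (δ * ‖v‖)) ^ 2 = 2 * (α * (δ * ‖v‖)) ^ 2 := by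
      rw [mul_assoc, mul_pow, Real.sq_sqrt (by norm_num)]
    rw [h6]; linarith
  have hvR : ‖restr ((insert i₀ (interval n a len)) \ T) (dev Φ v)‖ * (1 - ρ) ≤
      ρ * (δ * ‖u‖) := by
    -- Without padding `v = 0`. A single padding lies in one residue class, so no `√p` arises and
    -- `√2 ≤ √p` absorbs the joining factor. From two paddings on, the pair estimate cancels the
    -- `√2`.
    rcases Nat.lt_or_ge A.card 2 with hk | hk
    · rcases Nat.eq_zero_or_pos A.card with hk0 | hk0
      · have hv0 : v = 0 := by
          ext t
          refine supp_subset_iff.1 hv t ?_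
          simp [hT, padded, Finset.card_eq_zero.1 hk0]
        rw [hv0, dev_zero]
        have : restr ((insert i₀ (interval n a len)) \ T) (0 : EuclideanSpace 𝕜 (Fin n)) = 0 := by
          ext t; simp
        rw [this, norm_zero, zero_mul]
        positivity
      · obtain ⟨s, rfl⟩ := Finset.card_eq_one.1 (show A.card = 1 by omega)
        have hTs : T = interval n (i s) (p * b) := by simp [hT, padded]
        have h1 := hcomb 1 zero_le_one fun a len hlen => by
          have hcov := covered_paddings_union_interval hs hp hc hi ((s : ℕ) % p) a len hlen
          rw [one_mul]
          refine (norm_restr_mono Finset.subset_union_right _).trans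
            (hcov.norm_restr_dev_le (hv.trans (Finset.Subset.trans ?_ Finset.subset_union_left)))
          intro x hx
          rw [hTs] at hx
          exact Finset.mem_biUnion.2 ⟨s, by simp, hx⟩
        have h2 : ‖restr T (dev Φ u)‖ ≤ δ * ‖u‖ := by
          rw [hTs]
          exact (norm_restr_mono Finset.subset_union_right _).trans
            (norm_restr_dev_clusterSet_le Φ hs hc hucl hs.le_L)
        have h3 : √2 * δ ≤ ρ := by
          rw [hρdef]
          refine mul_le_mul_of_nonneg_right (Real.sqrt_le_sqrt ?_) hδ0
          rw [Finset.card_singleton, Nat.cast_one, one_mul]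
          exact_mod_cast hp
        calc _ ≤ √2 * 1 * (δ * ‖v‖) * (1 - ρ) := mul_le_mul_of_nonneg_right h1 hρ1.le
          _ = √2 * δ * ((1 - ρ) * ‖v‖) := by ring
          _ ≤ ρ * (δ * ‖u‖) := mul_le_mul h3 (hvT.trans h2)
              (mul_nonneg hρ1.le (norm_nonneg _)) (by positivity)
    · have h1 := hcomb (√p) (Real.sqrt_nonneg _) fun a len hlen =>
        norm_restr_dev_interval_le Φ hs hp hc hi hv hlen
      have h2 := two_mul_norm_restr_dev_remaining_sq_le Φ hs hc hi hk hu
      have h3 : √2 * ‖restr T (dev Φ u)‖ ≤ √A.card * (δ * ‖u‖) := by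
        refine le_of_sq_le_sq ?_ (by positivity)
        rw [mul_pow, mul_pow, Real.sq_sqrt (by norm_num), Real.sq_sqrt (Nat.cast_nonneg _)]
        exact h2
      calc _ ≤ √2 * √p * (δ * ‖v‖) * (1 - ρ) := mul_le_mul_of_nonneg_right h1 hρ1.le
        _ = √p * δ * (√2 * ((1 - ρ) * ‖v‖)) := by ring
        _ ≤ √p * δ * (√A.card * (δ * ‖u‖)) := by
            refine mul_le_mul_of_nonneg_left (le_trans ?_ h3) (by positivity)
            exact mul_le_mul_of_nonneg_left hvT (Real.sqrt_nonneg _)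
        _ = ρ * (δ * ‖u‖) := by
            rw [hρdef, Real.sqrt_mul (Nat.cast_nonneg _)]; ring
  rw [dev_sub, restr_sub, div_mul_eq_mul_div, le_div_iff₀ hρ1]
  calc _ ≤ (‖restr ((insert i₀ (interval n a len)) \ T) (dev Φ u)‖ +
        ‖restr ((insert i₀ (interval n a len)) \ T) (dev Φ v)‖) * (1 - ρ) :=
        mul_le_mul_of_nonneg_right (norm_sub_le _ _) hρ1.le
    _ ≤ δ * ‖u‖ * (1 - ρ) + ρ * (δ * ‖u‖) := by
        rw [add_mul]
        exact add_le_add (mul_le_mul_of_nonneg_right huR hρ1.le) hvR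
    _ = δ * ‖u‖ := by ring

theorem padded_subset_clusterSet_of_eq_one (hp : p = 1) (hc : TrueClusters n b p L' K c j)
    (hi : Padding n b p c j i) (A : Finset (Fin g)) :
    padded n b p i A ⊆ clusterSet n b c j := by
  refine Finset.biUnion_subset.2 fun s _ => ?_
  have h1 := hi s
  have h2 : j s = 1 := le_antisymm (hp ▸ hc.le_p s) (hc.one_le s)
  have h3 := cluster_subset_clusterSet (n := n) (b := b) (c := c) (j := j) s
  rw [h2] at h1 h3
  rw [hp] at h1 ⊢
  rw [show i s = c s by omega]
  exact h3

/-- For `p = 1` the paddings are true clusters, so `u - v` itself lies in a covered set. Of the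
total `δ² (‖u‖² + ‖v‖²)` the padded set already takes `‖v‖²`, and since `δ ≤ 1` at most `δ² ‖u‖²` is
left elsewhere. -/
theorem devBound_of_eq_one (Φ : Matrix (Fin m) (Fin n) 𝕜) (hs : Sizes n b p L L' K)
    (hp : p = 1) (hc : TrueClusters n b p L' K c j) (hi : Padding n b p c j i)
    (A : Finset (Fin g)) (hδ1 : pibric Φ b p L' L' (K - 1) 2 ≤ 1) :
    DevBound Φ b p L c j i A (pibric Φ b p L' L' (K - 1) 2) := by
  intro u v hu hv hort i₀ hi₀ a len hlen
  set δ := pibric Φ b p L' L' (K - 1) 2 with hδ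
  have hδ0 : 0 ≤ δ := pibric_nonneg ..
  set T := padded n b p i A with hT
  have hTc : T ⊆ clusterSet n b c j := padded_subset_clusterSet_of_eq_one hp hc hi A
  have hucl := hu.trans (remaining_subset_clusterSet A)
  have huv : supp (u - v) ⊆ clusterSet n b c j := supp_subset_iff.2 fun t ht => by
    rw [PiLp.sub_apply, supp_subset_iff.1 hucl t ht,
      supp_subset_iff.1 (hv.trans hTc) t ht, sub_zero]
  have h1 := norm_restr_dev_clusterSet_le Φ hs hc huv (a := a) hlen
  have h2 := restr_padded_dev_eq Φ hs hc hi hu hv hort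
  have hdis := disjoint_remaining_padded hs hc hi A
  have h3 : ‖u - v‖ ^ 2 = ‖u‖ ^ 2 + ‖v‖ ^ 2 := by
    have h4 : supp (u - v) ⊆ remaining n b c j A ∪ T := supp_subset_iff.2 fun t ht => by
      rw [Finset.mem_union, not_or] at ht
      rw [PiLp.sub_apply, supp_subset_iff.1 hu t ht.1, supp_subset_iff.1 hv t ht.2, sub_zero]
    rw [← restr_eq_self h4, norm_restr_union_sq hdis]
    have h5 : restr (remaining n b c j A) (u - v) = u := by
      conv_rhs => rw [← restr_eq_self hu]
      refine restr_congr fun t ht => ?_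
      rw [PiLp.sub_apply, supp_subset_iff.1 hv t (Finset.disjoint_left.1 hdis ht), sub_zero]
    have h6 : restr T (u - v) = -v := by
      ext t
      by_cases ht : t ∈ T
      · rw [restr_apply, if_pos ht, PiLp.sub_apply, PiLp.neg_apply,
          supp_subset_iff.1 hu t (Finset.disjoint_right.1 hdis ht), zero_sub]
      · rw [restr_apply, if_neg ht, PiLp.neg_apply, supp_subset_iff.1 hv t ht, neg_zero]
    rw [h5, h6, norm_neg]
  set R := (insert i₀ (interval n a len)) \ T with hR
  have h5 : ‖restr (R ∪ T) (dev Φ (u - v))‖ ≤ δ * ‖u - v‖ := by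
    refine (norm_restr_mono ?_ _).trans h1
    refine Finset.union_subset (Finset.sdiff_subset.trans ?_)
      (hTc.trans Finset.subset_union_left)
    exact Finset.insert_subset_iff.2 ⟨Finset.mem_union_left _
      (remaining_subset_clusterSet A hi₀), Finset.subset_union_right⟩
  have h6 := pow_le_pow_left₀ (norm_nonneg _) h5 2
  rw [norm_restr_union_sq Finset.sdiff_disjoint, h2, mul_pow, h3] at h6
  refine le_of_sq_le_sq ?_ (by positivity)
  rw [mul_pow]
  have h7 : δ ^ 2 ≤ 1 := pow_le_one₀ hδ0 hδ1
  nlinarith [sq_nonneg ‖v‖]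

end

/-! ### Least squares residuals and their correlations -/

noncomputable section

variable {𝕜 : Type*} [RCLike 𝕜] {m n b p L L' g K : ℕ} {c j i : Fin g → ℕ}

/-- The subspace of the vectors that vanish outside `T`. -/
def suppSubspace (𝕜 : Type*) [RCLike 𝕜] (T : Finset (Fin n)) :
    Submodule 𝕜 (EuclideanSpace 𝕜 (Fin n)) where
  carrier := {v | ∀ i, i ∉ T → v i = 0}
  add_mem' {v w} hv hw := fun i hi => by simp [hv i hi, hw i hi]
  zero_mem' := fun i _ => rfl
  smul_mem' a v hv := fun i hi => by simp [hv i hi]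

theorem mem_suppSubspace {T : Finset (Fin n)} {v : EuclideanSpace 𝕜 (Fin n)} :
    v ∈ suppSubspace 𝕜 T ↔ supp v ⊆ T := supp_subset_iff.symm

/-- The span of the columns with index in `T`. -/
def colSpan (Φ : Matrix (Fin m) (Fin n) 𝕜) (T : Finset (Fin n)) :
    Submodule 𝕜 (EuclideanSpace 𝕜 (Fin m)) :=
  (suppSubspace 𝕜 T).map (Matrix.toEuclideanLin Φ)

theorem mulE_mem_colSpan (Φ : Matrix (Fin m) (Fin n) 𝕜) {T : Finset (Fin n)}
    {v : EuclideanSpace 𝕜 (Fin n)} (hv : supp v ⊆ T) : mulE Φ v ∈ colSpan Φ T :=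
  Submodule.mem_map_of_mem (mem_suppSubspace.2 hv)

theorem exists_of_mem_colSpan {Φ : Matrix (Fin m) (Fin n) 𝕜} {T : Finset (Fin n)}
    {r : EuclideanSpace 𝕜 (Fin m)} (hr : r ∈ colSpan Φ T) : ∃ v, supp v ⊆ T ∧ mulE Φ v = r := by
  obtain ⟨v, hv, h⟩ := Submodule.mem_map.1 hr
  exact ⟨v, mem_suppSubspace.1 hv, h⟩

theorem mulE_conjTranspose_apply_eq_zero (Φ : Matrix (Fin m) (Fin n) 𝕜) {T : Finset (Fin n)}
    {r : EuclideanSpace 𝕜 (Fin m)} (hr : r ∈ (colSpan Φ T)ᗮ) {t : Fin n} (ht : t ∈ T) :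
    mulE Φᴴ r t = 0 := by
  have h1 : supp (restr {t} (mulE Φᴴ r)) ⊆ T :=
    (supp_restr_subset _ _).trans (Finset.singleton_subset_iff.2 ht)
  have h2 := Submodule.mem_orthogonal' _ _ |>.1 hr _ (mulE_mem_colSpan Φ h1)
  rw [← inner_mulE_conjTranspose, ← inner_restr (supp_restr_subset _ _), inner_self_eq_zero] at h2
  simpa using congrArg (fun v : EuclideanSpace 𝕜 (Fin n) => v t) h2

theorem norm_residual_sq (Φ : Matrix (Fin m) (Fin n) 𝕜) {T : Finset (Fin n)}
    (y : EuclideanSpace 𝕜 (Fin m)) {z : EuclideanSpace 𝕜 (Fin n)} (hz : supp z ⊆ T) :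
    ‖residual Φ y z‖ ^ 2 = ‖y - (colSpan Φ T).starProjection y‖ ^ 2 +
      ‖(colSpan Φ T).starProjection y - mulE Φ z‖ ^ 2 := by
  have h := Submodule.inner_left_of_mem_orthogonal
    (Submodule.sub_mem _ ((colSpan Φ T).starProjection_apply_mem y) (mulE_mem_colSpan Φ hz))
    ((colSpan Φ T).sub_starProjection_mem_orthogonal y)
  rw [residual, ← sub_add_sub_cancel y ((colSpan Φ T).starProjection y) (mulE Φ z), sq, sq, sq]
  exact norm_add_sq_eq_norm_sq_add_norm_sq_of_inner_eq_zero _ _ h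

/-- `z` minimizes the residual among the vectors supported in `T`. -/
def IsLeastSquares (Φ : Matrix (Fin m) (Fin n) 𝕜) (y : EuclideanSpace 𝕜 (Fin m))
    (T : Finset (Fin n)) (z : EuclideanSpace 𝕜 (Fin n)) : Prop :=
  supp z ⊆ T ∧ ∀ u : EuclideanSpace 𝕜 (Fin n), supp u ⊆ T → ‖residual Φ y z‖ ≤ ‖residual Φ y u‖

theorem exists_isLeastSquares (Φ : Matrix (Fin m) (Fin n) 𝕜) (y : EuclideanSpace 𝕜 (Fin m))
    (T : Finset (Fin n)) : ∃ z, IsLeastSquares Φ y T z := by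
  obtain ⟨z, hz, h⟩ := exists_of_mem_colSpan ((colSpan Φ T).starProjection_apply_mem y)
  refine ⟨z, hz, fun u hu => ?_⟩
  rw [← sq_le_sq₀ (norm_nonneg _) (norm_nonneg _), norm_residual_sq Φ y hz,
    norm_residual_sq Φ y hu, h, sub_self, norm_zero]
  nlinarith [sq_nonneg ‖mulE Φ z - mulE Φ u‖]

theorem IsLeastSquares.mulE_eq {Φ : Matrix (Fin m) (Fin n) 𝕜} {y : EuclideanSpace 𝕜 (Fin m)}
    {T : Finset (Fin n)} {z : EuclideanSpace 𝕜 (Fin n)} (hz : IsLeastSquares Φ y T z) :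
    mulE Φ z = (colSpan Φ T).starProjection y := by
  obtain ⟨w, hw, h⟩ := exists_of_mem_colSpan ((colSpan Φ T).starProjection_apply_mem y)
  have h1 := pow_le_pow_left₀ (norm_nonneg _) (hz.2 w hw) 2
  rw [norm_residual_sq Φ y hz.1, norm_residual_sq Φ y hw, h, sub_self, norm_zero] at h1
  have h2 : ‖(colSpan Φ T).starProjection y - mulE Φ z‖ ^ 2 = 0 :=
    le_antisymm (by linarith) (sq_nonneg _)
  have h3 := sub_eq_zero.1 (norm_eq_zero.1 (pow_eq_zero_iff two_ne_zero |>.1 h2))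
  exact h3.symm

/-- The residual of a least squares vector splits into a signal and a noise part, both orthogonal
to the selected columns. -/
theorem IsLeastSquares.exists_decomp {Φ : Matrix (Fin m) (Fin n) 𝕜}
    {x z : EuclideanSpace 𝕜 (Fin n)} {e : EuclideanSpace 𝕜 (Fin m)} {T : Finset (Fin n)}
    (hz : IsLeastSquares Φ (mulE Φ x + e) T z) {u : EuclideanSpace 𝕜 (Fin n)}
    (hu : supp (x - u) ⊆ T) :
    ∃ v e', supp v ⊆ T ∧ ‖e'‖ ≤ ‖e‖ ∧
      residual Φ (mulE Φ x + e) z = mulE Φ (u - v) + e' ∧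
      (∀ t ∈ T, mulE Φᴴ (mulE Φ (u - v)) t = 0) ∧ ∀ t ∈ T, mulE Φᴴ e' t = 0 := by
  set P := (colSpan Φ T).starProjection with hP
  obtain ⟨v, hv, h⟩ := exists_of_mem_colSpan ((colSpan Φ T).starProjection_apply_mem (mulE Φ u))
  refine ⟨v, e - P e, hv, ?_, ?_, fun t ht => ?_, fun t ht => ?_⟩
  · have h1 := norm_residual_sq Φ e (T := T) (z := 0) (supp_subset_iff.2 fun _ _ => rfl)
    rw [residual, mulE_zero, sub_zero, sub_zero] at h1
    rw [← sq_le_sq₀ (norm_nonneg _) (norm_nonneg _), h1]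
    nlinarith [sq_nonneg ‖(colSpan Φ T).starProjection e‖]
  · have h1 : P (mulE Φ (x - u)) = mulE Φ (x - u) :=
      Submodule.starProjection_eq_self_iff.2 (mulE_mem_colSpan Φ hu)
    have h2 : P (mulE Φ x) = mulE Φ x - mulE Φ u + P (mulE Φ u) := by
      rw [← mulE_sub, ← h1, ← map_add, ← mulE_add, sub_add_cancel]
    rw [residual, hz.mulE_eq, ← hP, map_add, h2, mulE_sub, h]
    abel
  · rw [mulE_sub, h]
    exact mulE_conjTranspose_apply_eq_zero Φ
      ((colSpan Φ T).sub_starProjection_mem_orthogonal _) ht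
  · exact mulE_conjTranspose_apply_eq_zero Φ
      ((colSpan Φ T).sub_starProjection_mem_orthogonal _) ht

theorem norm_mulE_conjTranspose_apply_le {Φ : Matrix (Fin m) (Fin n) 𝕜} {t : Fin n}
    (hΦ : ∑ s, ‖Φ s t‖ ^ 2 = 1) (r : EuclideanSpace 𝕜 (Fin m)) : ‖mulE Φᴴ r t‖ ≤ ‖r‖ := by
  set w : EuclideanSpace 𝕜 (Fin m) := WithLp.toLp 2 fun s => Φ s t with hw
  have h1 : ‖w‖ = 1 := by
    rw [← sq_eq_sq₀ (norm_nonneg _) zero_le_one, EuclideanSpace.norm_sq_eq, one_pow, ← hΦ]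
  have h2 : mulE Φᴴ r t = inner 𝕜 w r := by
    rw [PiLp.inner_apply]
    simp only [mulE, Matrix.mulVec, dotProduct, Matrix.conjTranspose_apply, RCLike.inner_apply]
    exact Finset.sum_congr rfl fun s _ => mul_comm _ _
  rw [h2]
  simpa [h1] using norm_inner_le_norm (𝕜 := 𝕜) w r

theorem Covered.norm_mulE_sq_le {Φ : Matrix (Fin m) (Fin n) 𝕜} {A : Finset (Fin n)}
    (hA : Covered b p L' K A) {w : EuclideanSpace 𝕜 (Fin n)} (hw : supp w ⊆ A) :
    ‖mulE Φ w‖ ^ 2 ≤ (1 + pibric Φ b p L' L' K 2) * ‖w‖ ^ 2 := by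
  have h1 := (abs_le.1 (abs_norm_mulE_sq_sub_le Φ hw)).2
  have h2 := mul_le_mul_of_nonneg_right (hA.norm_restr_dev_le (Φ := Φ) hw) (norm_nonneg w)
  nlinarith

/-- The correlations with the noise. -/
theorem Covered.norm_restr_mulE_conjTranspose_le {Φ : Matrix (Fin m) (Fin n) 𝕜}
    {A : Finset (Fin n)} (hA : Covered b p L' K A) (f : EuclideanSpace 𝕜 (Fin m)) :
    ‖restr A (mulE Φᴴ f)‖ ≤ √(1 + pibric Φ b p L' L' K 2) * ‖f‖ := by
  set w := restr A (mulE Φᴴ f) with hw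
  have hδ0 := pibric_nonneg Φ b p L' L' K 2
  have hws : supp w ⊆ A := supp_restr_subset _ _
  -- Duality: `‖w‖²` is the inner product of `f` with `Φ w`, and the upper isometry bound applies to
  -- `Φ w`.
  have h1 : ‖w‖ ^ 2 ≤ ‖f‖ * ‖mulE Φ w‖ := by
    have h2 : inner 𝕜 w w = inner 𝕜 f (mulE Φ w) := by
      conv_lhs => rw [hw, inner_restr hws, inner_mulE_conjTranspose]
    have h3 := norm_inner_le_norm (𝕜 := 𝕜) f (mulE Φ w)
    rw [← h2, inner_self_eq_norm_sq_to_K, norm_pow, RCLike.norm_ofReal, abs_norm] at h3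
    exact h3
  have h2 : ‖mulE Φ w‖ ≤ √(1 + pibric Φ b p L' L' K 2) * ‖w‖ := by
    rw [← sq_le_sq₀ (norm_nonneg _) (by positivity), mul_pow, Real.sq_sqrt (by positivity)]
    exact hA.norm_mulE_sq_le hws
  rcases (norm_nonneg w).eq_or_lt with h | h
  · rw [← h]; positivity
  · refine le_of_mul_le_mul_right ?_ h
    nlinarith [mul_le_mul_of_nonneg_left h2 (norm_nonneg f)]

theorem clusterSet_subset_union (hi : Padding n b p c j i) (A : Finset (Fin g)) :
    clusterSet n b c j ⊆ remaining n b c j A ∪ padded n b p i A := by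
  refine Finset.biUnion_subset.2 fun s _ => ?_
  by_cases hsA : s ∈ A
  · exact ((cluster_subset_padding hi s).trans
      (Finset.subset_biUnion_of_mem (fun s => interval n (i s) (p * b)) hsA)).trans
        Finset.subset_union_right
  · exact (Finset.subset_biUnion_of_mem (fun s => interval n (c s) (j s * b))
      (Finset.mem_compl.2 hsA)).trans Finset.subset_union_left

/-- The bound on the difference between the residual correlations and the undiscovered signal. -/
theorem norm_restr_corr_sub_le (Φ : Matrix (Fin m) (Fin n) 𝕜) (hs : Sizes n b p L L' K)
    (hc : TrueClusters n b p L' K c j) (hi : Padding n b p c j i)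
    {x z : EuclideanSpace 𝕜 (Fin n)} {e : EuclideanSpace 𝕜 (Fin m)} {ε : ℝ} (he : ‖e‖ ≤ ε)
    (hx : supp x ⊆ clusterSet n b c j) {A : Finset (Fin g)}
    (hz : IsLeastSquares Φ (mulE Φ x + e) (padded n b p i A) z) {η : ℝ}
    (hdev : DevBound Φ b p L c j i A η) {i₀ : Fin n} (hi₀ : i₀ ∈ remaining n b c j A)
    {a len : ℕ} (hlen : len ≤ L) :
    (∀ t ∈ padded n b p i A, mulE Φᴴ (residual Φ (mulE Φ x + e) z) t = 0) ∧
    ‖restr (insert i₀ (interval n a len) \ padded n b p i A)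
        (mulE Φᴴ (residual Φ (mulE Φ x + e) z) - restr (remaining n b c j A) x)‖ ≤
      η * ‖restr (remaining n b c j A) x‖ + √(1 + pibric Φ b p L' L' (K - 1) 2) * ε := by
  set u := restr (remaining n b c j A) x with hu
  have husupp : supp u ⊆ remaining n b c j A := supp_restr_subset _ _
  have hxu : supp (x - u) ⊆ padded n b p i A := supp_subset_iff.2 fun t ht => by
    by_cases hr : t ∈ remaining n b c j A
    · simp [hu, hr]
    · have : x t = 0 := supp_subset_iff.1 hx t fun h =>
        (Finset.mem_union.1 (clusterSet_subset_union hi A h)).elim hr ht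
      simp [hu, hr, this]
  obtain ⟨v, e', hv, he', hr, hort, hort'⟩ := hz.exists_decomp hxu
  rw [hr, mulE_add]
  refine ⟨fun t ht => by rw [PiLp.add_apply, hort t ht, hort' t ht, add_zero], ?_⟩
  have h1 := hdev u v husupp hv hort i₀ hi₀ a len hlen
  have hsub : insert i₀ (interval n a len) \ padded n b p i A ⊆
      clusterSet n b c j ∪ interval n a len :=
    Finset.sdiff_subset.trans (Finset.insert_subset_iff.2 ⟨Finset.mem_union_left _
      (remaining_subset_clusterSet A hi₀), Finset.subset_union_right⟩)
  have h2 := (norm_restr_mono hsub _).trans ((covered_clusterSet_union_interval hs hc a len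
    hlen).norm_restr_mulE_conjTranspose_le (Φ := Φ) e')
  have h3 : restr (insert i₀ (interval n a len) \ padded n b p i A)
      (mulE Φᴴ (mulE Φ (u - v)) + mulE Φᴴ e' - u) =
      restr (insert i₀ (interval n a len) \ padded n b p i A) (dev Φ (u - v)) +
        restr (insert i₀ (interval n a len) \ padded n b p i A) (mulE Φᴴ e') := by
    rw [← restr_add]
    refine restr_congr fun t ht => ?_
    have h4 : v t = 0 := supp_subset_iff.1 hv t (Finset.mem_sdiff.1 ht).2
    simp only [dev, PiLp.add_apply, PiLp.sub_apply, h4]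
    ring
  rw [h3]
  refine (norm_add_le _ _).trans (add_le_add h1 (h2.trans ?_))
  exact mul_le_mul_of_nonneg_left (he'.trans he) (Real.sqrt_nonneg _)

/-- The correlation of the residual with a single undiscovered index exceeds the correlation with
an interval without undiscovered indices. -/
theorem corrNorm_lt_of_disjoint (Φ : Matrix (Fin m) (Fin n) 𝕜) (hs : Sizes n b p L L' K)
    (hc : TrueClusters n b p L' K c j) (hi : Padding n b p c j i)
    {x z : EuclideanSpace 𝕜 (Fin n)} {e : EuclideanSpace 𝕜 (Fin m)} {ε : ℝ} (he : ‖e‖ ≤ ε)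
    (hx : supp x ⊆ clusterSet n b c j) {A : Finset (Fin g)}
    (hz : IsLeastSquares Φ (mulE Φ x + e) (padded n b p i A) z) {η : ℝ}
    (hdev : DevBound Φ b p L c j i A η) {i₀ : Fin n} (hi₀ : i₀ ∈ remaining n b c j A)
    {a len : ℕ} (hlen : len ≤ L) (hD : Disjoint (interval n a len) (remaining n b c j A))
    (hbig : √2 * (η * ‖restr (remaining n b c j A) x‖ +
      √(1 + pibric Φ b p L' L' (K - 1) 2) * ε) < ‖x i₀‖) :
    corrNorm Φ (interval n a len) (residual Φ (mulE Φ x + e) z) <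
      ‖mulE Φᴴ (residual Φ (mulE Φ x + e) z) i₀‖ := by
  obtain ⟨h0, h1⟩ := norm_restr_corr_sub_le Φ hs hc hi he hx hz hdev hi₀ (a := a) hlen
  set q := mulE Φᴴ (residual Φ (mulE Φ x + e) z) with hq
  set u := restr (remaining n b c j A) x with hu
  set T := padded n b p i A with hT
  set β := η * ‖u‖ + √(1 + pibric Φ b p L' L' (K - 1) 2) * ε with hβ
  have hi₀D : i₀ ∉ interval n a len \ T := fun h =>
    Finset.disjoint_left.1 hD (Finset.mem_sdiff.1 h).1 hi₀
  have hi₀T : i₀ ∉ T := Finset.disjoint_left.1 (disjoint_remaining_padded hs hc hi A) hi₀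
  have hins : insert i₀ (interval n a len) \ T = {i₀} ∪ (interval n a len \ T) := by
    rw [Finset.insert_sdiff_of_notMem _ hi₀T, Finset.insert_eq]
  have h2 := pow_le_pow_left₀ (norm_nonneg _) h1 2
  rw [hins, norm_restr_union_sq (Finset.disjoint_singleton_left.2 hi₀D),
    norm_restr_singleton] at h2
  have h3 : restr (interval n a len \ T) (q - u) = restr (interval n a len) q := by
    ext t
    by_cases hT' : t ∈ T
    · simp [hT', h0 t hT']
    · by_cases hD' : t ∈ interval n a len
      · have : u t = 0 := by simp [hu, Finset.disjoint_left.1 hD hD']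
        simp [hT', hD', this]
      · simp [hD']
  rw [h3] at h2
  rw [corrNorm_eq, ← hq]
  have h4 : (q - u) i₀ = q i₀ - x i₀ := by simp [hu, hi₀]
  rw [h4] at h2
  have h5 : ‖x i₀‖ ≤ ‖q i₀‖ + ‖q i₀ - x i₀‖ := norm_le_insert (q i₀) (x i₀)
  have hβ0 : 0 ≤ β := (norm_nonneg _).trans h1
  -- The two errors occupy disjoint sets and share the budget `β` in the square sum, so their sum is
  -- at most `√2 β` instead of `2 β`.
  have h6 : ‖q i₀ - x i₀‖ + ‖restr (interval n a len) q‖ ≤ √2 * β := by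
    refine le_of_sq_le_sq ?_ (by positivity)
    rw [mul_pow, Real.sq_sqrt (by norm_num)]
    nlinarith [sq_nonneg (‖q i₀ - x i₀‖ - ‖restr (interval n a len) q‖)]
  linarith

/-- The residual does not drop below the noise level while a cluster is missing. -/
theorem sub_le_norm_residual (Φ : Matrix (Fin m) (Fin n) 𝕜) (hs : Sizes n b p L L' K)
    (hc : TrueClusters n b p L' K c j) (hi : Padding n b p c j i)
    {x z : EuclideanSpace 𝕜 (Fin n)} {e : EuclideanSpace 𝕜 (Fin m)} {ε : ℝ} (he : ‖e‖ ≤ ε)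
    (hx : supp x ⊆ clusterSet n b c j) {A : Finset (Fin g)}
    (hz : IsLeastSquares Φ (mulE Φ x + e) (padded n b p i A) z) {η : ℝ}
    (hdev : DevBound Φ b p L c j i A η) {i₀ : Fin n} (hi₀ : i₀ ∈ remaining n b c j A)
    (hΦ : ∑ s, ‖Φ s i₀‖ ^ 2 = 1) :
    ‖x i₀‖ - (η * ‖restr (remaining n b c j A) x‖ +
      √(1 + pibric Φ b p L' L' (K - 1) 2) * ε) ≤ ‖residual Φ (mulE Φ x + e) z‖ := by
  -- The empty interval: only the index `i₀` is tested.
  obtain ⟨-, h1⟩ := norm_restr_corr_sub_le Φ hs hc hi he hx hz hdev hi₀ (a := 0) (len := 0)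
    (Nat.zero_le _)
  have hi₀T := Finset.disjoint_left.1 (disjoint_remaining_padded hs hc hi A) hi₀
  have h2 := (norm_restr_mono (A := {i₀}) (Finset.singleton_subset_iff.2
    (Finset.mem_sdiff.2 ⟨Finset.mem_insert_self _ _, hi₀T⟩)) _).trans h1
  rw [norm_restr_singleton, PiLp.sub_apply, restr_apply, if_pos hi₀] at h2
  have h3 := norm_mulE_conjTranspose_apply_le hΦ (residual Φ (mulE Φ x + e) z)
  have h4 := norm_le_insert (mulE Φᴴ (residual Φ (mulE Φ x + e) z) i₀) (x i₀)
  linarith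

/-- Least squares on a superset of the support. -/
theorem IsLeastSquares.norm_mulE_sub_le {Φ : Matrix (Fin m) (Fin n) 𝕜}
    {x z : EuclideanSpace 𝕜 (Fin n)} {e : EuclideanSpace 𝕜 (Fin m)} {T : Finset (Fin n)}
    (hz : IsLeastSquares Φ (mulE Φ x + e) T z) (hx : supp x ⊆ T) :
    ‖mulE Φ (z - x)‖ ≤ ‖e‖ := by
  have h1 := norm_residual_sq Φ e (T := T) (z := 0) (supp_subset_iff.2 fun _ _ => rfl)
  rw [residual, mulE_zero, sub_zero, sub_zero] at h1
  have h2 : mulE Φ (z - x) = (colSpan Φ T).starProjection e := by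
    rw [mulE_sub, hz.mulE_eq, map_add,
      Submodule.starProjection_eq_self_iff.2 (mulE_mem_colSpan Φ hx), add_sub_cancel_left]
  rw [h2, ← sq_le_sq₀ (norm_nonneg _) (norm_nonneg _), h1]
  nlinarith [sq_nonneg ‖e - (colSpan Φ T).starProjection e‖]

/-- Every cluster in `A` has at least one block, so at most `K - |A|` blocks are undiscovered. -/
theorem norm_restr_remaining_sq_le (hc : TrueClusters n b p L' K c j) (A : Finset (Fin g))
    {x : EuclideanSpace 𝕜 (Fin n)} {M : ℝ} (hM : ∀ t, ‖x t‖ ≤ M) :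
    ‖restr (remaining n b c j A) x‖ ^ 2 ≤ ((K : ℝ) - A.card) * b * M ^ 2 := by
  have h1 : (remaining n b c j A).card ≤ (∑ s ∈ Aᶜ, j s) * b := by
    rw [Finset.sum_mul]
    refine Finset.card_biUnion_le.trans (Finset.sum_le_sum fun s _ => ?_)
    have h2 : (interval n (c s) (j s * b)).card =
        ((interval n (c s) (j s * b)).map Fin.valEmbedding).card := (Finset.card_map _).symm
    have h3 : (interval n (c s) (j s * b)).map Fin.valEmbedding ⊆
        Finset.Ico (c s) (c s + j s * b) := by
      intro t ht
      obtain ⟨t, ht', rfl⟩ := Finset.mem_map.1 ht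
      exact Finset.mem_Ico.2 (mem_interval.1 ht')
    rw [h2]
    simpa using Finset.card_le_card h3
  have h2 : A.card + ∑ s ∈ Aᶜ, j s ≤ K := by
    rw [← hc.sum_eq, ← Finset.sum_add_sum_compl A, Finset.card_eq_sum_ones]
    exact Nat.add_le_add_right (Finset.sum_le_sum fun s _ => hc.one_le s) _
  have h3 : (A.card : ℝ) + (∑ s ∈ Aᶜ, j s : ℕ) ≤ K := by exact_mod_cast h2
  have h4 : ((remaining n b c j A).card : ℝ) ≤ (∑ s ∈ Aᶜ, j s : ℕ) * b := by exact_mod_cast h1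
  rw [norm_restr_sq]
  calc ∑ t ∈ remaining n b c j A, ‖x t‖ ^ 2 ≤ ∑ _t ∈ remaining n b c j A, M ^ 2 :=
        Finset.sum_le_sum fun t _ => pow_le_pow_left₀ (norm_nonneg _) (hM t) 2
    _ = (remaining n b c j A).card * M ^ 2 := by rw [Finset.sum_const, nsmul_eq_mul]
    _ ≤ _ := by
        refine mul_le_mul_of_nonneg_right (h4.trans ?_) (sq_nonneg _)
        exact mul_le_mul_of_nonneg_right (by linarith) (Nat.cast_nonneg _)

end

/-! ### Numerical inequalities for the recovery condition -/

noncomputable section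

section numerics

/-- The factor of `xmax` in the recovery condition. -/
def errorFactor (δ B' : ℝ) (b K : ℕ) : ℝ :=
  δ * √(B' * b) / (1 + δ) * (K / (4 * B') * (1 + δ) + √((K : ℝ) + 1) + 1)

variable {δ B' : ℝ} {b p K k : ℕ}

theorem errorFactor_nonneg (hδ : 0 ≤ δ) (hB' : 0 ≤ B') : 0 ≤ errorFactor δ B' b K := by
  unfold errorFactor; positivity

/-- Cauchy–Schwarz for `(√α, √β)` and `(√x, √y)`. -/
theorem sqrt_mul_add_sqrt_mul_le {α β x y : ℝ} (hα : 0 ≤ α) (hβ : 0 ≤ β) (hx : 0 ≤ x)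
    (hy : 0 ≤ y) : √(α * x) + √(β * y) ≤ √((α + β) * (x + y)) := by
  refine Real.le_sqrt_of_sq_le ?_
  rw [Real.sqrt_mul hα, Real.sqrt_mul hβ]
  have h1 := Real.sq_sqrt hα
  have h2 := Real.sq_sqrt hβ
  have h3 := Real.sq_sqrt hx
  have h4 := Real.sq_sqrt hy
  have h5 := sq_nonneg (√α * √y - √β * √x)
  have h6 : (α + β) * (x + y) = (√α ^ 2 + √β ^ 2) * (√x ^ 2 + √y ^ 2) := by
    rw [h1, h2, h3, h4]
  rw [h6]
  nlinarith

/-- Here `2 b + p ≤ B' b`, with equality for `b = p = 2`, so the term with `√(K + 1)` alone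
dominates the left side. -/
theorem sqrt_le_of_two_le_width {B' : ℝ} (hb : 2 ≤ b) (hp : 2 ≤ p)
    (hB' : B' = (p : ℝ) * b - b + 1) :
    √(K * (2 * b + p)) ≤ √(B' * b) * (K / (4 * B')) + √(B' * b) * (√((K : ℝ) + 1) + 1) - 1 := by
  have hb' : (2 : ℝ) ≤ b := by exact_mod_cast hb
  have hp' : (2 : ℝ) ≤ p := by exact_mod_cast hp
  have hB1 : 1 ≤ B' := by nlinarith
  have h1 : (2 * b + p : ℝ) ≤ B' * b := by
    rw [hB']; nlinarith [mul_nonneg (sub_nonneg.2 hb') (sub_nonneg.2 hp')]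
  have h2 : √(K * (2 * b + p)) ≤ √(B' * b) * √((K : ℝ) + 1) := by
    rw [← Real.sqrt_mul (by positivity), mul_comm]
    exact Real.sqrt_le_sqrt (mul_le_mul h1 (by linarith) (by positivity) (by positivity))
  have h3 : 1 ≤ √(B' * b) := Real.one_le_sqrt.2 (by nlinarith)
  have h4 : 0 ≤ √(B' * b) * (K / (4 * B')) := by positivity
  linarith

theorem sqrt_le_of_width_eq_one {P : ℝ} (hP : 3 ≤ P) :
    √(K * (2 + P)) ≤ √P * (K / (4 * P)) + √P * (√((K : ℝ) + 1) + 1) - 1 := by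
  set q := √P with hq
  set r := √(K : ℝ) with hr
  have hq2 : q ^ 2 = P := Real.sq_sqrt (by linarith)
  have hr2 : r ^ 2 = K := Real.sq_sqrt (Nat.cast_nonneg _)
  have hr0 : 0 ≤ r := Real.sqrt_nonneg _
  have hq0 : 17 / 10 ≤ q := Real.le_sqrt_of_sq_le (by norm_num; linarith)
  have hqpos : 0 < q := by linarith
  have h1 : r ≤ √((K : ℝ) + 1) := Real.sqrt_le_sqrt (by linarith)
  have h2 : √(K * (2 + P)) ≤ r * (q + 1 / q) := by
    rw [Real.sqrt_le_left (by positivity), mul_pow, hr2]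
    refine mul_le_mul_of_nonneg_left ?_ (Nat.cast_nonneg _)
    have : (q + 1 / q) ^ 2 = q ^ 2 + 2 + (1 / q) ^ 2 := by field_simp; ring
    rw [this, hq2]
    linarith [sq_nonneg (1 / q)]
  have h3 : q * (K / (4 * P)) = r ^ 2 / (4 * q) := by
    rw [← hr2, ← hq2]; field_simp
  rw [h3]
  have h4 : q * r ≤ q * √((K : ℝ) + 1) := mul_le_mul_of_nonneg_left h1 hqpos.le
  -- After multiplication by `4 q` this is `(r - 2)² + 4 q² - 4 q - 4 ≥ 0`, which holds since `q ≥
  -- 1.7`; this is where `P ≥ 3` enters.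
  have h5 : r / q - q + 1 ≤ r ^ 2 / (4 * q) := by
    rw [le_div_iff₀ (by positivity)]
    have : (r / q - q + 1) * (4 * q) = 4 * r - 4 * q ^ 2 + 4 * q := by field_simp
    rw [this]
    nlinarith [sq_nonneg (r - 2), sq_nonneg (q - 17 / 10)]
  have h6 : r * (q + 1 / q) = q * r + r / q := by ring
  linarith

theorem sqrt_le_of_width_eq_one_of_two :
    √(K * (2 + 2)) ≤ √2 * (K / (4 * 2)) + √2 * (√((K : ℝ) + 1) + 1) - 1 := by
  set r := √(K : ℝ) with hr
  have hr2 : r ^ 2 = K := Real.sq_sqrt (Nat.cast_nonneg _)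
  have hr0 : 0 ≤ r := Real.sqrt_nonneg _
  have h2 : (1.414 : ℝ) ≤ √2 := Real.le_sqrt_of_sq_le (by norm_num)
  -- Cauchy–Schwarz of `(r, 1)` against nearly the unit vector `(√3 / 2, 1 / 2)`.
  have h1 : 0.866 * r + 0.5 ≤ √((K : ℝ) + 1) := by
    refine Real.le_sqrt_of_sq_le ?_
    rw [← hr2]
    nlinarith [sq_nonneg (0.5 * r - 0.866)]
  have h3 : √((K : ℝ) * (2 + 2)) = r * 2 := by
    rw [Real.sqrt_mul (Nat.cast_nonneg _), show (2 + 2 : ℝ) = 2 ^ 2 by norm_num,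
      Real.sqrt_sq (by norm_num)]
  have h4 : 1.414 * (r ^ 2 / (4 * 2) + (0.866 * r + 0.5 + 1)) ≤
      √2 * (r ^ 2 / (4 * 2) + (√((K : ℝ) + 1) + 1)) :=
    mul_le_mul h2 (by linarith) (by positivity) (by positivity)
  rw [h3, ← hr2]
  rw [← hr2] at h4
  nlinarith [sq_nonneg (r - 2.2)]

/-- The left side is at most `δ √(K (2 b + p))` for every `k`. On the right, `E < 1` removes the
denominator: with `a = √(B' b) (√(K + 1) + 1)` the quotient `δ a / (1 + δ)` is at most `1`, hence at
least `δ (a - 1)`. The three inequalities above compare what remains. -/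
theorem mul_sqrt_add_sqrt_le_errorFactor (hδ : 0 ≤ δ) (hb : 1 ≤ b) (hp : 2 ≤ p)
    (hB' : B' = (p : ℝ) * b - b + 1) (hk : k ≤ K) (hE : errorFactor δ B' b K < 1) :
    δ * (√(2 * (((K : ℝ) - k) * b)) + √(k * p)) ≤ errorFactor δ B' b K := by
  have hk' : (k : ℝ) ≤ K := by exact_mod_cast hk
  have hb' : (1 : ℝ) ≤ b := by exact_mod_cast hb
  have hp' : (2 : ℝ) ≤ p := by exact_mod_cast hp
  have hB1 : 1 ≤ B' := by nlinarith
  have h1 : √(2 * (((K : ℝ) - k) * b)) + √(k * p) ≤ √(K * (2 * b + p)) := by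
    have := sqrt_mul_add_sqrt_mul_le (sub_nonneg.2 hk') (Nat.cast_nonneg k)
      (by positivity : (0 : ℝ) ≤ 2 * b) (Nat.cast_nonneg p)
    rw [sub_add_cancel] at this
    rwa [mul_left_comm]
  have h2 : √(K * (2 * b + p)) ≤
      √(B' * b) * (K / (4 * B')) + √(B' * b) * (√((K : ℝ) + 1) + 1) - 1 := by
    rcases Nat.lt_or_ge b 2 with h | h
    · have hb1 : b = 1 := by omega
      subst hb1
      rw [Nat.cast_one] at *
      have : B' = p := by rw [hB']; ring
      rw [this, mul_one, mul_one]
      rcases Nat.lt_or_ge p 3 with h | h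
      · have hp2 : p = 2 := by omega
        subst hp2
        exact_mod_cast sqrt_le_of_width_eq_one_of_two
      · exact sqrt_le_of_width_eq_one (by exact_mod_cast h)
    · exact sqrt_le_of_two_le_width h hp hB'
  have h3 : errorFactor δ B' b K = δ * (√(B' * b) * (K / (4 * B'))) +
      δ * (√(B' * b) * (√((K : ℝ) + 1) + 1)) / (1 + δ) := by
    unfold errorFactor; field_simp; ring
  set a := √(B' * b) * (√((K : ℝ) + 1) + 1) with ha
  have h4 : 0 ≤ δ * (√(B' * b) * (K / (4 * B'))) := by positivity
  have h5 : δ * a / (1 + δ) ≤ 1 := by linarith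
  have h6 : δ * a / (1 + δ) = δ * (a - δ * a / (1 + δ)) := by field_simp; ring
  calc _ ≤ δ * (√(B' * b) * (K / (4 * B')) + a - 1) :=
        mul_le_mul_of_nonneg_left (h1.trans h2) hδ
    _ ≤ δ * (√(B' * b) * (K / (4 * B'))) + δ * (a - δ * a / (1 + δ)) := by
        rw [← mul_add δ]; exact mul_le_mul_of_nonneg_left (by linarith) hδ
    _ = _ := by rw [h3, ← h6]

/-- The case `p = 1`, where `B' = 1`. With `y = √(2 K)` the smallness of `δ` gives `δ y ≤ 1`, hence
`1 / (1 + δ) ≥ y / (y + 1)`, and `δ` drops out. -/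
theorem mul_sqrt_le_errorFactor (hδ : 0 ≤ δ) (hK : 1 ≤ K)
    (hδK : δ < 1 / √(2 * (K : ℝ) + 1)) : δ * √(2 * (K * b)) ≤ errorFactor δ 1 b K := by
  have hK' : (1 : ℝ) ≤ K := by exact_mod_cast hK
  set y := √(2 * (K : ℝ)) with hy
  have hy2 : y ^ 2 = 2 * K := Real.sq_sqrt (by positivity)
  have hy0 : 0 < y := Real.sqrt_pos.2 (by linarith)
  have h1 : δ * y ≤ 1 := by
    rw [lt_div_iff₀ (Real.sqrt_pos.2 (by positivity))] at hδK
    exact (mul_le_mul_of_nonneg_left (Real.sqrt_le_sqrt (by linarith)) hδ).trans hδK.le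
  -- Essentially the tangent of `√(y² / 2 + 1)` at `y = √2`, that is at `K = 1`; the constant `√2 /
  -- 2` is rounded down.
  have h2 : y / 2 + 0.7 ≤ √((K : ℝ) + 1) := by
    refine Real.le_sqrt_of_sq_le ?_
    nlinarith [sq_nonneg (y - 1.4)]
  set S := √((K : ℝ) + 1) with hS
  have h3 : y ≤ K / 4 + (S + 1) / (1 + δ) := by
    have h4 : (S + 1) * y / (y + 1) ≤ (S + 1) / (1 + δ) := by
      rw [div_le_div_iff₀ (by linarith) (by linarith), mul_assoc]
      exact mul_le_mul_of_nonneg_left (by nlinarith) (by positivity)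
    have h5 : y ≤ K / 4 + (S + 1) * y / (y + 1) := by
      rw [← sub_le_iff_le_add', le_div_iff₀ (by linarith)]
      have h6 : (y / 2 + 0.7 + 1) * y ≤ (S + 1) * y :=
        mul_le_mul_of_nonneg_right (by linarith) hy0.le
      have h7 : (K : ℝ) = y ^ 2 / 2 := by linarith
      rw [h7]
      nlinarith [mul_nonneg hy0.le (sq_nonneg (y - 1.5))]
    linarith
  have h4 : errorFactor δ 1 b K = δ * √b * (K / 4 + (S + 1) / (1 + δ)) := by
    unfold errorFactor; rw [one_mul, mul_one]; field_simp; ring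
  rw [h4, ← mul_assoc, Real.sqrt_mul (by positivity), ← hy]
  calc δ * (y * √b) = δ * √b * y := by ring
    _ ≤ _ := mul_le_mul_of_nonneg_left h3 (by positivity)

/-- The complex recovery condition implies the real one. -/
theorem recovery_condition_of_complex {x₀ x₁ N : ℝ} (hδ : 0 ≤ δ) (hδ1 : δ < 1) (hb : 1 ≤ b)
    (hK : 1 ≤ K) (hB' : 0 ≤ B') (hx : x₀ ≤ x₁) (hx₁ : 0 < x₁) (hN : 0 ≤ N)
    (h : x₀ > (δ * √((K : ℝ) * b) + δ * (1 - δ ^ 2) * √(B' * b) / (1 + δ) *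
        (K / (4 * B') * (1 + δ) + √((K : ℝ) + 1) + 1)) * x₁ /
          √((1 - δ ^ 2) ^ 2 + δ ^ 2) + N) :
    errorFactor δ B' b K * x₁ + N < x₀ := by
  set E := errorFactor δ B' b K with hE
  have hE0 : 0 ≤ E := errorFactor_nonneg hδ hB'
  have h1 : δ * (1 - δ ^ 2) * √(B' * b) / (1 + δ) *
      (K / (4 * B') * (1 + δ) + √((K : ℝ) + 1) + 1) = (1 - δ ^ 2) * E := by
    rw [hE, errorFactor]; ring
  rw [h1] at h
  set D := √((1 - δ ^ 2) ^ 2 + δ ^ 2) with hD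
  have hs : 0 < 1 - δ ^ 2 := by nlinarith
  have hD0 : 0 < D := Real.sqrt_pos.2 (by positivity)
  have hD1 : D ≤ (1 - δ ^ 2) + δ := by
    rw [hD, Real.sqrt_le_left (by positivity)]
    nlinarith [mul_nonneg hδ hs.le]
  have hKb : δ ≤ δ * √((K : ℝ) * b) := by
    refine le_mul_of_one_le_right hδ (Real.one_le_sqrt.2 ?_)
    have : 1 ≤ K * b := Nat.mul_pos hK hb
    exact_mod_cast this
  -- The quotient is compared with `min E 1` because `D ≤ (1 - δ²) + δ`. If `E ≥ 1`, the condition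
  -- would give `x₁ + N < x₀`, against `x₀ ≤ x₁`; otherwise the minimum is `E`.
  have hC : min E 1 ≤ (δ * √((K : ℝ) * b) + (1 - δ ^ 2) * E) / D := by
    rw [le_div_iff₀ hD0]
    have h2 : min E 1 * D ≤ min E 1 * ((1 - δ ^ 2) + δ) :=
      mul_le_mul_of_nonneg_left hD1 (le_min hE0 zero_le_one)
    have h3 : min E 1 * (1 - δ ^ 2) ≤ E * (1 - δ ^ 2) :=
      mul_le_mul_of_nonneg_right (min_le_left _ _) hs.le
    have h4 : min E 1 * δ ≤ 1 * δ := mul_le_mul_of_nonneg_right (min_le_right _ _) hδ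
    linarith
  have h2 := mul_le_mul_of_nonneg_right hC hx₁.le
  rw [div_mul_eq_mul_div] at h2
  rcases le_total E 1 with h3 | h3
  · rw [min_eq_left h3] at h2; linarith
  · rw [min_eq_right h3] at h2; linarith

/-- The noise factor of the recovery condition is at least `2 √(1 + δ)`. -/
theorem two_mul_sqrt_le_noiseFactor (hδ : 0 ≤ δ) (hB' : 1 ≤ B')
    (hδK : δ < 1 / √(2 * (K : ℝ) + 1)) :
    2 * √(1 + δ) ≤ √(2 * (1 + B') * (1 + δ)) / (1 - δ * √(2 * (K : ℝ) + 1)) := by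
  have h0 : 0 < √(2 * (K : ℝ) + 1) := Real.sqrt_pos.2 (by positivity)
  rw [lt_div_iff₀ h0] at hδK
  rw [le_div_iff₀ (by linarith)]
  have h1 : 2 * √(1 + δ) ≤ √(2 * (1 + B') * (1 + δ)) := by
    refine Real.le_sqrt_of_sq_le ?_
    rw [mul_pow, Real.sq_sqrt (by linarith)]
    nlinarith
  have h2 : 0 ≤ δ * √(2 * (K : ℝ) + 1) := by positivity
  refine le_trans ?_ h1
  exact mul_le_of_le_one_right (by positivity) (by linarith)

end numerics

end

/-! ### Consequences of the recovery condition -/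

noncomputable section

variable {𝕜 : Type*} [RCLike 𝕜] {m n b p L L' g K : ℕ} {c j i : Fin g → ℕ}

theorem Setting.sizes {Φ : Matrix (Fin m) (Fin n) 𝕜} (h : Setting Φ b p L L' K) :
    Sizes n b p L L' K :=
  ⟨h.one_le_b, h.one_le_p, h.le_L, h.sep, h.long⟩

theorem image_norm_finite (x : EuclideanSpace 𝕜 (Fin n)) :
    ((fun i => ‖x i‖) '' {i | x i ≠ 0}).Finite := Set.toFinite _

theorem xmin_le {x : EuclideanSpace 𝕜 (Fin n)} {t : Fin n} (ht : x t ≠ 0) : xmin x ≤ ‖x t‖ :=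
  csInf_le (image_norm_finite x).bddBelow ⟨t, ht, rfl⟩

theorem le_xmax_of_ne {x : EuclideanSpace 𝕜 (Fin n)} {t : Fin n} (ht : x t ≠ 0) :
    ‖x t‖ ≤ xmax x :=
  le_csSup (image_norm_finite x).bddAbove ⟨t, ht, rfl⟩

theorem xmax_nonneg (x : EuclideanSpace 𝕜 (Fin n)) : 0 ≤ xmax x :=
  Real.sSup_nonneg fun _ ⟨_, _, h⟩ => h ▸ norm_nonneg _

theorem le_xmax (x : EuclideanSpace 𝕜 (Fin n)) (t : Fin n) : ‖x t‖ ≤ xmax x := by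
  by_cases ht : x t = 0
  · rw [ht, norm_zero]; exact xmax_nonneg x
  · exact le_xmax_of_ne ht

/-- The hypotheses of the recovery theorem in the form in which they are used. -/
structure Recoverable (Φ : Matrix (Fin m) (Fin n) 𝕜) (x : EuclideanSpace 𝕜 (Fin n))
    (e : EuclideanSpace 𝕜 (Fin m)) (b p L L' K : ℕ) (ε : ℝ) (c j : Fin g → ℕ) : Prop where
  setting : Setting Φ b p L L' K
  clusters : TrueClusters n b p L' K c j
  supp_eq : supp x = clusterSet n b c j
  noise : ‖e‖ ≤ ε
  small : pibric Φ b p L' L' (K - 1) 2 < 1 / √(2 * (K : ℝ) + 1)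
  bound : errorFactor (pibric Φ b p L' L' (K - 1) 2) ((p : ℝ) * b - b + 1) b K * xmax x +
    2 * √(1 + pibric Φ b p L' L' (K - 1) 2) * ε < xmin x

theorem exists_mem_cluster (hs : Sizes n b p L L' K) (hc : TrueClusters n b p L' K c j)
    (s : Fin g) : ∃ t : Fin n, (t : ℕ) = c s ∧ t ∈ interval n (c s) (j s * b) := by
  have h1 := hc.in_range s
  have h2 : 1 ≤ j s * b := Nat.mul_pos (hc.one_le s) hs.one_le_b
  exact ⟨⟨c s, by omega⟩, rfl, mem_interval.2 ⟨le_rfl, show c s < c s + j s * b by omega⟩⟩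

variable {Φ : Matrix (Fin m) (Fin n) 𝕜} {x z : EuclideanSpace 𝕜 (Fin n)}
  {e : EuclideanSpace 𝕜 (Fin m)} {ε : ℝ}

theorem Setting.one_le_width (h : Setting Φ b p L L' K) : 1 ≤ (p : ℝ) * b - b + 1 := by
  have h1 : (1 : ℝ) ≤ p := by exact_mod_cast h.one_le_p
  have h2 : (0 : ℝ) ≤ b := Nat.cast_nonneg _
  nlinarith

theorem lt_one_of_small {δ : ℝ} (h : δ < 1 / √(2 * (K : ℝ) + 1)) : δ < 1 := by
  refine h.trans_le ?_
  rw [div_le_one (Real.sqrt_pos.2 (by positivity))]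
  exact Real.one_le_sqrt.2 (by linarith [(Nat.cast_nonneg K : (0 : ℝ) ≤ K)])

theorem xmin_le_xmax_of_clusters (h : Setting Φ b p L L' K) (hc : TrueClusters n b p L' K c j)
    (hx : supp x = clusterSet n b c j) : xmin x ≤ xmax x ∧ 0 < xmax x := by
  have hg : g ≠ 0 := by
    rintro rfl
    have h1 := hc.sum_eq
    have h2 := h.one_le_K
    simp at h1
    omega
  obtain ⟨t, -, ht⟩ := exists_mem_cluster h.sizes hc ⟨0, by omega⟩
  have h1 : x t ≠ 0 := mem_supp.1 (hx ▸ cluster_subset_clusterSet _ ht)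
  exact ⟨(xmin_le h1).trans (le_xmax_of_ne h1), (norm_pos_iff.2 h1).trans_le (le_xmax_of_ne h1)⟩

namespace Recoverable

/-- Otherwise the condition would force `xmax x < xmin x`. -/
theorem errorFactor_lt_one (H : Recoverable Φ x e b p L L' K ε c j) :
    errorFactor (pibric Φ b p L' L' (K - 1) 2) ((p : ℝ) * b - b + 1) b K < 1 := by
  have h1 := xmin_le_xmax_of_clusters H.setting H.clusters H.supp_eq
  have h2 := H.bound
  have hε : 0 ≤ ε := (norm_nonneg e).trans H.noise
  have h3 : 0 ≤ 2 * √(1 + pibric Φ b p L' L' (K - 1) 2) * ε := by positivity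
  by_contra h4
  have := mul_le_mul_of_nonneg_right (not_lt.1 h4) h1.2.le
  linarith

theorem exists_devBound (H : Recoverable Φ x e b p L L' K ε c j) (hi : Padding n b p c j i)
    (A : Finset (Fin g)) : ∃ η, DevBound Φ b p L c j i A η ∧ 0 ≤ η ∧
      √2 * η * √(((K : ℝ) - A.card) * b) ≤
        errorFactor (pibric Φ b p L' L' (K - 1) 2) ((p : ℝ) * b - b + 1) b K := by
  have hs := H.setting.sizes
  have hE1 := H.errorFactor_lt_one
  have hAg : A.card ≤ g := by simpa using Finset.card_le_univ A
  have hAK : A.card ≤ K := hAg.trans H.clusters.card_le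
  set δ := pibric Φ b p L' L' (K - 1) 2 with hδ
  have hδ0 : 0 ≤ δ := pibric_nonneg ..
  set E := errorFactor δ ((p : ℝ) * b - b + 1) b K with hE
  rcases Nat.lt_or_ge p 2 with hp | hp
  · have hp1 : p = 1 := by have := hs.one_le_p; omega
    refine ⟨δ, devBound_of_eq_one Φ hs hp1 H.clusters hi A (lt_one_of_small H.small).le, hδ0, ?_⟩
    have h1 := mul_sqrt_le_errorFactor (b := b) hδ0 H.setting.one_le_K H.small
    have h2 : (p : ℝ) * b - b + 1 = 1 := by rw [hp1]; simp
    rw [hE, h2]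
    refine le_trans ?_ h1
    rw [mul_comm √2, mul_assoc, ← Real.sqrt_mul (by norm_num : (0 : ℝ) ≤ 2)]
    refine mul_le_mul_of_nonneg_left (Real.sqrt_le_sqrt (mul_le_mul_of_nonneg_left ?_
      zero_le_two)) hδ0
    exact mul_le_mul_of_nonneg_right (by linarith [(Nat.cast_nonneg A.card : (0 : ℝ) ≤ A.card)])
      (Nat.cast_nonneg _)
  · have h1 := mul_sqrt_add_sqrt_le_errorFactor hδ0 hs.one_le_b hp rfl hAK hE1
    rw [← hE, mul_add, mul_comm δ √(A.card * p)] at h1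
    set ρ := √(A.card * p) * δ with hρ
    have h2 : 0 ≤ δ * √(2 * (((K : ℝ) - A.card) * b)) := by positivity
    have h3 : ρ < 1 := by linarith
    refine ⟨_, devBound_of_one_lt Φ hs hp H.clusters hi A h3, by
      have : 0 ≤ 1 - ρ := by linarith
      positivity, ?_⟩
    have h4 : 0 < 1 - ρ := by linarith
    rw [mul_div_assoc', div_mul_eq_mul_div, div_le_iff₀ h4]
    rw [Real.sqrt_mul (by norm_num)] at h1
    have h5 : 0 ≤ ρ := by positivity
    -- From `√2 δ √((K - |A|) b) + ρ ≤ E` and `E < 1` follows `√2 δ √((K - |A|) b) ≤ E - ρ ≤ E (1 -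
    -- ρ)`.
    nlinarith

/-- The noise term `2 √(1 + δ) ε` serves two purposes: it dominates `√2 √(1 + δ) ε` for the
comparison of correlations, and `√(1 + δ) ε + ε` for the size of the residual. -/
theorem bounds (H : Recoverable Φ x e b p L L' K ε c j) {A : Finset (Fin g)} {η : ℝ}
    (hη : 0 ≤ η) (hηE : √2 * η * √(((K : ℝ) - A.card) * b) ≤
        errorFactor (pibric Φ b p L' L' (K - 1) 2) ((p : ℝ) * b - b + 1) b K) {t : Fin n}
    (ht : t ∈ remaining n b c j A) :
    √2 * (η * ‖restr (remaining n b c j A) x‖ +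
        √(1 + pibric Φ b p L' L' (K - 1) 2) * ε) < ‖x t‖ ∧
      ε ≤ ‖x t‖ - (η * ‖restr (remaining n b c j A) x‖ +
        √(1 + pibric Φ b p L' L' (K - 1) 2) * ε) := by
  have hxt : x t ≠ 0 := mem_supp.1 (H.supp_eq ▸ remaining_subset_clusterSet A ht)
  have h1 := xmin_le hxt
  have h2 := H.bound
  have hδ0 : 0 ≤ pibric Φ b p L' L' (K - 1) 2 := pibric_nonneg ..
  have hε : 0 ≤ ε := (norm_nonneg e).trans H.noise
  set U := ‖restr (remaining n b c j A) x‖ with hU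
  set s := √(1 + pibric Φ b p L' L' (K - 1) 2) with hsdef
  have hs1 : 1 ≤ s := Real.one_le_sqrt.2 (by linarith)
  have hsε : ε ≤ s * ε := le_mul_of_one_le_left hε hs1
  have h3 : U ≤ √(((K : ℝ) - A.card) * b) * xmax x := by
    have h4 := norm_restr_remaining_sq_le H.clusters A (le_xmax x)
    rw [← Real.sqrt_sq (xmax_nonneg x), ← Real.sqrt_mul' _ (sq_nonneg _)]
    exact Real.le_sqrt_of_sq_le h4
  have h4 : √2 * (η * U) ≤
      errorFactor (pibric Φ b p L' L' (K - 1) 2) ((p : ℝ) * b - b + 1) b K * xmax x :=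
    calc √2 * (η * U) = √2 * η * U := by ring
      _ ≤ √2 * η * (√(((K : ℝ) - A.card) * b) * xmax x) :=
        mul_le_mul_of_nonneg_left h3 (by positivity)
      _ = √2 * η * √(((K : ℝ) - A.card) * b) * xmax x := by ring
      _ ≤ _ := mul_le_mul_of_nonneg_right hηE (xmax_nonneg x)
  have h5 : (1 : ℝ) ≤ √2 := Real.one_le_sqrt.2 (by norm_num)
  have h6 : √2 ≤ 2 := (Real.sqrt_le_left (by norm_num)).2 (by norm_num)
  have h7 : √2 * (s * ε) ≤ 2 * (s * ε) := mul_le_mul_of_nonneg_right h6 (by positivity)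
  have h8 : η * U ≤ √2 * (η * U) := le_mul_of_one_le_left (by positivity) h5
  constructor
  · linarith
  · linarith

theorem corrNorm_lt (H : Recoverable Φ x e b p L L' K ε c j) (hi : Padding n b p c j i)
    {A : Finset (Fin g)} (hz : IsLeastSquares Φ (mulE Φ x + e) (padded n b p i A) z)
    {t : Fin n} (ht : t ∈ remaining n b c j A) {a len : ℕ} (hlen : len ≤ L)
    (hD : Disjoint (interval n a len) (remaining n b c j A)) :
    corrNorm Φ (interval n a len) (residual Φ (mulE Φ x + e) z) <
      ‖mulE Φᴴ (residual Φ (mulE Φ x + e) z) t‖ := by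
  obtain ⟨η, hdev, hη, hηE⟩ := H.exists_devBound hi A
  exact corrNorm_lt_of_disjoint Φ H.setting.sizes H.clusters hi H.noise H.supp_eq.subset hz hdev
    ht hlen hD (H.bounds hη hηE ht).1

theorem exists_mem_remaining (H : Recoverable Φ x e b p L L' K ε c j) {A : Finset (Fin g)}
    (hA : A.card < g) : (remaining n b c j A).Nonempty := by
  obtain ⟨s, hs⟩ : ∃ s, s ∉ A := by
    by_contra h
    push Not at h
    rw [Finset.eq_univ_of_forall h, Finset.card_univ, Fintype.card_fin] at hA
    exact lt_irrefl _ hA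
  obtain ⟨t, -, ht⟩ := exists_mem_cluster H.setting.sizes H.clusters s
  exact ⟨t, Finset.mem_biUnion.2 ⟨s, Finset.mem_compl.2 hs, ht⟩⟩

theorem le_norm_residual (H : Recoverable Φ x e b p L L' K ε c j) (hi : Padding n b p c j i)
    {A : Finset (Fin g)} (hz : IsLeastSquares Φ (mulE Φ x + e) (padded n b p i A) z)
    (hA : A.card < g) : ε ≤ ‖residual Φ (mulE Φ x + e) z‖ := by
  obtain ⟨η, hdev, hη, hηE⟩ := H.exists_devBound hi A
  obtain ⟨t, ht⟩ := H.exists_mem_remaining hA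
  exact (H.bounds hη hηE ht).2.trans (sub_le_norm_residual Φ H.setting.sizes H.clusters hi H.noise
    H.supp_eq.subset hz hdev ht (H.setting.unit_columns t))

/-- Lower restricted isometry bound on the padded clusters. -/
theorem one_sub_mul_norm_sq_le (H : Recoverable Φ x e b p L L' K ε c j)
    (hi : Padding n b p c j i) {A : Finset (Fin g)} {v : EuclideanSpace 𝕜 (Fin n)}
    (hv : supp v ⊆ padded n b p i A) :
    (1 - errorFactor (pibric Φ b p L' L' (K - 1) 2) ((p : ℝ) * b - b + 1) b K) * ‖v‖ ^ 2 ≤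
      ‖mulE Φ v‖ ^ 2 := by
  have hs := H.setting.sizes
  have hE1 := H.errorFactor_lt_one
  have hAg : A.card ≤ g := by simpa using Finset.card_le_univ A
  have hAK : A.card ≤ K := hAg.trans H.clusters.card_le
  set δ := pibric Φ b p L' L' (K - 1) 2 with hδ
  have hδ0 : 0 ≤ δ := pibric_nonneg ..
  set E := errorFactor δ ((p : ℝ) * b - b + 1) b K with hE
  have key : ‖restr (padded n b p i A) (dev Φ v)‖ ≤ E * ‖v‖ := by
    rcases Nat.lt_or_ge p 2 with hp | hp
    · have hp1 : p = 1 := by have := hs.one_le_p; omega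
      have hTc := padded_subset_clusterSet_of_eq_one hp1 H.clusters hi A
      have h1 := (norm_restr_mono (hTc.trans Finset.subset_union_left) _).trans
        (norm_restr_dev_clusterSet_le Φ hs H.clusters (hv.trans hTc) (a := 0) (Nat.zero_le L))
      refine h1.trans (mul_le_mul_of_nonneg_right ?_ (norm_nonneg _))
      have h2 := mul_sqrt_le_errorFactor (b := b) hδ0 H.setting.one_le_K H.small
      have h3 : (p : ℝ) * b - b + 1 = 1 := by rw [hp1]; simp
      rw [hE, h3]
      refine le_trans (le_mul_of_one_le_right hδ0 (Real.one_le_sqrt.2 ?_)) h2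
      have h4 : 1 ≤ 2 * (K * b) := by
        have := Nat.mul_pos H.setting.one_le_K hs.one_le_b; omega
      exact_mod_cast h4
    · refine (norm_restr_dev_padded_le Φ hs hp H.clusters hi hv).trans
        (mul_le_mul_of_nonneg_right ?_ (norm_nonneg _))
      have h1 := mul_sqrt_add_sqrt_le_errorFactor hδ0 hs.one_le_b hp rfl hAK hE1
      have h2 : 0 ≤ δ * √(2 * (((K : ℝ) - A.card) * b)) := by positivity
      rw [mul_add, mul_comm δ √(A.card * p)] at h1
      linarith
  have h1 := (abs_le.1 (abs_norm_mulE_sq_sub_le Φ hv)).1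
  have h2 := mul_le_mul_of_nonneg_right key (norm_nonneg v)
  nlinarith

/-- On the selected columns `(1 - E) ‖z - x‖² ≤ ‖Φ (z - x)‖² ≤ ‖e‖²`, and the recovery condition,
with `xmin x ≤ xmax x`, yields `2 ε < (1 - E) xmin x`. The factor `√2` is needed to compare two
entries of `z`. -/
theorem sqrt_two_mul_norm_sub_lt (H : Recoverable Φ x e b p L L' K ε c j)
    (hi : Padding n b p c j i)
    (hz : IsLeastSquares Φ (mulE Φ x + e) (padded n b p i Finset.univ) z) :
    √2 * ‖z - x‖ < xmin x ∧ (e = 0 → z = x) := by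
  have hxT : supp x ⊆ padded n b p i Finset.univ := by
    rw [H.supp_eq]
    exact Finset.biUnion_mono fun s _ => cluster_subset_padding hi s
  have hv : supp (z - x) ⊆ padded n b p i Finset.univ := supp_subset_iff.2 fun t ht => by
    rw [PiLp.sub_apply, supp_subset_iff.1 hz.1 t ht, supp_subset_iff.1 hxT t ht, sub_zero]
  have h1 := H.one_sub_mul_norm_sq_le hi hv
  have h2 := hz.norm_mulE_sub_le hxT
  have hE1 := H.errorFactor_lt_one
  have hbound := H.bound
  have hE0 := errorFactor_nonneg (b := b) (K := K) (pibric_nonneg Φ b p L' L' (K - 1) 2)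
    (zero_le_one.trans H.setting.one_le_width)
  have hδ0 : 0 ≤ pibric Φ b p L' L' (K - 1) 2 := pibric_nonneg ..
  set E := errorFactor (pibric Φ b p L' L' (K - 1) 2) ((p : ℝ) * b - b + 1) b K with hE
  have hε : 0 ≤ ε := (norm_nonneg e).trans H.noise
  have hs1 : 1 ≤ √(1 + pibric Φ b p L' L' (K - 1) 2) := Real.one_le_sqrt.2 (by linarith)
  have hsε := le_mul_of_one_le_left hε hs1
  obtain ⟨hmm, hxmax⟩ := xmin_le_xmax_of_clusters H.setting H.clusters H.supp_eq
  have h3 : 2 * ε < (1 - E) * xmin x := by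
    have := mul_le_mul_of_nonneg_left hmm hE0
    linarith
  have hxmin : 0 < xmin x := by
    have : 0 < (1 - E) * xmin x := by linarith
    exact pos_of_mul_pos_right this (by linarith)
  constructor
  · have h4 : (1 - E) * (√2 * ‖z - x‖) ^ 2 ≤ (1 - E) ^ 2 * (xmin x) ^ 2 / 2 := by
      rw [mul_pow, Real.sq_sqrt (by norm_num)]
      have h5 := pow_le_pow_left₀ (norm_nonneg _) (h2.trans H.noise) 2
      have h6 := pow_le_pow_left₀ (by linarith) h3.le 2
      nlinarith
    have h5 : (√2 * ‖z - x‖) ^ 2 ≤ (1 - E) * (xmin x) ^ 2 / 2 := by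
      have h6 : 0 < 1 - E := by linarith
      refine le_of_mul_le_mul_left ?_ h6
      linarith
    refine lt_of_pow_lt_pow_left₀ 2 hxmin.le (h5.trans_lt ?_)
    nlinarith [sq_nonneg (xmin x), mul_pos hxmin hxmin]
  · rintro rfl
    rw [norm_zero] at h2
    have h4 : ‖mulE Φ (z - x)‖ = 0 := le_antisymm h2 (norm_nonneg _)
    rw [h4] at h1
    have h5 : ‖z - x‖ ^ 2 ≤ 0 := by
      have h6 : 0 < 1 - E := by linarith
      refine le_of_mul_le_mul_left ?_ h6
      linarith
    have h6 : ‖z - x‖ = 0 := by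
      have := le_antisymm h5 (sq_nonneg _)
      exact pow_eq_zero_iff two_ne_zero |>.1 this
    exact sub_eq_zero.1 (norm_eq_zero.1 h6)

/-- The support consists of the dominating entries of the least squares vector. -/
theorem norm_lt_norm (H : Recoverable Φ x e b p L L' K ε c j) (hi : Padding n b p c j i)
    (hz : IsLeastSquares Φ (mulE Φ x + e) (padded n b p i Finset.univ) z) {s t : Fin n}
    (hs : s ∈ supp x) (ht : t ∉ supp x) : ‖z t‖ < ‖z s‖ := by
  have h1 := (H.sqrt_two_mul_norm_sub_lt hi hz).1
  have hst : s ≠ t := by rintro rfl; exact ht hs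
  have hxt : x t = 0 := by rwa [mem_supp, not_not] at ht
  have h2 := xmin_le (mem_supp.1 hs)
  have h3 : ‖z t‖ ^ 2 + ‖z s - x s‖ ^ 2 ≤ ‖z - x‖ ^ 2 := by
    have h4 := norm_restr_mono (Finset.subset_univ {t, s}) (z - x)
    rw [restr_eq_self (Finset.subset_univ (supp (z - x)))] at h4
    have h5 := pow_le_pow_left₀ (norm_nonneg _) h4 2
    rw [norm_restr_sq, Finset.sum_pair hst.symm] at h5
    simpa [hxt] using h5
  -- Both terms are entries of `z - x`, since `x t = 0`; their sum is less than `xmin x ≤ ‖x s‖`.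
  have h4 : ‖z t‖ + ‖z s - x s‖ ≤ √2 * ‖z - x‖ := by
    refine le_of_sq_le_sq ?_ (by positivity)
    rw [mul_pow, Real.sq_sqrt (by norm_num)]
    nlinarith [sq_nonneg (‖z t‖ - ‖z s - x s‖)]
  have h5 := norm_le_insert (z s) (x s)
  linarith

end Recoverable

end

/-! ### The greedy choice finds an undiscovered cluster -/

noncomputable section

variable {𝕜 : Type*} [RCLike 𝕜] {m n b p L L' g K : ℕ} {c j i : Fin g → ℕ}

theorem blockIndices_union (T T' : Finset ℕ) :
    blockIndices n b (T ∪ T') = blockIndices n b T ∪ blockIndices n b T' :=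
  Finset.union_biUnion

theorem blockIndices_blockStarts (hb : 1 ≤ b) (l : ℕ) :
    blockIndices n b (blockStarts b p l) = interval n l (p * b) := by
  ext x
  simp only [blockIndices, blockStarts, Finset.mem_biUnion, Finset.mem_image, Finset.mem_range,
    mem_interval]
  constructor
  · rintro ⟨_, ⟨t, ht, rfl⟩, h1, h2⟩
    have h3 := Nat.mul_le_mul_right b (Nat.succ_le_of_lt ht)
    rw [Nat.succ_mul] at h3
    omega
  · rintro ⟨h1, h2⟩
    have h3 := Nat.div_add_mod' ((x : ℕ) - l) b
    have h4 := Nat.mod_lt ((x : ℕ) - l) hb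
    refine ⟨_, ⟨((x : ℕ) - l) / b, ?_, rfl⟩, by omega, by omega⟩
    rw [Nat.div_lt_iff_lt_mul hb]
    omega

theorem norm_le_corrNorm (Φ : Matrix (Fin m) (Fin n) 𝕜) {S : Finset (Fin n)} {t : Fin n}
    (ht : t ∈ S) (r : EuclideanSpace 𝕜 (Fin m)) : ‖mulE Φᴴ r t‖ ≤ corrNorm Φ S r := by
  rw [corrNorm_eq, ← norm_restr_singleton]
  exact norm_restr_mono (Finset.singleton_subset_iff.2 ht) _

/-- Exchanging an index for a set on which the correlations are smaller increases the norm. -/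
theorem corrNorm_lt_corrNorm (Φ : Matrix (Fin m) (Fin n) 𝕜) {S S' D : Finset (Fin n)}
    {t : Fin n} {r : EuclideanSpace 𝕜 (Fin m)} (ht : t ∈ S') (htS : t ∉ S) (hS : S ⊆ D ∪ S')
    (hD : corrNorm Φ D r < ‖mulE Φᴴ r t‖) : corrNorm Φ S r < corrNorm Φ S' r := by
  rw [corrNorm_eq] at *
  rw [corrNorm_eq]
  set q := mulE Φᴴ r
  have h1 : ‖restr S q‖ ^ 2 ≤ ‖restr D q‖ ^ 2 + ‖restr (S ∩ S') q‖ ^ 2 := by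
    refine (pow_le_pow_left₀ (norm_nonneg _) (norm_restr_mono ?_ q) 2).trans
      (norm_restr_union_sq_le D (S ∩ S') q)
    intro y hy
    rcases Finset.mem_union.1 (hS hy) with h | h
    · exact Finset.mem_union_left _ h
    · exact Finset.mem_union_right _ (Finset.mem_inter.2 ⟨hy, h⟩)
  have h2 : ‖q t‖ ^ 2 + ‖restr (S ∩ S') q‖ ^ 2 ≤ ‖restr S' q‖ ^ 2 := by
    rw [← norm_restr_singleton, ← norm_restr_union_sq (Finset.disjoint_singleton_left.2
      fun h => htS (Finset.mem_inter.1 h).1)]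
    refine pow_le_pow_left₀ (norm_nonneg _) (norm_restr_mono ?_ q) 2
    exact Finset.union_subset (Finset.singleton_subset_iff.2 ht) Finset.inter_subset_right
  have h3 := pow_lt_pow_left₀ hD (norm_nonneg _) two_ne_zero
  exact lt_of_pow_lt_pow_left₀ 2 (norm_nonneg _) (by linarith)

variable {Φ : Matrix (Fin m) (Fin n) 𝕜} {x z : EuclideanSpace 𝕜 (Fin n)}
  {e : EuclideanSpace 𝕜 (Fin m)} {ε : ℝ}

/-- A window with maximal correlations meets an undiscovered cluster. -/
theorem Recoverable.window_meets_remaining (H : Recoverable Φ x e b p L L' K ε c j)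
    (hi : Padding n b p c j i) {A : Finset (Fin g)} (hA : A.card < g)
    (hz : IsLeastSquares Φ (mulE Φ x + e) (padded n b p i A) z) {w : ℕ}
    (hmax : ∀ l < n / L, corrNorm Φ (window n L l) (residual Φ (mulE Φ x + e) z) ≤
      corrNorm Φ (window n L w) (residual Φ (mulE Φ x + e) z)) :
    ¬ Disjoint (window n L w) (remaining n b c j A) := by
  intro hd
  obtain ⟨t, ht⟩ := H.exists_mem_remaining hA
  have hL : 0 < L := by
    have h1 := H.setting.sizes.b_le
    have h2 := H.setting.one_le_b
    have h3 := H.setting.le_L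
    omega
  have h1 := H.corrNorm_lt hi hz ht le_rfl hd
  -- The window that contains `t`; it exists because `L` divides `n`.
  have h2 := hmax (t / L) (Nat.div_lt_div_of_lt_of_dvd H.setting.dvd t.2)
  have h3 : t ∈ window n L (t / L) := by
    rw [window, mem_interval]
    have h4 := Nat.div_add_mod' (t : ℕ) L
    have h5 := Nat.mod_lt (t : ℕ) hL
    omega
  have h4 := norm_le_corrNorm Φ h3 (residual Φ (mulE Φ x + e) z)
  exact absurd (h4.trans h2) (not_le.2 h1)

/-- The selected cluster contains an undiscovered true cluster. -/
theorem Recoverable.exists_selected (H : Recoverable Φ x e b p L L' K ε c j)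
    (hi : Padding n b p c j i) {A : Finset (Fin g)} (hA : A.card < g)
    (hz : IsLeastSquares Φ (mulE Φ x + e) (padded n b p i A) z) {w a' : ℕ}
    (hwmax : ∀ l < n / L, corrNorm Φ (window n L l) (residual Φ (mulE Φ x + e) z) ≤
      corrNorm Φ (window n L w) (residual Φ (mulE Φ x + e) z))
    (hcand : IsCandidate n (p * b) L w a')
    (hmax : ∀ l, IsCandidate n (p * b) L w l →
      corrNorm Φ (interval n l (p * b)) (residual Φ (mulE Φ x + e) z) ≤
        corrNorm Φ (interval n a' (p * b)) (residual Φ (mulE Φ x + e) z)) :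
    ∃ s ∉ A, a' ≤ c s ∧ c s + j s * b ≤ a' + p * b := by
  have hs := H.setting.sizes
  have hc := H.clusters
  have hLp := hs.le_L
  have hL' := hs.L_add_le
  obtain ⟨x₀, hx₀W, hx₀⟩ := Finset.not_disjoint_iff.1
    (H.window_meets_remaining hi hA hz hwmax)
  obtain ⟨s, hsA, hx₀⟩ := Finset.mem_biUnion.1 hx₀
  have hsub : interval n (c s) (j s * b) ⊆ remaining n b c j A :=
    Finset.subset_biUnion_of_mem (fun s => interval n (c s) (j s * b)) hsA
  have hx₀' := mem_interval.1 hx₀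
  rw [window, mem_interval] at hx₀W
  obtain ⟨hc1, hc2, hc3⟩ := hcand
  rw [Nat.succ_mul] at hc2
  have hrange := hc.in_range s
  have hl := Nat.mul_le_mul_right b (hc.le_p s)
  -- intervals near the window only meet the cluster `s`
  have hdis : ∀ d len, w * L ≤ d + p * b → d + len ≤ w * L + L + p * b →
      (d + len ≤ c s ∨ c s + j s * b ≤ d) →
      Disjoint (interval n d len) (remaining n b c j A) := by
    intro d len h1 h2 h3
    rw [remaining, Finset.disjoint_biUnion_right]
    intro r _
    rw [Finset.disjoint_left]
    intro y hy hy'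
    rw [mem_interval] at hy hy'
    rcases lt_trichotomy r s with h | rfl | h
    · have := hc.separated r s h; omega
    · omega
    · have := hc.separated s r h; omega
  -- The exchange: a candidate `a` that gains an undiscovered index `t`, and loses only indices of
  -- an interval without undiscovered ones, beats the maximizer `a'`.
  have hcontra : ∀ (t : Fin n) (a d len : ℕ), t ∈ interval n (c s) (j s * b) → len ≤ L →
      Disjoint (interval n d len) (remaining n b c j A) → IsCandidate n (p * b) L w a →
      t ∈ interval n a (p * b) → t ∉ interval n a' (p * b) →
      interval n a' (p * b) ⊆ interval n d len ∪ interval n a (p * b) → False :=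
    fun t a d len ht hlen hd ha hta hta' hsub' => absurd (hmax a ha) (not_le.2
      (corrNorm_lt_corrNorm Φ hta hta' hsub' (H.corrNorm_lt hi hz (hsub ht) hlen hd)))
  refine ⟨s, Finset.mem_compl.1 hsA, ?_⟩
  by_contra hcon
  by_cases h1 : a' + p * b ≤ c s ∨ c s + j s * b ≤ a'
  · refine hcontra x₀ (min (c s) (n - p * b)) a' (p * b) hx₀ hLp
      (hdis _ _ (by omega) (by omega) h1) ⟨by omega, ?_, by omega⟩ ?_ ?_
      Finset.subset_union_left
    · rw [Nat.succ_mul]; omega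
    · rw [mem_interval]; omega
    · rw [mem_interval]; omega
  · by_cases h2 : c s < a'
    -- The cluster sticks out on the left: shift to the left until the first index of the cluster is
    -- contained. Only the last `a' - c s` indices are lost.
    · refine hcontra ⟨c s, by omega⟩ (c s) (c s + p * b) (a' - c s) (mem_interval.2 ?_) (by omega)
        (hdis _ _ (by omega) (by omega) (by omega)) ⟨by omega, ?_, by omega⟩
        (mem_interval.2 ?_) (fun h => ?_) fun y hy => ?_
      · simp only; omega
      · rw [Nat.succ_mul]; omega
      · simp only; omega
      · have := mem_interval.1 h; simp only at this; omega
      · rw [Finset.mem_union, mem_interval, mem_interval]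
        rw [mem_interval] at hy
        omega
    -- The cluster sticks out on the right: shift to the right until its last index is contained.
    -- The subtraction of `p b` does not truncate, as `a' + p b` lies before the end of the cluster.
    · refine hcontra ⟨c s + j s * b - 1, by omega⟩ (c s + j s * b - p * b) a'
        (c s + j s * b - p * b - a') (mem_interval.2 ?_) (by omega)
        (hdis _ _ (by omega) (by omega) (by omega)) ⟨by omega, ?_, by omega⟩
        (mem_interval.2 ?_) (fun h => ?_) fun y hy => ?_
      · simp only; omega
      · rw [Nat.succ_mul]; omega
      · simp only; omega
      · have := mem_interval.1 h; simp only at this; omega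
      · rw [Finset.mem_union, mem_interval, mem_interval]
        rw [mem_interval] at hy
        omega

end

/-! ### Executions of the algorithm -/

noncomputable section

variable {𝕜 : Type*} [RCLike 𝕜] {m n b p L L' g K : ℕ} {c j : Fin g → ℕ}
  {Φ : Matrix (Fin m) (Fin n) 𝕜} {x : EuclideanSpace 𝕜 (Fin n)}
  {e y : EuclideanSpace 𝕜 (Fin m)} {ε : ℝ} {N : ℕ} {w i : ℕ → ℕ} {T : ℕ → Finset ℕ}
  {z : ℕ → EuclideanSpace 𝕜 (Fin n)}

theorem Setting.exists_isRun (h : Setting Φ b p L L' K) (y : EuclideanSpace 𝕜 (Fin m)) (ε : ℝ) :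
    ∃ N w i T z, IsRun Φ y b p L K ε N w i T z := by
  have hs := h.sizes
  have hL' := hs.L_add_le
  have hlong := hs.long
  have hLp := hs.le_L
  have hbp := hs.b_le
  have hb := hs.one_le_b
  have step : ∀ S : Finset ℕ × EuclideanSpace 𝕜 (Fin n), ∃ (v l : ℕ)
      (S' : Finset ℕ × EuclideanSpace 𝕜 (Fin n)), v < n / L ∧
      (∀ v' < n / L, corrNorm Φ (window n L v') (residual Φ y S.2) ≤
        corrNorm Φ (window n L v) (residual Φ y S.2)) ∧
      IsCandidate n (p * b) L v l ∧
      (∀ l', IsCandidate n (p * b) L v l' →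
        corrNorm Φ (blockIndices n b (blockStarts b p l')) (residual Φ y S.2) ≤
          corrNorm Φ (blockIndices n b (blockStarts b p l)) (residual Φ y S.2)) ∧
      S'.1 = S.1 ∪ blockStarts b p l ∧ IsLeastSquares Φ y (blockIndices n b S'.1) S'.2 := by
    intro S
    obtain ⟨v, hv, hvmax⟩ := Finset.exists_max_image (Finset.range (n / L))
      (fun v => corrNorm Φ (window n L v) (residual Φ y S.2))
      ⟨0, Finset.mem_range.2 (Nat.div_pos (by omega) (by omega))⟩
    rw [Finset.mem_range] at hv
    have hvL : (v + 1) * L ≤ n :=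
      (Nat.mul_le_mul_right L hv).trans (Nat.div_mul_le_self n L)
    rw [Nat.succ_mul] at hvL
    classical
    obtain ⟨l, hl, hlmax⟩ := Finset.exists_max_image
      ((Finset.range (n + 1)).filter (IsCandidate n (p * b) L v))
      (fun l => corrNorm Φ (blockIndices n b (blockStarts b p l)) (residual Φ y S.2))
      -- The interval at the start of the window is a candidate because `p b ≤ L`.
      ⟨v * L, Finset.mem_filter.2 ⟨Finset.mem_range.2 (by omega),
        ⟨by omega, by rw [Nat.succ_mul]; omega, by omega⟩⟩⟩
    obtain ⟨u, hu⟩ := exists_isLeastSquares Φ y (blockIndices n b (S.1 ∪ blockStarts b p l))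
    refine ⟨v, l, (S.1 ∪ blockStarts b p l, u), hv, fun v' hv' => hvmax v' (Finset.mem_range.2 hv'),
      (Finset.mem_filter.1 hl).2, fun l' hl' => hlmax l' (Finset.mem_filter.2 ⟨?_, hl'⟩), rfl, hu⟩
    have := hl'.1
    exact Finset.mem_range.2 (by omega)
  choose fw fl fS h1 h2 h3 h4 h5 h6 using step
  set S : ℕ → Finset ℕ × EuclideanSpace 𝕜 (Fin n) := fun k => fS^[k] (∅, 0) with hS
  have hS' : ∀ k, S (k + 1) = fS (S k) := fun k => Function.iterate_succ_apply' _ _ _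
  have hex : ∃ k, ¬ (ε ≤ ‖residual Φ y (S k).2‖ ∧ k < K) := ⟨K, by simp⟩
  classical
  -- The number of iterations is the first `k` at which the loop condition fails, which happens at
  -- `K` at the latest. Iteration `k + 1` makes its choices from state `k`, hence the index `k - 1`.
  refine ⟨Nat.find hex, fun k => fw (S (k - 1)), fun k => fl (S (k - 1)), fun k => (S k).1,
    fun k => (S k).2, rfl, rfl, fun k hk => not_not.1 (Nat.find_min hex hk), Nat.find_spec hex,
    fun k _ => h1 _, fun k _ => h2 _, fun k _ => h3 _, fun k _ => h4 _, fun k _ => ?_,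
    fun k _ => ?_, fun k _ => ?_⟩
  · simp only [hS', Nat.add_sub_cancel]; exact h5 _
  · simp only [hS']; exact (h6 _).1
  · simp only [hS']; exact (h6 _).2

namespace IsRun

theorem blockIndices_eq (h : IsRun Φ y b p L K ε N w i T z) (hb : 1 ≤ b) {k : ℕ} (hk : k ≤ N) :
    blockIndices n b (T k) =
      (Finset.range k).biUnion fun t => interval n (i (t + 1)) (p * b) := by
  induction k with
  | zero => simp [h.T_zero, blockIndices]
  | succ k ih =>
    rw [h.T_succ k hk, blockIndices_union, ih (by omega), blockIndices_blockStarts hb,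
      Finset.range_add_one, Finset.biUnion_insert, Finset.union_comm]

theorem isLeastSquares (h : IsRun Φ y b p L K ε N w i T z) {k : ℕ} (hk : k ≤ N) :
    IsLeastSquares Φ y (blockIndices n b (T k)) (z k) := by
  cases k with
  | zero =>
    rw [h.T_zero, h.z_zero, blockIndices, Finset.biUnion_empty]
    refine ⟨supp_subset_iff.2 fun _ _ => rfl, fun u hu => ?_⟩
    have : u = 0 := by ext t; exact supp_subset_iff.1 hu t (Finset.notMem_empty t)
    rw [this]
  | succ k => exact ⟨h.supp_z k hk, h.least_squares k hk⟩

end IsRun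

/-- The cluster selected in iteration `t + 1` contains the true cluster `f t`, for all `t < k`. -/
structure Selects (b p : ℕ) (c j : Fin g → ℕ) (i : ℕ → ℕ) (k : ℕ) (f : ℕ → Fin g) : Prop where
  injOn : ∀ t < k, ∀ t' < k, f t = f t' → t = t'
  contains : ∀ t < k, i (t + 1) ≤ c (f t) ∧ c (f t) + j (f t) * b ≤ i (t + 1) + p * b

theorem Selects.card_image {k : ℕ} {f : ℕ → Fin g} (hf : Selects b p c j i k f) :
    ((Finset.range k).image f).card = k := by
  rw [Finset.card_image_of_injOn, Finset.card_range]
  intro t ht t' ht' h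
  exact hf.injOn t (Finset.mem_range.1 ht) t' (Finset.mem_range.1 ht') h

theorem Selects.exists_padding (hs : Sizes n b p L L' K) (hc : TrueClusters n b p L' K c j)
    {k : ℕ} {f : ℕ → Fin g} (hf : Selects b p c j i k f)
    (hi : ∀ t < k, i (t + 1) + p * b ≤ n) :
    ∃ i' : Fin g → ℕ, Padding n b p c j i' ∧ padded n b p i' ((Finset.range k).image f) =
      (Finset.range k).biUnion fun t => interval n (i (t + 1)) (p * b) := by
  have h1 : ∀ s, ∃ v, (v ≤ c s ∧ c s + j s * b ≤ v + p * b ∧ v + p * b ≤ n) ∧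
      ∀ t < k, f t = s → v = i (t + 1) := by
    intro s
    by_cases h : ∃ t < k, f t = s
    · obtain ⟨t, ht, rfl⟩ := h
      refine ⟨i (t + 1), ⟨(hf.contains t ht).1, (hf.contains t ht).2, hi t ht⟩,
        fun t' ht' heq => ?_⟩
      rw [hf.injOn t' ht' t ht heq]
    -- An undiscovered cluster gets an arbitrary admissible padding: `Padding` concerns all
    -- clusters, but only those in the image of `f` enter the union.
    · refine ⟨min (c s) (n - p * b), ?_, fun t ht heq => absurd ⟨t, ht, heq⟩ h⟩
      have h2 := hc.in_range s
      have h3 := Nat.mul_le_mul_right b (hc.le_p s)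
      have h4 := hs.L_add_le
      have h5 := hs.long
      omega
  choose i' h2 h3 using h1
  refine ⟨i', h2, ?_⟩
  rw [padded, Finset.image_biUnion]
  exact Finset.biUnion_congr rfl fun t ht => by rw [h3 (f t) t (Finset.mem_range.1 ht) rfl]

namespace Recoverable

theorem exists_padding (H : Recoverable Φ x e b p L L' K ε c j)
    (h : IsRun Φ y b p L K ε N w i T z) {k : ℕ} (hk : k ≤ N) {f : ℕ → Fin g}
    (hf : Selects b p c j i k f) :
    ∃ i' : Fin g → ℕ, Padding n b p c j i' ∧
      blockIndices n b (T k) = padded n b p i' ((Finset.range k).image f) := by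
  obtain ⟨i', h1, h2⟩ := hf.exists_padding H.setting.sizes H.clusters
    fun t ht => (h.cluster_mem t (by omega)).1
  exact ⟨i', h1, by rw [h2, h.blockIndices_eq H.setting.one_le_b hk]⟩

/-- Induction on the iterations: while fewer than `g` clusters are found, the residual is at least
`ε` and `k < g ≤ K`, so the loop continues, and the next interval contains a cluster outside the
image of `f`. -/
theorem exists_selects (H : Recoverable Φ x e b p L L' K ε c j)
    (h : IsRun Φ (mulE Φ x + e) b p L K ε N w i T z) {k : ℕ} (hk : k ≤ g) :
    k ≤ N ∧ ∃ f : ℕ → Fin g, Selects b p c j i k f := by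
  induction k with
  | zero =>
    have hg : 0 < g := by
      by_contra hg
      have h1 := H.clusters.sum_eq
      have h2 := H.setting.one_le_K
      obtain rfl : g = 0 := by omega
      simp at h1
      omega
    exact ⟨Nat.zero_le _, fun _ => ⟨0, hg⟩, by omega, by omega⟩
  | succ k ih =>
    obtain ⟨hkN, f, hf⟩ := ih (by omega)
    obtain ⟨i', hi', hT⟩ := H.exists_padding h hkN hf
    have hz := h.isLeastSquares hkN
    rw [hT] at hz
    have hA : ((Finset.range k).image f).card < g := by rw [hf.card_image]; omega
    have hloop := H.le_norm_residual hi' hz hA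
    have hgK := H.clusters.card_le
    have hkN' : k < N := by
      refine lt_of_le_of_ne hkN ?_
      rintro rfl
      exact h.exit_cond ⟨hloop, by omega⟩
    have hb := H.setting.one_le_b
    obtain ⟨s, hsA, hsel⟩ := H.exists_selected hi' hA hz (h.window_max k hkN')
      (h.cluster_mem k hkN') fun l hl => by
        have := h.cluster_max k hkN' l hl
        rwa [blockIndices_blockStarts hb, blockIndices_blockStarts hb] at this
    have hs : ∀ t < k, f t ≠ s := fun t ht heq =>
      hsA (Finset.mem_image.2 ⟨t, Finset.mem_range.2 ht, heq⟩)
    refine ⟨hkN', fun t => if t < k then f t else s, fun t ht t' ht' heq => ?_, fun t ht => ?_⟩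
    · by_cases h1 : t < k <;> by_cases h2 : t' < k
      · simp only [h1, h2, if_true] at heq
        exact hf.injOn t h1 t' h2 heq
      · simp only [h1, h2, if_true, if_false] at heq
        exact absurd heq (hs t h1)
      · simp only [h1, h2, if_true, if_false] at heq
        exact absurd heq.symm (hs t' h2)
      · omega
    · by_cases h1 : t < k
      · simp only [h1, if_true]
        exact hf.contains t h1
      · obtain rfl : t = k := by omega
        simp only [lt_irrefl, if_false]
        exact hsel

theorem recoversSupport (H : Recoverable Φ x e b p L L' K ε c j) :
    RecoversSupport Φ x e b p L L' K ε := by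
  refine ⟨H.setting.exists_isRun _ ε, g, c, j, H.clusters, H.supp_eq, fun N w i T z h => ?_⟩
  obtain ⟨hgN, f, hf⟩ := H.exists_selects h le_rfl
  obtain ⟨i', hi', hT⟩ := H.exists_padding h hgN hf
  have hb := H.setting.one_le_b
  have huniv : (Finset.range g).image f = Finset.univ :=
    Finset.eq_univ_of_card _ (by rw [hf.card_image, Fintype.card_fin])
  rw [huniv] at hT
  have hz := h.isLeastSquares hgN
  have hsub : supp x ⊆ blockIndices n b (T g) := by
    rw [H.supp_eq, hT]
    exact Finset.biUnion_mono fun s _ => cluster_subset_padding hi' s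
  have hres : ‖residual Φ (mulE Φ x + e) (z g)‖ ≤ ‖e‖ := by
    have := hz.2 x hsub
    rwa [residual, residual, add_sub_cancel_left] at this
  rw [hT] at hz
  refine ⟨hgN, ?_, fun he => ?_, ?_, hsub, hsub.trans ?_, fun hj => ?_,
    fun s hs t ht => H.norm_lt_norm hi' hz hs ht, (H.sqrt_two_mul_norm_sub_lt hi' hz).2⟩
  · rcases Nat.eq_zero_or_pos N with h0 | h0
    · omega
    · have := (h.loop (N - 1) (by omega)).2
      omega
  -- After `g` iterations `x` itself competes in the least squares problem, so the residual is at
  -- most `‖e‖ < ε` and the loop ends.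
  · refine le_antisymm (not_lt.1 fun hlt => ?_) hgN
    exact absurd ((h.loop g hlt).1.trans hres) (not_le.2 he)
  · have hinj : Function.Injective fun k : Fin g => f k := fun k k' hk =>
      Fin.ext (hf.injOn k k.2 k' k'.2 hk)
    exact ⟨Equiv.ofBijective _ (Finite.injective_iff_bijective.1 hinj),
      fun k => hf.contains k k.2⟩
  · rw [h.blockIndices_eq hb hgN, h.blockIndices_eq hb le_rfl]
    exact Finset.biUnion_subset_biUnion_of_subset_left _ (Finset.range_subset_range.2 hgN)
  · rw [hT, H.supp_eq]
    refine Finset.biUnion_congr rfl fun s _ => ?_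
    have h1 := hi' s
    rw [hj s] at h1 ⊢
    rw [show i' s = c s by omega]

end Recoverable

theorem exists_trueClusters (hx : IsPIBS b p L L' K 0 x) : ∃ (g : ℕ) (c j : Fin g → ℕ),
    TrueClusters n b p L' K c j ∧ supp x = clusterSet n b c j := by
  obtain ⟨g, c, j, q, a, hc, hq, -, -, -, hsupp⟩ := hx
  obtain rfl : q = 0 := by omega
  exact ⟨g, c, j, hc, by simpa using hsupp⟩

/-- The recovery theorem under the condition for real signals. -/
theorem recoversSupport_of_lt {δ B' : ℝ} (h : Setting Φ b p L L' K) (hx : IsPIBS b p L L' K 0 x)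
    (he : ‖e‖ ≤ ε) (hδ : δ = pibric Φ b p L' L' (K - 1) 2) (hB' : B' = (p : ℝ) * b - b + 1)
    (hδK : δ < 1 / √(2 * (K : ℝ) + 1))
    (hbound : errorFactor δ B' b K * xmax x +
      √(2 * (1 + B') * (1 + δ)) * ε / (1 - δ * √(2 * (K : ℝ) + 1)) < xmin x) :
    RecoversSupport Φ x e b p L L' K ε := by
  obtain ⟨g, c, j, hc, hsupp⟩ := exists_trueClusters hx
  subst hδ hB'
  refine (⟨h, hc, hsupp, he, hδK, lt_of_le_of_lt ?_ hbound⟩ :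
    Recoverable Φ x e b p L L' K ε c j).recoversSupport
  have hε : 0 ≤ ε := (norm_nonneg e).trans he
  have h1 := mul_le_mul_of_nonneg_right
    (two_mul_sqrt_le_noiseFactor (pibric_nonneg Φ b p L' L' (K - 1) 2) h.one_le_width hδK) hε
  rw [div_mul_eq_mul_div] at h1
  linarith

end

end TSGBOMP

open TSGBOMP in
theorem theorem1 (m n b p L L' K : ℕ) (ε : ℝ) :
    -- real case
    (∀ (Φ : Matrix (Fin m) (Fin n) ℝ) (x : EuclideanSpace ℝ (Fin n))
      (e : EuclideanSpace ℝ (Fin m)) (δ B' : ℝ),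
      Setting Φ b p L L' K → IsPIBS b p L L' K 0 x → ‖e‖ ≤ ε →
      δ = pibric Φ b p L' L' (K - 1) 2 → B' = (p : ℝ) * b - b + 1 →
      δ < 1 / √(2 * (K : ℝ) + 1) →
      xmin x > xmax x * δ * √(B' * b) / (1 + δ) *
            (K / (4 * B') * (1 + δ) + √((K : ℝ) + 1) + 1) +
          √(2 * (1 + B') * (1 + δ)) * ε / (1 - δ * √(2 * (K : ℝ) + 1)) →
      RecoversSupport Φ x e b p L L' K ε) ∧
    -- complex case
    (∀ (Φ : Matrix (Fin m) (Fin n) ℂ) (x : EuclideanSpace ℂ (Fin n))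
      (e : EuclideanSpace ℂ (Fin m)) (δ B' : ℝ),
      Setting Φ b p L L' K → IsPIBS b p L L' K 0 x → ‖e‖ ≤ ε →
      δ = pibric Φ b p L' L' (K - 1) 2 → B' = (p : ℝ) * b - b + 1 →
      δ < 1 / √(2 * (K : ℝ) + 1) →
      xmin x > (δ * √((K : ℝ) * b) + δ * (1 - δ ^ 2) * √(B' * b) / (1 + δ) *
            (K / (4 * B') * (1 + δ) + √((K : ℝ) + 1) + 1)) * xmax x /
              √((1 - δ ^ 2) ^ 2 + δ ^ 2) +
          √(2 * (1 + B') * (1 + δ)) * ε / (1 - δ * √(2 * (K : ℝ) + 1)) →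
      RecoversSupport Φ x e b p L L' K ε) := by
  constructor
  · intro Φ x e δ B' h hx he hδ hB' hδK hbound
    refine recoversSupport_of_lt h hx he hδ hB' hδK (lt_of_eq_of_lt ?_ hbound)
    rw [errorFactor]
    ring
  · intro Φ x e δ B' h hx he hδ hB' hδK hbound
    refine recoversSupport_of_lt h hx he hδ hB' hδK ?_
    obtain ⟨g, c, j, hc, hsupp⟩ := exists_trueClusters hx
    obtain ⟨hmm, hpos⟩ := xmin_le_xmax_of_clusters h hc hsupp
    have hδ0 : 0 ≤ δ := hδ ▸ pibric_nonneg ..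
    have hB1 : 1 ≤ B' := hB' ▸ h.one_le_width
    have hε : 0 ≤ ε := (norm_nonneg e).trans he
    -- The noise factor is nonnegative because it is at least `2 √(1 + δ)`; the sign of its
    -- denominator is hidden in that bound.
    refine recovery_condition_of_complex hδ0 (lt_one_of_small hδK) h.one_le_b h.one_le_K
      (by linarith) hmm hpos (le_trans ?_ (mul_le_mul_of_nonneg_right
        (two_mul_sqrt_le_noiseFactor hδ0 hB1 hδK) hε |>.trans_eq (div_mul_eq_mul_div ..))) hbound
    positivity
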